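/- Let $M$ be a smooth $10$-manifold, $P_{YM}\to M$ a principal bundle with compact structure group $K$ (Lie algebra $\mathfrak k$), and $P_M\to M$ an $SL(10,\mathbb R)$-bundle of frames of $TM$ (the frames of unit volume for a volume form). Put $P=P_{YM}\times_M P_M$, $G=K\times SL(10,\mathbb R)$, $\mathfrak g=\mathfrak k\oplus\mathfrak{sl}(10,\mathbb R)$. Let $\operatorname{tr}_{\mathfrak k}$ be a nondegenerate $\mathrm{Ad}$-invariant symmetric bilinear form on $\mathfrak k$ (such as the Killing form of a semisimple $\mathfrak k$), let $\operatorname{tr}$ be a fixed non-zero multiple of the trace form $(X,Y)\mapsto\operatorname{Tr}(XY)$ on matrices, let $\alpha'>0$, and let $$c=\alpha'(\operatorname{tr}-\operatorname{tr}_{\mathfrak k})$$ on $\mathfrak g$. Assume that $p_1(P)=0$ with respect to $c$, and let $\hat E$ be an exact Courant algebroid over $P$ with an equivariant lifted $G$-action $\rho$ with $-\langle\rho(z),\rho(z)\rangle=c(z,z)$ that admits an equivariant isotropic splitting (it exists because $p_1(P)=0$ and is unique up to isomorphism). That is, $\hat E=TP\oplus T^*P$ with $\langle X+\xi,Y+\eta\rangle=\frac12(\eta(X)+\xi(Y))$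 and $[X+\xi,Y+\eta]=[X,Y]+L_X\eta-i_Yd\xi+i_Yi_X\hat H$ for a closed invariant 3-form $\hat H$, and $\rho(z)=Y_z+\xi_z$, where $Y_z$ is the fundamental vector field, $d\xi_z=i_{Y_z}\hat H$ and $R_a^*\xi_z=\xi_{\mathrm{Ad}(a)z}$. Let $E=\rho(\mathfrak g)^\perp/G$ be the reduced transitive Courant algebroid over $M$, with anchor $\pi:E\to T=TM$. Let $V_+\subset E$ be an admissible metric, i.e. a subbundle on which the pairing is nondegenerate, with $V_+\cap T^*=0$ and $\operatorname{rk}V_+=\operatorname{rk}E-\dim M$; let $V_-=V_+^\perp$. It determines a metric $g$ on $M$ (the restriction of the pairing to the orthogonal complement of $V_+\cap\operatorname{Ker}\pi$ in $V_+$, which $\pi$ identifies with $T$), an isotropic splitting $\lambda:T\to E$, $\lambda(X)=\pi_\perp^{-1}(X)-g(X)$, where $\pi_\perp$ is the restriction of $\pi$ to that complement, a connection on $P$ (its horizontal lift is the $TP$-component of $\lambda$) with curvature $F$, and a 3-form $H(X,Y,Z)=2\langle[\lambda X,\lambda Y],\lambda Z\rangle$ on $M$. Assume that $g$ has signature $(1,9)$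 and that the connection on $P$ is the product of a connection $A$ on $P_{YM}$, with curvature $F_A$, and a connection $\nabla^T$ on $TM$ compatible with $g$, with curvature $R$. Let $\phi\in C^\infty(M)$ and $\varphi=\frac{-6}{\operatorname{rk}V_+-1}d\phi$. In the splitting $E\cong T\oplus\operatorname{ad}P\oplus T^*$ given by $\lambda$, let $D'=\nabla^g\oplus\nabla^A\oplus\nabla^{g*}$, where $\nabla^g$ is the Levi-Civita connection and $\nabla^A$ is here the connection on $\operatorname{ad}P$ induced by the connection on $P$. Let $\chi=\chi^0+\chi^\varphi$, where $\langle\chi^0_{e_1}e_2,e_3\rangle=(\frac12\pi^*H-CS)(e_1,e_2,e_3)$, $$CS(e_1,e_2,e_3)=-c(r_1,[r_2,r_3])+c(F(X_1,X_2),r_3)-c(F(X_1,X_3),r_2)+c(F(X_2,X_3),r_1)$$ for $e_i=X_i+r_i+\xi_i$ (sections $r_i$ of $\operatorname{ad}P$ being regarded as invariant vertical vector fields on $P$ and $[r_2,r_3]$ being the bracket of vector fields), and $\chi^\varphi_{e_1}e_2=\varphi(e_2)e_1-\langle e_1,e_2\rangle\langle\cdot,\cdot\rangle^{-1}\varphi$.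 Let $\chi^{abc}_{e_1}e_2$ be the projection to $V_a$ of $\chi_{e_1^b}e_2^c$, where $e^\pm$ are the components of $e$ in $E=V_+\oplus V_-$, and let $$D=D^\varphi=D'+\tfrac13\chi^{+++}+\tfrac13\chi^{---}+\chi^{+-+}+\chi^{-+-},$$ a torsion-free generalized connection compatible with $V_+$. Let $GR(e_1,e_2)e_3=D_{e_1}D_{e_2}e_3-D_{e_2}D_{e_1}e_3-D_{[[e_1,e_2]]}e_3$, with the skew-symmetrized bracket $[[\cdot,\cdot]]$, and for $e_2\in V_-$, $e_3\in V_+$ let $\mathrm{GRic}(e_2,e_3)$ be the trace of the endomorphism $e_1\mapsto GR(e_1,e_2)e_3$ of $V_+$. Then $\mathrm{GRic}=0$ if and only if $(g,\phi,H,A,\nabla^T)$ satisfies $$\operatorname{Ric}^g+2\nabla^g(d\phi)-\tfrac14H\circ H+\alpha'\operatorname{tr}_{\mathfrak k}F_A\circ F_A-\alpha'\operatorname{tr}R\circ R=0,\qquad d^*(e^{-2\phi}H)=0,$$ $$d_A^*(e^{-2\phi}F_A)+\tfrac12e^{-2\phi}*(F_A\wedge*H)=0,\qquad d_{\nabla^T}^*(e^{-2\phi}R)+\tfrac12e^{-2\phi}*(R\wedge*H)=0,$$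 $$dH=\alpha'(\operatorname{tr}R\wedge R-\operatorname{tr}_{\mathfrak k}F_A\wedge F_A).$$ Here, for a local frame $e_j$ of $TM$ with $g$-dual frame $e^j$, $H\circ H(Y,Z)=\sum_{j,k}H(e_j,Y,e_k)H(e^j,Z,e^k)$, $\operatorname{tr}R\circ R(Y,Z)=\sum_j\operatorname{tr}(R(Y,e_j)R(Z,e^j))$ and likewise for $F_A$; the adjoints $d^*$, $d_A^*$, $d_{\nabla^T}^*$ of a form $\beta$ are $-\sum_ji_{e^j}\nabla_{e_j}\beta$, with $\nabla$ built from $\nabla^g$ and the connection in the coefficients; and $*(F_A\wedge*H)$ denotes the 1-form $Y\mapsto-\sum_jF_A(e_j,g^{-1}H(e^j,Y,\cdot))$, and likewise for $R$. -/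

import Mathlib

open scoped Manifold ContDiff TensorProduct

set_option linter.unusedSectionVars false

noncomputable section

namespace Heterotic

/-! ## Calculus over a commutative algebra

Vector fields on a manifold are the derivations of its algebra `A` of smooth functions, and
differential forms are the alternating `A`-multilinear maps on vector fields (for the Hausdorff
σ-compact finite-dimensional manifolds used below these are the usual smooth objects). -/

section Calculus

variable (A : Type*) [CommRing A] [Algebra ℝ A]

/-- Vector fields. -/
abbrev VF := Derivation ℝ A A

/-- Differential 1-forms. -/
abbrev Form1 := VF A →ₗ[A] A

/-- Differential 3-forms. -/
abbrev Form3 := VF A [⋀^Fin 3]→ₗ[A] A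

/-- Sections `X + ξ` of the generalized tangent bundle `T ⊕ T*`. -/
abbrev GT := VF A × Form1 A

variable {A}

lemma lie_smul_vf (X Y : VF A) (a : A) : ⁅X, a • Y⁆ = X a • Y + a • ⁅X, Y⁆ := by
  ext f
  simp only [Derivation.commutator_apply, Derivation.smul_apply, Derivation.add_apply,
    Derivation.leibniz, smul_eq_mul]
  ring

/-- The differential of a function. -/
def dFn (f : A) : Form1 A where
  toFun X := X f
  map_add' _ _ := rfl
  map_smul' _ _ := rfl

/-- `dξ(X,Y) = X ξ(Y) - Y ξ(X) - ξ([X,Y])`. -/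
def d1 (ξ : Form1 A) (X Y : VF A) : A := X (ξ Y) - Y (ξ X) - ξ ⁅X, Y⁆

/-- The exterior differential of a 3-form, evaluated on four vector fields. -/
def d3 (H : Form3 A) (X Y Z W : VF A) : A :=
  X (H ![Y, Z, W]) - Y (H ![X, Z, W]) + Z (H ![X, Y, W]) - W (H ![X, Y, Z])
    - H ![⁅X, Y⁆, Z, W] + H ![⁅X, Z⁆, Y, W] - H ![⁅X, W⁆, Y, Z]
    - H ![⁅Y, Z⁆, X, W] + H ![⁅Y, W⁆, X, Z] - H ![⁅Z, W⁆, X, Y]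

/-- The Lie derivative `L_X η` of a 1-form. -/
def lieForm (X : VF A) (η : Form1 A) : Form1 A where
  toFun Z := X (η Z) - η ⁅X, Z⁆
  map_add' Z W := by
    simp only [map_add, lie_add]
    ring
  map_smul' a Z := by
    simp only [map_smul, lie_smul_vf, map_add, smul_eq_mul, Derivation.leibniz, RingHom.id_apply]
    ring

/-- The 1-form `i_Y dξ`. -/
def contrD (Y : VF A) (ξ : Form1 A) : Form1 A where
  toFun Z := d1 ξ Y Z
  map_add' Z W := by
    simp only [d1, map_add, lie_add, Derivation.add_apply]
    ring
  map_smul' a Z := by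
    simp only [d1, map_smul, lie_smul_vf, map_add, smul_eq_mul, Derivation.leibniz,
      Derivation.smul_apply, RingHom.id_apply]
    ring

/-- The 1-form `i_Y i_X H = H(X, Y, ·)`. -/
def contr2 (H : Form3 A) (X Y : VF A) : Form1 A where
  toFun Z := H ![X, Y, Z]
  map_add' Z W := by
    have h := ((H.curryLeft X).curryLeft Y).map_vecCons_add ![] Z W
    simpa using h
  map_smul' a Z := by
    have h := ((H.curryLeft X).curryLeft Y).map_vecCons_smul ![] a Z
    simpa using h

lemma contr2_apply (H : Form3 A) (X Y Z : VF A) : contr2 H X Y Z = H ![X, Y, Z] := rfl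

/-- `⟨X + ξ, Y + η⟩ = ½ (η(X) + ξ(Y))`. -/
def pair (u v : GT A) : A := (1 / 2 : ℝ) • (v.2 u.1 + u.2 v.1)

lemma pair_add_left (u v w : GT A) : pair (u + v) w = pair u w + pair v w := by
  simp only [pair, Prod.fst_add, Prod.snd_add, map_add, LinearMap.add_apply, ← smul_add]
  congr 1
  ring

lemma pair_smul_left (t : ℝ) (u v : GT A) : pair (t • u) v = t • pair u v := by
  simp [pair, smul_comm t, LinearMap.map_smul_of_tower]

/-- The Dorfman bracket `[X + ξ, Y + η] = [X,Y] + L_X η - i_Y dξ + i_Y i_X H` on `T ⊕ T*`. -/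
def dorfman (H : Form3 A) (u v : GT A) : GT A :=
  (⁅u.1, v.1⁆, lieForm u.1 v.2 - contrD v.1 u.2 + contr2 H u.1 v.1)

lemma dorfman_add_right (H : Form3 A) (u v w : GT A) :
    dorfman H u (v + w) = dorfman H u v + dorfman H u w := by
  refine Prod.ext ?_ (LinearMap.ext fun Z => ?_)
  · simp [dorfman]
  · have h : H ![u.1, v.1 + w.1, Z] = H ![u.1, v.1, Z] + H ![u.1, w.1, Z] := by
      simpa using (H.curryLeft u.1).map_vecCons_add ![Z] v.1 w.1
    simp only [dorfman, lieForm, contrD, contr2_apply, d1, Prod.fst_add, Prod.snd_add,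
      LinearMap.add_apply, LinearMap.sub_apply, LinearMap.coe_mk, AddHom.coe_mk, map_add, add_lie,
      Derivation.add_apply, h]
    ring

lemma dorfman_smul_right (H : Form3 A) (u v : GT A) (t : ℝ) :
    dorfman H u (t • v) = t • dorfman H u v := by
  refine Prod.ext ?_ (LinearMap.ext fun Z => ?_)
  · simp [dorfman]
  · have h : H ![u.1, t • v.1, Z] = t • H ![u.1, v.1, Z] := by
      have h := (H.curryLeft u.1).map_vecCons_smul ![Z] (algebraMap ℝ A t) v.1
      simpa [algebraMap_smul, Algebra.smul_def] using h
    simp only [dorfman, lieForm, contrD, contr2_apply, d1, Prod.smul_fst, Prod.smul_snd,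
      LinearMap.add_apply, LinearMap.sub_apply, LinearMap.coe_mk, AddHom.coe_mk, smul_lie,
      LinearMap.smul_apply, Derivation.smul_apply, Derivation.map_smul,
      LinearMap.map_smul_of_tower, h, smul_sub, smul_add]

/-- The skew-symmetrized bracket `[[u,v]]`. -/
def courant (H : Form3 A) (u v : GT A) : GT A :=
  (1 / 2 : ℝ) • (dorfman H u v - dorfman H v u)

end Calculus

/-! ## Pseudo-Riemannian geometry on `M`, with `B = C^∞(M)` -/

section Metric

variable (B : Type*) [CommRing B] [Algebra ℝ B]

/-- A pseudo-Riemannian metric: a symmetric bilinear form on vector fields that identifies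
vector fields with 1-forms. -/
structure PseudoMetric where
  /-- the bilinear form -/
  toForm : VF B →ₗ[B] Form1 B
  symm : ∀ X Y, toForm X Y = toForm Y X
  nondegenerate : Function.Bijective toForm

variable {B} (g : PseudoMetric B)

/-- The Koszul expression, equal to `2 g(∇_X Y, Z)`. -/
def PseudoMetric.koszul (X Y Z : VF B) : B :=
  X (g.toForm Y Z) + Y (g.toForm X Z) - Z (g.toForm X Y)
    + g.toForm ⁅X, Y⁆ Z - g.toForm ⁅X, Z⁆ Y - g.toForm ⁅Y, Z⁆ X

/-- The Levi-Civita connection `∇^g_X Y`: the vector field `W` determined by Koszul's formula. -/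
def PseudoMetric.nabla (X Y : VF B) : VF B :=
  Classical.epsilon fun W => ∀ Z, g.toForm W Z = (1 / 2 : ℝ) • g.koszul X Y Z

/-- The curvature `R(X,Y)Z` of a connection on the tangent bundle. -/
def curv (D : VF B → VF B → VF B) (X Y Z : VF B) : VF B :=
  D X (D Y Z) - D Y (D X Z) - D ⁅X, Y⁆ Z

/-- The covariant derivative `(∇_X H)(Y,Z,W)` of a 3-form. -/
def PseudoMetric.nabla3 (H : Form3 B) (X Y Z W : VF B) : B :=
  X (H ![Y, Z, W]) - H ![g.nabla X Y, Z, W] - H ![Y, g.nabla X Z, W] - H ![Y, Z, g.nabla X W]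

/-- The trace of an endomorphism `T` of the tangent bundle in a frame `e` with `g`-dual
frame `e'`. -/
def PseudoMetric.tr {n : ℕ} (e e' : Fin n → VF B) (T : VF B → VF B) : B :=
  ∑ l, g.toForm (T (e l)) (e' l)

end Metric

/-! ## Principal bundles -/

section Principal

variable {EG HG G EP P EM M : Type*}
  [NormedAddCommGroup EG] [NormedSpace ℝ EG] [TopologicalSpace HG] (IG : ModelWithCorners ℝ EG HG)
  [TopologicalSpace G] [ChartedSpace HG G] [Group G] [LieGroup IG ∞ G]
  [NormedAddCommGroup EP] [NormedSpace ℝ EP] [TopologicalSpace P] [ChartedSpace EP P]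
  [IsManifold 𝓘(ℝ, EP) ∞ P]
  [NormedAddCommGroup EM] [NormedSpace ℝ EM] [TopologicalSpace M] [ChartedSpace EM M]

/-- The algebra of smooth real functions on a manifold modelled on `E`. -/
abbrev Fn (E X : Type*) [NormedAddCommGroup E] [NormedSpace ℝ E] [TopologicalSpace X]
    [ChartedSpace E X] := C^∞⟮𝓘(ℝ, E), X; ℝ⟯

/-- The exponential of a smooth function. -/
def expFn (f : Fn EM M) : Fn EM M :=
  ⟨fun x => Real.exp (f x), (Real.contDiff_exp.contMDiff (n := ∞)).comp f.contMDiff⟩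

/-- The derivative at `1` of a function on a Lie group along a vector `z` of the Lie algebra
`T_1 G`, which is the model space of `G`. -/
def dOne (f : G → ℝ) (z : EG) : ℝ := mfderiv IG 𝓘(ℝ, ℝ) f 1 z

/-- The adjoint representation on the Lie algebra `T_1 G`. -/
def Ad (a : G) : EG →ₗ[ℝ] EG where
  toFun z := mfderiv IG IG (fun x : G => a * x * a⁻¹) 1 z
  map_add' z w := map_add (mfderiv IG IG (fun x : G => a * x * a⁻¹) 1) z w
  map_smul' t z := map_smul (mfderiv IG IG (fun x : G => a * x * a⁻¹) 1) t z

variable (G EP P EM M) in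
/-- A smooth principal `G`-bundle `proj : P → M`, with `G` acting on the right. -/
structure PrincipalBundle where
  /-- the projection -/
  proj : C^∞⟮𝓘(ℝ, EP), P; 𝓘(ℝ, EM), M⟯
  /-- the right action -/
  act : P → G → P
  act_smooth : ContMDiff (𝓘(ℝ, EP).prod IG) 𝓘(ℝ, EP) ∞ fun q : P × G => act q.1 q.2
  act_one : ∀ p, act p 1 = p
  act_mul : ∀ p a b, act (act p a) b = act p (a * b)
  free : ∀ p a, act p a = p → a = 1
  proj_act : ∀ p a, proj (act p a) = proj p
  /-- `(y, a) ↦ act (σ y) a` is a local trivialization over `U`, with inverse `(proj, γ)` -/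
  locally_trivial : ∀ x : M, ∃ U : Set M, IsOpen U ∧ x ∈ U ∧ ∃ (σ : M → P) (γ : P → G),
    ContMDiffOn 𝓘(ℝ, EM) 𝓘(ℝ, EP) ∞ σ U ∧ ContMDiffOn 𝓘(ℝ, EP) IG ∞ γ (proj ⁻¹' U) ∧
    (∀ y ∈ U, proj (σ y) = y) ∧ ∀ p, proj p ∈ U → p = act (σ (proj p)) (γ p)

variable {IG} (Q : PrincipalBundle G EP P EM M IG)

namespace PrincipalBundle

/-- Right translation `R_a`. -/
def rmap (a : G) : C^∞⟮𝓘(ℝ, EP), P; 𝓘(ℝ, EP), P⟯ :=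
  ⟨fun p => Q.act p a, Q.act_smooth.comp (contMDiff_id.prodMk contMDiff_const)⟩

/-- Pull-back of functions from `M` to `P`. -/
def pull : Fn EM M →ₐ[ℝ] Fn EP P where
  toFun f := f.comp Q.proj
  map_one' := rfl
  map_mul' _ _ := rfl
  map_zero' := rfl
  map_add' _ _ := rfl
  commutes' _ := rfl

/-- Pull-back `R_a^*` of functions on `P`. -/
def rpull (a : G) : Fn EP P →ₐ[ℝ] Fn EP P where
  toFun f := f.comp (Q.rmap a)
  map_one' := rfl
  map_mul' _ _ := rfl
  map_zero' := rfl
  map_add' _ _ := rfl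
  commutes' _ := rfl

lemma rpull_rpull_inv (a : G) (f : Fn EP P) : Q.rpull a (Q.rpull a⁻¹ f) = f := by
  ext p
  change f (Q.act (Q.act p a) a⁻¹) = f p
  rw [Q.act_mul, mul_inv_cancel, Q.act_one]

/-- Pull-back `R_a^*` of vector fields on `P`. -/
def rpullVF (a : G) (Z : VF (Fn EP P)) : VF (Fn EP P) :=
  Derivation.mk' ((Q.rpull a).toLinearMap ∘ₗ (Z : Fn EP P →ₗ[ℝ] Fn EP P) ∘ₗ
    (Q.rpull a⁻¹).toLinearMap) fun f h => by
      simp [rpull_rpull_inv]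

/-- The vector field `X` on `P` projects to the vector field `Y` on `M`. -/
def Related (X : VF (Fn EP P)) (Y : VF (Fn EM M)) : Prop :=
  ∀ f, X (Q.pull f) = Q.pull (Y f)

/-- The vector field on `M` to which a projectable vector field on `P` projects. -/
def push (X : VF (Fn EP P)) : VF (Fn EM M) := Classical.epsilon (Q.Related X)

/-- A vector field on `P` tangent to the fibres. -/
def Vertical (X : VF (Fn EP P)) : Prop := ∀ f, X (Q.pull f) = 0

lemma orbit_smooth (f : Fn EP P) (p : P) :
    ContMDiff IG 𝓘(ℝ, ℝ) ∞ fun a : G => f (Q.act p a) :=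
  f.contMDiff.comp (Q.act_smooth.comp (contMDiff_const.prodMk contMDiff_id))

lemma orbit_mdiff (f : Fn EP P) (p : P) :
    MDifferentiableAt IG 𝓘(ℝ, ℝ) (fun a : G => f (Q.act p a)) 1 :=
  (Q.orbit_smooth f p).mdifferentiable (by simp) 1

lemma fund_smooth (z : EG) (f : Fn EP P) : ContMDiff 𝓘(ℝ, EP) 𝓘(ℝ, ℝ) ∞
    fun p => dOne IG (fun a : G => f (Q.act p a)) z := by
  have : IsManifold IG 1 G := IsManifold.of_le (n := ∞) (by simp)
  have : IsManifold 𝓘(ℝ, EP) 1 P := IsManifold.of_le (n := ∞) (by simp)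
  intro p
  have h := ContMDiffAt.mfderiv_apply (I := IG) (I' := 𝓘(ℝ, ℝ)) (J := 𝓘(ℝ, EP))
    (J' := 𝓘(ℝ, EP)) (x₀ := p) (m := ∞) (n := ∞)
    (fun p a => f (Q.act p a)) (fun _ => (1 : G)) (fun p => p) (fun _ => z)
    ((f.contMDiff.comp Q.act_smooth) _) contMDiffAt_const contMDiffAt_id contMDiffAt_const
    (by simp)
  refine h.congr_of_eventuallyEq (Filter.Eventually.of_forall fun p' => ?_)
  have key : ∀ (φ : P → EG →L[ℝ] ℝ) (u : P → ℝ),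
      inTangentCoordinates IG 𝓘(ℝ, ℝ) (fun _ : P => (1 : G)) u φ p p' = φ p' := by
    intro φ u
    have e := inTangentCoordinates_eq (I := IG) (I' := 𝓘(ℝ, ℝ)) (fun _ : P => (1 : G)) u φ
      (x₀ := p) (x := p') (mem_chart_source _ _) (by exact Set.mem_univ _)
    rw [e]
    ext w
    have e1 : (tangentBundleCore IG G).coordChange (achart HG (1 : G)) (achart HG (1 : G)) 1 w = w :=
      (tangentBundleCore IG G).coordChange_self _ _ (mem_chart_source _ _) w
    simp only [ContinuousLinearMap.comp_apply, e1, tangentBundleCore_coordChange_model_space]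
    rfl
  exact (congrArg (fun L : EG →L[ℝ] ℝ => L z)
    (key (fun x => mfderiv IG 𝓘(ℝ, ℝ) (fun a : G => f (Q.act x a)) 1) _)).symm

/-- The infinitesimal action: `fund z` at `p` is the derivative of `a ↦ p a` at `1` along `z`. -/
def fund : EG →ₗ[ℝ] VF (Fn EP P) where
  toFun z := Derivation.mk'
    { toFun := fun f => ⟨_, Q.fund_smooth z f⟩
      map_add' := fun f h => by
        ext p
        exact congrArg (fun L : EG →L[ℝ] ℝ => L z)
          (mfderiv_add (Q.orbit_mdiff f p) (Q.orbit_mdiff h p))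
      map_smul' := fun t f => by
        ext p
        exact congrArg (fun L : EG →L[ℝ] ℝ => L z)
          (const_smul_mfderiv (Q.orbit_mdiff f p) t) } fun f h => by
        ext p
        have e := congrArg (fun L : EG →L[ℝ] ℝ => L z)
          ((Q.orbit_mdiff f p).hasMFDerivAt.mul (Q.orbit_mdiff h p).hasMFDerivAt).mfderiv
        have hf : f (Q.act p 1) = f p := by rw [Q.act_one]
        have hh : h (Q.act p 1) = h p := by rw [Q.act_one]
        exact e.trans (congrArg₂ (fun x y : ℝ => x * dOne IG (fun a : G => h (Q.act p a)) z
          + y * dOne IG (fun a : G => f (Q.act p a)) z) hf hh)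
  map_add' z w := by
    ext f p
    exact map_add (mfderiv IG 𝓘(ℝ, ℝ) (fun a : G => f (Q.act p a)) 1) z w
  map_smul' t z := by
    ext f p
    exact map_smul (mfderiv IG 𝓘(ℝ, ℝ) (fun a : G => f (Q.act p a)) 1) t z

@[simp] lemma rpullVF_apply (a : G) (Z : VF (Fn EP P)) (f : Fn EP P) :
    Q.rpullVF a Z f = Q.rpull a (Z (Q.rpull a⁻¹ f)) := rfl

/-- A connection on `P`, as a Lie algebra valued 1-form (`A ⊗ 𝔤` being the smooth functions from
`P` to `𝔤`). -/
structure Connection where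
  /-- the connection form -/
  form : VF (Fn EP P) →ₗ[Fn EP P] Fn EP P ⊗[ℝ] EG
  form_fund : ∀ z, form (Q.fund z) = 1 ⊗ₜ z
  /-- `R_a^* form = Ad(a⁻¹) form` -/
  equivariant : ∀ (a : G) Z, (Ad IG a⁻¹).lTensor (Fn EP P) (form (Q.rpullVF a Z))
    = (Q.rpull a).toLinearMap.rTensor EG (form Z)

/-- An exact Courant algebroid over `P` with a lifted `G`-action, written in an equivariant
isotropic splitting: the bracket on `TP ⊕ T*P` is twisted by the closed invariant 3-form `Hhat`,
the action is `ρ(z) = fund z + xi z`, and its quadratic form is `c(z) = -⟨ρ(z), ρ(z)⟩`. -/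
structure LiftedAction (c : LinearMap.BilinForm ℝ EG) where
  /-- the curvature 3-form -/
  Hhat : Form3 (Fn EP P)
  closed : ∀ X Y Z W, d3 Hhat X Y Z W = 0
  invariant : ∀ (a : G) X Y Z,
    Hhat ![Q.rpullVF a X, Q.rpullVF a Y, Q.rpullVF a Z] = Q.rpull a (Hhat ![X, Y, Z])
  /-- the 1-form component of the lifted action -/
  xi : EG →ₗ[ℝ] Form1 (Fn EP P)
  d_xi : ∀ z X Y, d1 (xi z) X Y = Hhat ![Q.fund z, X, Y]
  xi_equivariant : ∀ (a : G) z X, xi (Ad IG a z) (Q.rpullVF a X) = Q.rpull a (xi z X)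
  quadratic : ∀ z w, pair (Q.fund z, xi z) (Q.fund w, xi w) = algebraMap ℝ (Fn EP P) (-c z w)

variable {Q} {c : LinearMap.BilinForm ℝ EG} (L : Q.LiftedAction c)

namespace LiftedAction

/-- The lifted action `ρ`. -/
def rho (z : EG) : GT (Fn EP P) := (Q.fund z, L.xi z)

/-- The sections of the reduced Courant algebroid `E = K^⊥ / G`, `K = ρ(𝔤)` (for nondegenerate `c`
one has `K ∩ K^⊥ = 0`): the sections of `K^⊥` invariant under the lifted action. The anchor is the
projection to `M` of the first component, the subbundle `T*` consists of the elements with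
vanishing first component, and the bracket and the pairing are those of `TP ⊕ T*P`.
(Infinitesimal invariance, the last condition, is a consequence of invariance under `G`.) -/
def sections : Submodule ℝ (GT (Fn EP P)) where
  carrier := {e | (∀ z, pair e (L.rho z) = 0) ∧ (∀ a : G, Q.rpullVF a e.1 = e.1) ∧
    (∀ (a : G) X, e.2 (Q.rpullVF a X) = Q.rpull a (e.2 X)) ∧
    ∀ z, dorfman L.Hhat (L.rho z) e = 0}
  zero_mem' := by
    refine ⟨fun z => by simp [pair], fun a => by ext; simp, fun a X => by simp, fun z => ?_⟩
    have h := dorfman_smul_right L.Hhat (L.rho z) 0 0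
    simpa using h
  add_mem' := by
    rintro e e' ⟨h1, h2, h3, h4⟩ ⟨k1, k2, k3, k4⟩
    refine ⟨fun z => ?_, fun a => ?_, fun a X => ?_, fun z => ?_⟩
    · rw [pair_add_left, h1, k1, add_zero]
    · conv_rhs => rw [Prod.fst_add, ← h2 a, ← k2 a]
      ext; simp
    · simp [h3, k3]
    · rw [dorfman_add_right, h4, k4, add_zero]
  smul_mem' := by
    rintro t e ⟨h1, h2, h3, h4⟩
    refine ⟨fun z => ?_, fun a => ?_, fun a X => ?_, fun z => ?_⟩
    · rw [pair_smul_left, h1, smul_zero]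
    · conv_rhs => rw [Prod.smul_fst, ← h2 a]
      ext; simp
    · simp [h3]
    · rw [dorfman_smul_right, h4, smul_zero]

/-- The pairing `c` on `𝔤`-valued functions. -/
def cPair (_L : Q.LiftedAction c) (r t : Fn EP P ⊗[ℝ] EG) : Fn EP P :=
  c.baseChange (Fn EP P) r t

/-- On the open set where the function `χ` on `M` does not vanish, `s` is a frame of the bundle with
module of sections `W ⊆ Γ(E)`, and `s'` is the dual frame for the pairing. -/
def IsFrame (W : Submodule ℝ (GT (Fn EP P))) (χ : Fn EM M) {n : ℕ}
    (s s' : Fin n → GT (Fn EP P)) : Prop :=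
  (∀ i, s i ∈ W ∧ s' i ∈ W) ∧
  (∀ i j, Q.pull χ * pair (s i) (s' j) = if i = j then Q.pull χ else 0) ∧
  ∀ e ∈ W, Q.pull χ • e = Q.pull χ • ∑ i, pair e (s' i) • s i

variable (Q) in
/-- `W` is the module of sections of a vector bundle of rank `n` on which the pairing is
nondegenerate: near every point it has a frame with a dual frame. -/
def HasRank (W : Submodule ℝ (GT (Fn EP P))) (n : ℕ) : Prop :=
  ∀ x : M, ∃ (χ : Fn EM M) (s s' : Fin n → GT (Fn EP P)), χ x ≠ 0 ∧ IsFrame (Q := Q) W χ s s'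

/-- The section `u` of `TP ⊕ T*P` vanishes at `p`. -/
def VanishesAt (p : P) (u : GT (Fn EP P)) : Prop := (∀ f, u.1 f p = 0) ∧ ∀ X, u.2 X p = 0

/-- A generalized metric of rank `n` on `E`: a subbundle `V_+`, given by its module of sections, on
which the pairing is nondegenerate, so that `E = V_+ ⊕ V_+^⊥`. -/
structure GenMetric (n : ℕ) where
  /-- the sections of `V_+` -/
  V : Submodule ℝ (GT (Fn EP P))
  le : V ≤ L.sections
  smul_mem : ∀ (f : Fn EM M), ∀ v ∈ V, Q.pull f • v ∈ V
  hasRank : HasRank Q V n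
  decomp : ∀ e ∈ L.sections, ∃ v ∈ V, ∀ w ∈ V, pair (e - v) w = 0

variable {L} {n : ℕ} (𝒱 : L.GenMetric n)

namespace GenMetric

/-- `V_+ ∩ T* = 0` in every fibre, and `rk V_+ = rk E - dim M`. -/
def Admissible : Prop :=
  (∀ p, ∀ v ∈ 𝒱.V, ∀ t ∈ L.sections, t.1 = 0 → VanishesAt p (v - t) → VanishesAt p v) ∧
  HasRank Q L.sections (n + Module.finrank ℝ EM)

/-- A section of the orthogonal complement `V_-` of `V_+` in `E`. -/
def MemMinus (e : GT (Fn EP P)) : Prop := e ∈ L.sections ∧ ∀ v ∈ 𝒱.V, pair e v = 0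

/-- The orthogonal projection `e^+` of a section of `E` to `V_+`. -/
def plus (e : GT (Fn EP P)) : GT (Fn EP P) :=
  Classical.epsilon fun v => v ∈ 𝒱.V ∧ ∀ w ∈ 𝒱.V, pair (e - v) w = 0

/-- The orthogonal projection `e^-` of a section of `E` to `V_-`. -/
def minus (e : GT (Fn EP P)) : GT (Fn EP P) := e - 𝒱.plus e

/-- The metric `g`, the isotropic splitting `λ : T → E` (here `lam`), the connection `A` on `P` and
the 3-form `H` on `M` determined by an admissible metric `V_+`. -/
structure Fields where
  /-- the metric on `M` -/
  g : PseudoMetric (Fn EM M)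
  /-- the inverse of the isomorphism `(V_+ ∩ Ker π)^⊥ → T`, where `⊥` is taken in `V_+` -/
  lift : VF (Fn EM M) → GT (Fn EP P)
  lift_mem : ∀ X, lift X ∈ 𝒱.V
  lift_related : ∀ X, Q.Related (lift X).1 X
  lift_orth : ∀ X, ∀ v ∈ 𝒱.V, Q.Vertical v.1 → pair (lift X) v = 0
  g_eq : ∀ X Y, Q.pull (g.toForm X Y) = pair (lift X) (lift Y)
  /-- the splitting `λ(X) = lift X - g(X)` -/
  lam : VF (Fn EM M) → GT (Fn EP P)
  lam_mem : ∀ X, lam X ∈ L.sections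
  lam_fst : ∀ X, (lam X).1 = (lift X).1
  lam_snd : ∀ X Z Y, Q.Related Z Y → (lift X).2 Z - (lam X).2 Z = Q.pull (g.toForm X Y)
  /-- the connection whose horizontal lift is the `TP`-component of `λ` -/
  conn : Q.Connection
  conn_lam : ∀ X, conn.form (lam X).1 = 0
  /-- the 3-form with `H(X,Y,Z) = 2 ⟨[λX, λY], λZ⟩` -/
  H : Form3 (Fn EM M)
  H_eq : ∀ X Y Z,
    Q.pull (H ![X, Y, Z]) = (2 : ℝ) • pair (dorfman L.Hhat (lam X) (lam Y)) (lam Z)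

variable {𝒱} (ℱ : 𝒱.Fields)

namespace Fields

/-- The horizontal lift `A^⊥ X` of a vector field on `M`. -/
def hor (X : VF (Fn EM M)) : VF (Fn EP P) := (ℱ.lam X).1

/-- The curvature `F(X,Y) = -A[A^⊥ X, A^⊥ Y]`, a section of `ad P` viewed as an equivariant
`𝔤`-valued function on `P`. -/
def curvature (X Y : VF (Fn EM M)) : Fn EP P ⊗[ℝ] EG := -ℱ.conn.form ⁅ℱ.hor X, ℱ.hor Y⁆

/-- The covariant derivative of a section of an associated vector bundle, viewed as an equivariant
vector-valued function on `P`: the derivative along the horizontal lift. -/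
def covD {U : Type*} [AddCommGroup U] [Module ℝ U] (X : VF (Fn EM M)) (r : Fn EP P ⊗[ℝ] U) :
    Fn EP P ⊗[ℝ] U :=
  (ℱ.hor X : Fn EP P →ₗ[ℝ] Fn EP P).rTensor U r

/-- The vertical vector field `A(X)`. -/
def vert (X : VF (Fn EP P)) : VF (Fn EP P) := Q.fund.liftBaseChange (Fn EP P) (ℱ.conn.form X)

/-- `⟨D'_{e₁} e₂, e₃⟩` for `D' = ∇^g ⊕ ∇^A ⊕ ∇^{g*}` in the splitting `E ≅ T ⊕ ad P ⊕ T*` given by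
`λ`. The component of `e` in `T` is its projection to `M`, the one in `ad P` is `A(e)`, and the one
in `T*` is the 1-form `W ↦ 2⟨e, λW⟩`. -/
def dPrime (e₁ e₂ e₃ : GT (Fn EP P)) : Fn EP P :=
  let X := Q.push e₁.1
  let Y := Q.push e₂.1
  let Z := Q.push e₃.1
  pair (ℱ.lam (ℱ.g.nabla X Y)) e₃ + L.cPair (ℱ.covD X (ℱ.conn.form e₂.1)) (ℱ.conn.form e₃.1)
    + (ℱ.hor X (pair e₂ (ℱ.lam Z)) - pair e₂ (ℱ.lam (ℱ.g.nabla X Z)))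

/-- The Chern-Simons 3-form `CS(A)` on invariant vector fields on `P`, pulled back to `E`. -/
def cs (e₁ e₂ e₃ : GT (Fn EP P)) : Fn EP P :=
  let X := Q.push e₁.1
  let Y := Q.push e₂.1
  let Z := Q.push e₃.1
  let A := ℱ.conn.form
  L.cPair (ℱ.curvature X Y) (A e₃.1) - L.cPair (ℱ.curvature X Z) (A e₂.1)
    + L.cPair (ℱ.curvature Y Z) (A e₁.1) - L.cPair (A e₁.1) (A ⁅ℱ.vert e₂.1, ℱ.vert e₃.1⁆)

/-- `⟨χ_{e₁} e₂, e₃⟩` for `χ = χ⁰ + χ^ϕ`, with `⟨χ⁰_{e₁} e₂, e₃⟩ = ½ H - CS(A)` and the Weyl term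
`χ^ϕ_{e₁} e₂ = ϕ(e₂) e₁ - ⟨e₁, e₂⟩ ⟨·,·⟩⁻¹ϕ` of a 1-form `ϕ` on `M`. -/
def chi (ϕ : Form1 (Fn EM M)) (e₁ e₂ e₃ : GT (Fn EP P)) : Fn EP P :=
  (1 / 2 : ℝ) • Q.pull (ℱ.H ![Q.push e₁.1, Q.push e₂.1, Q.push e₃.1]) - ℱ.cs e₁ e₂ e₃
    + (Q.pull (ϕ (Q.push e₂.1)) * pair e₁ e₃ - pair e₁ e₂ * Q.pull (ϕ (Q.push e₃.1)))

/-- `⟨D^ϕ_{e₁} e₂, e₃⟩` for `D^ϕ = D' + ⅓ χ^{+++} + ⅓ χ^{---} + χ^{+-+} + χ^{-+-}`, where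
`χ^{abc}_{e₁} e₂` is the projection to `V_a` of `χ_{e₁^b} e₂^c`. -/
def weylForm (ϕ : Form1 (Fn EM M)) (e₁ e₂ e₃ : GT (Fn EP P)) : Fn EP P :=
  ℱ.dPrime e₁ e₂ e₃
    + (1 / 3 : ℝ) • ℱ.chi ϕ (𝒱.plus e₁) (𝒱.plus e₂) (𝒱.plus e₃)
    + (1 / 3 : ℝ) • ℱ.chi ϕ (𝒱.minus e₁) (𝒱.minus e₂) (𝒱.minus e₃)
    + ℱ.chi ϕ (𝒱.minus e₁) (𝒱.plus e₂) (𝒱.plus e₃)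
    + ℱ.chi ϕ (𝒱.plus e₁) (𝒱.minus e₂) (𝒱.minus e₃)

/-- The torsion-free generalized connection `D^ϕ` compatible with `V_+`: the section `D^ϕ_{e₁} e₂`
of `E` is determined by its pairings with the sections of `E`. -/
def conD (ϕ : Form1 (Fn EM M)) (e₁ e₂ : GT (Fn EP P)) : GT (Fn EP P) :=
  Classical.epsilon fun e => e ∈ L.sections ∧ ∀ e₃ ∈ L.sections, pair e e₃ = ℱ.weylForm ϕ e₁ e₂ e₃

/-- The generalized curvature
`GR(e₁,e₂)e₃ = D_{e₁} D_{e₂} e₃ - D_{e₂} D_{e₁} e₃ - D_{[[e₁,e₂]]} e₃` of `D = D^ϕ`. -/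
def GR (ϕ : Form1 (Fn EM M)) (e₁ e₂ e₃ : GT (Fn EP P)) : GT (Fn EP P) :=
  ℱ.conD ϕ e₁ (ℱ.conD ϕ e₂ e₃) - ℱ.conD ϕ e₂ (ℱ.conD ϕ e₁ e₃)
    - ℱ.conD ϕ (courant L.Hhat e₁ e₂) e₃

/-- `GRic(e₂,e₃)`, the trace of the endomorphism `e₁ ↦ GR(e₁,e₂)e₃` of `V_+`, computed in a frame
`s` of `V_+` with dual frame `s'`. -/
def GRic (ϕ : Form1 (Fn EM M)) (s s' : Fin n → GT (Fn EP P)) (e₂ e₃ : GT (Fn EP P)) : Fn EP P :=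
  ∑ i, pair (ℱ.GR ϕ (s i) e₂ e₃) (s' i)

/-- `GRic = 0` on `V_- ⊗ V_+`. -/
def RicciFlat (ϕ : Form1 (Fn EM M)) : Prop :=
  ∀ (χ : Fn EM M) (s s' : Fin n → GT (Fn EP P)), IsFrame (Q := Q) 𝒱.V χ s s' →
    ∀ e₂, 𝒱.MemMinus e₂ → ∀ e₃ ∈ 𝒱.V, Q.pull χ * ℱ.GRic ϕ s s' e₂ e₃ = 0

end Fields
end GenMetric
end LiftedAction
end PrincipalBundle

/-- On the open set where `χ` does not vanish, `e` is a frame of the tangent bundle of the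
10-manifold with `g`-dual frame `e'`. -/
def PseudoMetric.IsFrame {B : Type*} [CommRing B] [Algebra ℝ B] (g : PseudoMetric B) (χ : B)
    (e e' : Fin 10 → VF B) : Prop :=
  (∀ i j, χ * g.toForm (e i) (e' j) = if i = j then χ else 0) ∧
  ∀ X, χ • X = χ • ∑ i, g.toForm X (e' i) • e i

/-- Near every point there is an orthonormal frame with `g(e_0,e_0) = ε` and `g(e_i,e_i) = -ε` for
`1 ≤ i ≤ 9`. -/
def PseudoMetric.HasLorentzFrames (g : PseudoMetric (Fn EM M)) (ε : ℝ) : Prop :=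
  ∀ x : M, ∃ (χ : Fn EM M) (e : Fin 10 → VF (Fn EM M)), χ x ≠ 0 ∧
    g.IsFrame χ e fun i => (if i = 0 then ε else -ε) • e i

/-- Signature `(1,9)`, in either of the two sign conventions. -/
def PseudoMetric.IsLorentzian (g : PseudoMetric (Fn EM M)) : Prop :=
  g.HasLorentzFrames 1 ∨ g.HasLorentzFrames (-1)

end Principal

/-! ## Heterotic supergravity -/

section Heterotic

variable {EK K ES S EP P EM M : Type*}
  [NormedAddCommGroup EK] [NormedSpace ℝ EK]
  [TopologicalSpace K] [ChartedSpace EK K] [Group K] [LieGroup 𝓘(ℝ, EK) ∞ K]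
  [NormedAddCommGroup ES] [NormedSpace ℝ ES]
  [TopologicalSpace S] [ChartedSpace ES S] [Group S] [LieGroup 𝓘(ℝ, ES) ∞ S]
  [NormedAddCommGroup EP] [NormedSpace ℝ EP] [TopologicalSpace P] [ChartedSpace EP P]
  [IsManifold 𝓘(ℝ, EP) ∞ P]
  [NormedAddCommGroup EM] [NormedSpace ℝ EM] [TopologicalSpace M] [ChartedSpace EM M]

variable (ES S) in
/-- An isomorphism of the Lie group `S` with `SL(10,ℝ)`: a group isomorphism, smooth as a
matrix-valued map, whose derivative at `1` is an isomorphism onto the trace-free matrices. -/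
structure SLIso where
  /-- the isomorphism -/
  toEquiv : S ≃* Matrix.SpecialLinearGroup (Fin 10) ℝ
  smooth : ∀ i j, ContMDiff 𝓘(ℝ, ES) 𝓘(ℝ, ℝ) ∞ fun s : S => (toEquiv s).1 i j
  bijective : ∀ N : Matrix (Fin 10) (Fin 10) ℝ, N.trace = 0 →
    ∃! z : ES, ∀ i j, dOne 𝓘(ℝ, ES) (fun s : S => (toEquiv s).1 i j) z = N i j

namespace SLIso

variable (ι : SLIso ES S)

/-- The identification of the Lie algebra of `S` with `𝔰𝔩(10,ℝ)`. -/
def diff : ES →ₗ[ℝ] Matrix (Fin 10) (Fin 10) ℝ where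
  toFun z := Matrix.of fun i j => dOne 𝓘(ℝ, ES) (fun s : S => (ι.toEquiv s).1 i j) z
  map_add' z w := by
    ext i j
    exact map_add (mfderiv 𝓘(ℝ, ES) 𝓘(ℝ, ℝ) (fun s : S => (ι.toEquiv s).1 i j) 1) z w
  map_smul' t z := by
    ext i j
    exact map_smul (mfderiv 𝓘(ℝ, ES) 𝓘(ℝ, ℝ) (fun s : S => (ι.toEquiv s).1 i j) 1) t z

/-- The trace form `(z,w) ↦ Tr(zw)` on the Lie algebra of `S`. -/
def traceForm : LinearMap.BilinForm ℝ ES :=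
  ((LinearMap.mul ℝ (Matrix (Fin 10) (Fin 10) ℝ)).compr₂
    (Matrix.traceLinearMap (Fin 10) ℝ ℝ)).compl₁₂ ι.diff ι.diff

/-- The pairing `c = α' (tr - tr_𝔨)` on `𝔨 ⊕ 𝔰𝔩(10,ℝ)`, where `tr = κ Tr`. -/
def pairing (α κ : ℝ) (trk : LinearMap.BilinForm ℝ EK) : LinearMap.BilinForm ℝ (EK × ES) :=
  α • (κ • ι.traceForm.compl₁₂ (LinearMap.snd ℝ EK ES) (LinearMap.snd ℝ EK ES)
    - trk.compl₁₂ (LinearMap.fst ℝ EK ES) (LinearMap.fst ℝ EK ES))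

end SLIso

/-- A solder form on a principal `K × S`-bundle `P`, `S ≅ SL(10,ℝ)`: it identifies the points of
`P_M = P / K` with the frames of `TM` in an `SL(10,ℝ)`-reduction of the frame bundle (the frames of
unit volume for a volume form), so that `P = P_YM ×_M P_M` with `P_YM = P / S`. The value of
`theta` on a tangent vector at `p` is the vector of coordinates in the frame `p` of its projection
to `M`. -/
structure SolderForm (ι : SLIso ES S)
    (Q : PrincipalBundle (K × S) EP P EM M (𝓘(ℝ, EK).prod 𝓘(ℝ, ES))) where
  /-- the coordinates of the solder form -/
  theta : Fin 10 → Form1 (Fn EP P)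
  theta_fund : ∀ i z, theta i (Q.fund z) = 0
  surjective : ∀ p (v : Fin 10 → ℝ), ∃ Z, ∀ i, theta i Z p = v i
  kernel : ∀ p Z, (∀ i, theta i Z p = 0) → ∃ z, ∀ f, Z f p = Q.fund z f p
  equivariant : ∀ (a : K × S) i Z, Q.rpull a (theta i Z)
    = ∑ j, (ι.toEquiv a.2⁻¹).1 i j • theta j (Q.rpullVF a Z)

variable {ι : SLIso ES S} {Q : PrincipalBundle (K × S) EP P EM M (𝓘(ℝ, EK).prod 𝓘(ℝ, ES))}
  {c : LinearMap.BilinForm ℝ (EK × ES)} {L : Q.LiftedAction c} {n : ℕ} {𝒱 : L.GenMetric n}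

namespace PrincipalBundle.LiftedAction.GenMetric.Fields

variable (ℱ : 𝒱.Fields)

/-- `∇^T` is the connection on `TM` induced by the `𝔰𝔩(10,ℝ)`-component of the connection on `P`:
the coordinates of `∇^T_X Y` in the frames `p ∈ P` are the derivatives of those of `Y` along the
horizontal lift of `X`. -/
def Induces (θ : SolderForm ι Q) (nablaT : VF (Fn EM M) → VF (Fn EM M) → VF (Fn EM M)) : Prop :=
  ∀ X Y i, θ.theta i (ℱ.hor (nablaT X Y)) = ℱ.hor X (θ.theta i (ℱ.hor Y))

/-- `∇^T` is compatible with the metric `g`. -/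
def IsMetric (nablaT : VF (Fn EM M) → VF (Fn EM M) → VF (Fn EM M)) : Prop :=
  ∀ X Y Z, X (ℱ.g.toForm Y Z) = ℱ.g.toForm (nablaT X Y) Z + ℱ.g.toForm Y (nablaT X Z)

/-- The curvature `F_A` of the connection `A` on `P_YM`, as a `𝔨`-valued function on `P`: the
`𝔨`-component of the curvature of the connection on `P`. -/
def FA (X Y : VF (Fn EM M)) : Fn EP P ⊗[ℝ] EK :=
  (LinearMap.fst ℝ EK ES).lTensor (Fn EP P) (ℱ.curvature X Y)

section Equations

variable (e e' : Fin 10 → VF (Fn EM M))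

/-- `Ric^g(Y,Z)`, the trace of `X ↦ R^g(X,Y)Z`. -/
def ric (Y Z : VF (Fn EM M)) : Fn EM M :=
  ∑ j, ℱ.g.toForm (curv ℱ.g.nabla (e j) Y Z) (e' j)

/-- `(∇^g dφ)(Y,Z)`. -/
def hess (φ : Fn EM M) (Y Z : VF (Fn EM M)) : Fn EM M := Y (Z φ) - ℱ.g.nabla Y Z φ

/-- `(H ∘ H)(Y,Z) = Σ g(H(e_j,Y,·), H(e_j,Z,·))`. -/
def HH (Y Z : VF (Fn EM M)) : Fn EM M :=
  ∑ j, ∑ k, ℱ.H ![e j, Y, e k] * ℱ.H ![e' j, Z, e' k]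

/-- `(tr_𝔨 F_A ∘ F_A)(Y,Z) = Σ tr_𝔨(F_A(Y,e_j), F_A(Z,e_j))`. -/
def trFF (trk : LinearMap.BilinForm ℝ EK) (Y Z : VF (Fn EM M)) : Fn EP P :=
  ∑ j, trk.baseChange (Fn EP P) (ℱ.FA Y (e j)) (ℱ.FA Z (e' j))

/-- `Tr(R(X,Y) R(Z,W))`, for the curvature `R` of `∇^T`. -/
def trR (nablaT : VF (Fn EM M) → VF (Fn EM M) → VF (Fn EM M)) (X Y Z W : VF (Fn EM M)) : Fn EM M :=
  ℱ.g.tr e e' fun U => curv nablaT X Y (curv nablaT Z W U)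

/-- `(Tr R ∘ R)(Y,Z) = Σ Tr(R(Y,e_j) R(Z,e_j))`. -/
def trRR (nablaT : VF (Fn EM M) → VF (Fn EM M) → VF (Fn EM M)) (Y Z : VF (Fn EM M)) : Fn EM M :=
  ∑ j, ℱ.trR e e' nablaT Y (e j) Z (e' j)

/-- `d^*(wH)(Y,Z) = -Σ (∇^g_{e_j}(wH))(e_j,Y,Z)`. -/
def dstarH (w : Fn EM M) (Y Z : VF (Fn EM M)) : Fn EM M :=
  -∑ j, ℱ.g.nabla3 (w • ℱ.H) (e j) (e' j) Y Z

/-- `d_A^*(wF_A)(Y) = -Σ (∇_{e_j}(wF_A))(e_j,Y)`. -/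
def dstarF (w : Fn EM M) (Y : VF (Fn EM M)) : Fn EP P ⊗[ℝ] EK :=
  -∑ j, (ℱ.covD (e j) (Q.pull w • ℱ.FA (e' j) Y) - Q.pull w • ℱ.FA (ℱ.g.nabla (e j) (e' j)) Y
    - Q.pull w • ℱ.FA (e' j) (ℱ.g.nabla (e j) Y))

/-- `*(F_A ∧ *H)(Y) = -Σ F_A(e_j, g⁻¹H(e_j,Y,·))`. -/
def starF (Y : VF (Fn EM M)) : Fn EP P ⊗[ℝ] EK :=
  -∑ j, ∑ k, Q.pull (ℱ.H ![e' j, Y, e k]) • ℱ.FA (e j) (e' k)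

/-- `d_{∇^T}^*(wR)(Y) = -Σ (∇_{e_j}(wR))(e_j,Y)`, an endomorphism of `TM` applied to `U`. -/
def dstarR (nablaT : VF (Fn EM M) → VF (Fn EM M) → VF (Fn EM M)) (w : Fn EM M)
    (Y U : VF (Fn EM M)) : VF (Fn EM M) :=
  -∑ j, (nablaT (e j) (w • curv nablaT (e' j) Y U) - w • curv nablaT (e' j) Y (nablaT (e j) U)
    - w • curv nablaT (ℱ.g.nabla (e j) (e' j)) Y U
    - w • curv nablaT (e' j) (ℱ.g.nabla (e j) Y) U)

/-- `*(R ∧ *H)(Y) = -Σ R(e_j, g⁻¹H(e_j,Y,·))`, an endomorphism of `TM` applied to `U`. -/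
def starR (nablaT : VF (Fn EM M) → VF (Fn EM M) → VF (Fn EM M)) (Y U : VF (Fn EM M)) :
    VF (Fn EM M) :=
  -∑ j, ∑ k, ℱ.H ![e' j, Y, e k] • curv nablaT (e j) (e' k) U

end Equations

/-- The equations of motion of heterotic supergravity and the Bianchi identity
`dH = α' (tr R ∧ R - tr_𝔨 F_A ∧ F_A)` for `(g, φ, H, A, ∇^T)`, where `tr = κ Tr`. They are written
in frames `e` of `TM` with `g`-dual frames `e'`, on the open sets where `χ` does not vanish. -/
def HeteroticEquations (α κ : ℝ) (trk : LinearMap.BilinForm ℝ EK)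
    (nablaT : VF (Fn EM M) → VF (Fn EM M) → VF (Fn EM M)) (φ : Fn EM M) : Prop :=
  ∀ (χ : Fn EM M) (e e' : Fin 10 → VF (Fn EM M)), ℱ.g.IsFrame χ e e' →
    let w := expFn (-2 * φ)
    -- Ric + 2 ∇dφ - ¼ H∘H + α' tr_𝔨 F_A∘F_A - α' tr R∘R = 0
    (∀ Y Z, Q.pull χ * (Q.pull (ℱ.ric e e' Y Z + (2 : ℝ) • ℱ.hess φ Y Z
      - (1 / 4 : ℝ) • ℱ.HH e e' Y Z - (α * κ) • ℱ.trRR e e' nablaT Y Z)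
      + α • ℱ.trFF e e' trk Y Z) = 0) ∧
    -- d^*(e^{-2φ} H) = 0
    (∀ Y Z, χ * ℱ.dstarH e e' w Y Z = 0) ∧
    -- d_A^*(e^{-2φ} F_A) + ½ e^{-2φ} *(F_A ∧ *H) = 0
    (∀ Y, Q.pull χ • (ℱ.dstarF e e' w Y + Q.pull ((1 / 2 : ℝ) • w) • ℱ.starF e e' Y) = 0) ∧
    -- d_{∇^T}^*(e^{-2φ} R) + ½ e^{-2φ} *(R ∧ *H) = 0
    (∀ Y U, χ • (ℱ.dstarR e e' nablaT w Y U + ((1 / 2 : ℝ) • w) • ℱ.starR e e' nablaT Y U) = 0) ∧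
    -- dH = α' (tr R ∧ R - tr_𝔨 F_A ∧ F_A)
    (∀ X Y Z W, Q.pull (χ * d3 ℱ.H X Y Z W) = Q.pull χ *
      (Q.pull ((2 * α * κ) • (ℱ.trR e e' nablaT X Y Z W - ℱ.trR e e' nablaT X Z Y W
        + ℱ.trR e e' nablaT X W Y Z))
      - (2 * α) • (trk.baseChange (Fn EP P) (ℱ.FA X Y) (ℱ.FA Z W)
        - trk.baseChange (Fn EP P) (ℱ.FA X Z) (ℱ.FA Y W)
        + trk.baseChange (Fn EP P) (ℱ.FA X W) (ℱ.FA Y Z))))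

end PrincipalBundle.LiftedAction.GenMetric.Fields

end Heterotic

end Heterotic

end

open Heterotic

/-! Very little of the connection `D` enters `GRic`. In the direction of a section `Y^-` of `V_-`,
the contorsion is such that `D` acts on `V_+` by the bracket, `D v = [Y^-, v]^+` (`chiSplit_low`,
`con_low`). In the directions of `V_+` only the divergence `div v = tr (w ↦ D_w v)` survives: the
Chern-Simons contorsion is a 3-form and has trace zero, and the Weyl term contributes `(n-1)/3 • ϕ`,
which is `-2 dφ` for the given `ϕ` (`trace_con`, `weyl_smul`). This gives `trace_gCurv`: `GRic(Y^-,
v) = div [Y^-, v]^+ - Y (div v) + Σ ⟨[[e_j^-, v]^+, Y^-], e'_j^-⟩`.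

Write `X^± = λX ± g(X)`. Then `V_-` consists of the `X^-`, and `V_+` is the sum of the `X^+` and of
`ad = V_+ ∩ Ker π`. The mixed brackets of `Y^-` and `Z^+` are Levi-Civita derivatives with torsion
given by `H`, plus the curvature `F` of the connection on `P` (`pair_br_low_lift`,
`pair_br_lift_low`, `lift_plus_br_low_lift`). On `v = Z^+` the formula above is the Ricci tensor of
a connection with torsion `H`, together with the Hessian of `φ` and the trace of `F ∘ F`
(`trace_gCurv_lift`). Its symmetric part is the Einstein equation and its skew part is `d^*(e^{-2φ}
H)` up to a factor. On `v = r` in `ad` it is the Yang-Mills equation of `F` paired with `r`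
(`trace_gCurv_ad`). The identity for `dH` is no condition: it is the Jacobi identity of the bracket
(`pull_d3`).

These computations take place in the algebraic structure `Reduction`, with frames that are valid
after a ring homomorphism `q`, the restriction to an open set. Two facts connect it to the geometry.
Derivations of smooth functions are tangent vectors, by Hadamard's lemma, so vertical fields are
pointwise fundamental fields and the pairing on `ad` becomes `c` on values of the connection form
(`cPair_form`). And `V_-` projects isomorphically to `TM`, by counting ranks (`eq_zero_of_orth`).

Finally, the solder form represents the `𝔰𝔩(10,ℝ)`-component of `F` as the curvature of `∇^T`
(`theta_curv`, `trR_eq`). Since `c = α (κ Tr - tr_𝔨)` is block diagonal, the trace of `F ∘ F` gives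
the two gauge terms with opposite signs, and the equation on `ad` is equivalent to those of `A` and
`∇^T` together (`smul_fieldTensor_eq_zero_iff`). -/

namespace Heterotic

/-! ## Three-forms -/

section FormLemmas

variable {A : Type*} [CommRing A] [Algebra ℝ A] (H : Form3 A)

lemma form3_swap12 (X Y Z : VF A) : H ![Y, X, Z] = -H ![X, Y, Z] := by
  have h := H.map_swap ![X, Y, Z] (i := 0) (j := 1) (by decide)
  rw [← h]
  congr 1
  funext i
  fin_cases i <;> rfl

lemma form3_swap23 (X Y Z : VF A) : H ![X, Z, Y] = -H ![X, Y, Z] := by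
  have h := H.map_swap ![X, Y, Z] (i := 1) (j := 2) (by decide)
  rw [← h]
  congr 1
  funext i
  fin_cases i <;> rfl

lemma form3_swap13 (X Y Z : VF A) : H ![Z, Y, X] = -H ![X, Y, Z] := by
  rw [form3_swap12, form3_swap23, form3_swap12, neg_neg]

lemma form3_rotate (X Y Z : VF A) : H ![Y, Z, X] = H ![X, Y, Z] := by
  rw [form3_swap23, form3_swap12, neg_neg]

lemma form3_add₁ (X X' Y Z : VF A) : H ![X + X', Y, Z] = H ![X, Y, Z] + H ![X', Y, Z] :=
  H.map_vecCons_add ![Y, Z] X X'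

lemma form3_smul₁ (a : A) (X Y Z : VF A) : H ![a • X, Y, Z] = a * H ![X, Y, Z] :=
  H.map_vecCons_smul ![Y, Z] a X

lemma form3_smul₂ (a : A) (X Y Z : VF A) : H ![X, a • Y, Z] = a * H ![X, Y, Z] := by
  rw [form3_swap12, form3_smul₁, form3_swap12 H X Y]
  ring

lemma form3_add₃ (X Y Z Z' : VF A) : H ![X, Y, Z + Z'] = H ![X, Y, Z] + H ![X, Y, Z'] :=
  map_add (contr2 H X Y) Z Z'

lemma form3_smul₃ (a : A) (X Y Z : VF A) : H ![X, Y, a • Z] = a * H ![X, Y, Z] :=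
  map_smul (contr2 H X Y) a Z

lemma form3_zero₁ (Y Z : VF A) : H ![0, Y, Z] = 0 := by
  have h := form3_smul₁ H 0 0 Y Z
  simpa using h

lemma form3_zero₂ (X Z : VF A) : H ![X, 0, Z] = 0 := by
  rw [form3_swap12, form3_zero₁, neg_zero]

end FormLemmas

/-! ## The Courant algebroid `T ⊕ T*` -/

section CourantAxioms

variable {A : Type*} [CommRing A] [Algebra ℝ A]

lemma two_smul_half (a : A) : (2 : ℝ) • (1 / 2 : ℝ) • a = a := by
  rw [smul_smul]
  norm_num

lemma pair_symm (u v : GT A) : pair u v = pair v u := by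
  simp only [pair, add_comm]

lemma pair_add_right (u v w : GT A) : pair u (v + w) = pair u v + pair u w := by
  rw [pair_symm, pair_add_left, pair_symm v, pair_symm w]

lemma pair_smul_left' (a : A) (u v : GT A) : pair (a • u) v = a * pair u v := by
  simp only [pair, Prod.smul_fst, Prod.smul_snd, map_smul, LinearMap.smul_apply, smul_eq_mul,
    ← mul_add, mul_smul_comm]

lemma pair_smul_right' (a : A) (u v : GT A) : pair u (a • v) = a * pair u v := by
  rw [pair_symm, pair_smul_left', pair_symm]

lemma pair_zero_left (v : GT A) : pair 0 v = 0 := by simp [pair]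

lemma pair_zero_right (v : GT A) : pair v 0 = 0 := by simp [pair]

lemma pair_neg_left (u v : GT A) : pair (-u) v = -pair u v := by
  have h := pair_add_left u (-u) v
  rw [add_neg_cancel, pair_zero_left] at h
  exact (neg_eq_of_add_eq_zero_right h.symm).symm

lemma pair_neg_right (u v : GT A) : pair u (-v) = -pair u v := by
  rw [pair_symm, pair_neg_left, pair_symm]

lemma pair_sub_left (u v w : GT A) : pair (u - v) w = pair u w - pair v w := by
  rw [sub_eq_add_neg, pair_add_left, pair_neg_left, ← sub_eq_add_neg]

lemma pair_sub_right (u v w : GT A) : pair u (v - w) = pair u v - pair u w := by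
  rw [pair_symm, pair_sub_left, pair_symm v, pair_symm w]

lemma pair_sum_left {ι : Type*} (s : Finset ι) (u : ι → GT A) (v : GT A) :
    pair (∑ i ∈ s, u i) v = ∑ i ∈ s, pair (u i) v := by
  classical
  induction s using Finset.induction_on with
  | empty => simp [pair_zero_left]
  | insert i s hi ih => rw [Finset.sum_insert hi, Finset.sum_insert hi, pair_add_left, ih]

variable (H : Form3 A)

lemma dorfman_fst (u v : GT A) : (dorfman H u v).1 = ⁅u.1, v.1⁆ := rfl

lemma dorfman_snd_apply (u v : GT A) (Z : VF A) : (dorfman H u v).2 Z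
    = (u.1 (v.2 Z) - v.2 ⁅u.1, Z⁆) - (v.1 (u.2 Z) - Z (u.2 v.1) - u.2 ⁅v.1, Z⁆)
      + H ![u.1, v.1, Z] := rfl

lemma dorfman_pair (u v w : GT A) :
    u.1 (pair v w) = pair (dorfman H u v) w + pair v (dorfman H u w) := by
  simp only [pair, dorfman_fst, dorfman_snd_apply, Derivation.map_smul, map_add, ← smul_add]
  congr 1
  rw [form3_swap23 H u.1 v.1 w.1, ← lie_skew v.1 w.1, map_neg]
  ring

lemma dorfman_add_swap (u v : GT A) :
    dorfman H u v + dorfman H v u = (0, (2 : ℝ) • dFn (pair u v)) := by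
  refine Prod.ext ?_ (LinearMap.ext fun Z => ?_)
  · simp only [Prod.fst_add, dorfman_fst]
    rw [← lie_skew u.1 v.1, neg_add_cancel]
  · have h : ((2 : ℝ) • dFn (pair u v)) Z = Z (v.2 u.1) + Z (u.2 v.1) := by
      change (2 : ℝ) • Z ((1 / 2 : ℝ) • (v.2 u.1 + u.2 v.1)) = _
      rw [Derivation.map_smul, two_smul_half, map_add]
    rw [h]
    simp only [Prod.snd_add, LinearMap.add_apply, dorfman_snd_apply]
    rw [form3_swap12 H u.1 v.1]
    ring

/-- The defect of skew symmetry is exact, so it contributes only a derivative of `⟨u, v⟩`. For the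
orthogonal arguments met below the bracket is simply skew. -/
lemma pair_dorfman_swap (u v w : GT A) :
    pair (dorfman H u v) w = -pair (dorfman H v u) w + w.1 (pair u v) := by
  have h : pair (dorfman H u v + dorfman H v u) w = w.1 (pair u v) := by
    rw [dorfman_add_swap]
    change (1 / 2 : ℝ) • (w.2 0 + (2 : ℝ) • w.1 (pair u v)) = _
    rw [map_zero, zero_add, smul_smul]
    norm_num
  rw [pair_add_left] at h
  rw [← h]
  ring

lemma dorfman_smul_right' (a : A) (u v : GT A) :
    dorfman H u (a • v) = u.1 a • v + a • dorfman H u v := by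
  refine Prod.ext ?_ (LinearMap.ext fun Z => ?_)
  · simp only [dorfman_fst, Prod.smul_fst, Prod.fst_add, lie_smul_vf]
  · simp only [dorfman_snd_apply, Prod.smul_fst, Prod.smul_snd, Prod.snd_add, LinearMap.add_apply,
      LinearMap.smul_apply, smul_eq_mul, Derivation.leibniz, Derivation.smul_apply, map_smul,
      form3_smul₂]
    rw [← lie_skew (a • v.1) Z, lie_smul_vf, ← lie_skew v.1 Z]
    simp only [map_neg, map_add, map_smul, smul_eq_mul]
    ring

lemma dorfman_add_left (u v w : GT A) :
    dorfman H (u + v) w = dorfman H u w + dorfman H v w := by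
  refine Prod.ext ?_ (LinearMap.ext fun Z => ?_)
  · simp only [dorfman_fst, Prod.fst_add, add_lie]
  · simp only [dorfman_snd_apply, Prod.fst_add, Prod.snd_add, LinearMap.add_apply, map_add,
      Derivation.add_apply, add_lie, form3_add₁]
    ring

lemma dorfman_neg_left (u w : GT A) : dorfman H (-u) w = -dorfman H u w := by
  have h0 : dorfman H 0 w = 0 := by
    have h := dorfman_add_left H 0 0 w
    rw [add_zero] at h
    exact left_eq_add.mp h
  have h := dorfman_add_left H u (-u) w
  rw [add_neg_cancel, h0] at h
  exact (neg_eq_of_add_eq_zero_right h.symm).symm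

lemma dorfman_sub_left (u v w : GT A) :
    dorfman H (u - v) w = dorfman H u w - dorfman H v w := by
  rw [sub_eq_add_neg, dorfman_add_left, dorfman_neg_left, ← sub_eq_add_neg]

lemma dorfman_neg_right (u w : GT A) : dorfman H u (-w) = -dorfman H u w := by
  have h0 : dorfman H u 0 = 0 := by
    have h := dorfman_add_right H u 0 0
    rw [add_zero] at h
    exact left_eq_add.mp h
  have h := dorfman_add_right H u w (-w)
  rw [add_neg_cancel, h0] at h
  exact (neg_eq_of_add_eq_zero_right h.symm).symm

lemma dorfman_sub_right (u v w : GT A) :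
    dorfman H u (v - w) = dorfman H u v - dorfman H u w := by
  rw [sub_eq_add_neg, dorfman_add_right, dorfman_neg_right, ← sub_eq_add_neg]

/-- Both derivative terms vanish when `u` is orthogonal to `v` and `w`. This is why the mixed
brackets of `V_-` and `V_+` are tensorial in their first argument. -/
lemma pair_dorfman_smul_left (a : A) (u v w : GT A) : pair (dorfman H (a • u) v) w
    = a * pair (dorfman H u v) w - v.1 a * pair u w + w.1 a * pair u v := by
  rw [pair_dorfman_swap, dorfman_smul_right', pair_add_left, pair_smul_left', pair_smul_left',
    pair_dorfman_swap H v u, pair_smul_left', Derivation.leibniz, pair_symm v u]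
  simp only [smul_eq_mul]
  ring

/-- The vector components satisfy the Jacobi identity of the Lie bracket. In the 1-form components
the terms without `H` cancel once nested brackets are put in a normal form, and the terms with `H`
add up to `d3 H`. -/
lemma dorfman_jacobi (hH : ∀ X Y Z W, d3 H X Y Z W = 0) (u v w : GT A) :
    dorfman H u (dorfman H v w)
      = dorfman H (dorfman H u v) w + dorfman H v (dorfman H u w) := by
  refine Prod.ext ?_ (LinearMap.ext fun Z => ?_)
  · simp only [Prod.fst_add, dorfman_fst]
    exact leibniz_lie _ _ _
  · have h := hH u.1 v.1 w.1 Z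
    simp only [d3] at h
    have j1 : ⁅u.1, ⁅v.1, Z⁆⁆ = ⁅⁅u.1, v.1⁆, Z⁆ + ⁅v.1, ⁅u.1, Z⁆⁆ := leibniz_lie _ _ _
    have j2 : ⁅u.1, ⁅w.1, Z⁆⁆ = ⁅⁅u.1, w.1⁆, Z⁆ + ⁅w.1, ⁅u.1, Z⁆⁆ := leibniz_lie _ _ _
    have j3 : ⁅v.1, ⁅w.1, Z⁆⁆ = ⁅⁅v.1, w.1⁆, Z⁆ + ⁅w.1, ⁅v.1, Z⁆⁆ := leibniz_lie _ _ _
    simp only [Prod.snd_add, LinearMap.add_apply, dorfman_snd_apply, dorfman_fst, j1, j2, j3,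
      map_add, map_sub, Derivation.commutator_apply]
    rw [form3_rotate H ⁅u.1, Z⁆ v.1 w.1, form3_rotate H ⁅w.1, Z⁆ u.1 v.1,
      form3_rotate H ⁅v.1, Z⁆ u.1 w.1, form3_swap12 H ⁅v.1, w.1⁆ u.1 Z,
      form3_swap12 H ⁅u.1, w.1⁆ v.1 Z]
    linear_combination h

lemma courant_eq_dorfman {u v : GT A} (h : pair u v = 0) : courant H u v = dorfman H u v := by
  have h1 := dorfman_add_swap H u v
  have h2 : ((0, (2 : ℝ) • dFn (pair u v)) : GT A) = 0 := by
    rw [h]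
    refine Prod.ext rfl (LinearMap.ext fun Z => ?_)
    change (2 : ℝ) • Z 0 = 0
    rw [map_zero, smul_zero]
  rw [h2, add_eq_zero_iff_neg_eq] at h1
  rw [courant, ← h1, sub_neg_eq_add, ← two_smul ℝ, smul_smul]
  norm_num

end CourantAxioms
end Heterotic

namespace Heterotic

/-! ## The Levi-Civita connection -/

section LeviCivita

variable {B : Type*} [CommRing B] [Algebra ℝ B] (g : PseudoMetric B)

lemma smul_lie_vf (X Y : VF B) (a : B) : ⁅a • X, Y⁆ = a • ⁅X, Y⁆ - Y a • X := by
  rw [← lie_skew, lie_smul_vf, ← lie_skew X Y, smul_neg]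
  abel

lemma PseudoMetric.ext_iff' {X Y : VF B} (h : ∀ Z, g.toForm X Z = g.toForm Y Z) : X = Y :=
  g.nondegenerate.1 (LinearMap.ext h)

/-- The vector field dual to a 1-form. -/
noncomputable def PseudoMetric.sharp (η : Form1 B) : VF B := (g.nondegenerate.2 η).choose

lemma PseudoMetric.toForm_sharp (η : Form1 B) (Z : VF B) : g.toForm (g.sharp η) Z = η Z :=
  congrArg (fun η : Form1 B => η Z) (g.nondegenerate.2 η).choose_spec

/-- `nabla` is a choice, so existence has to be supplied: the Koszul expression is linear over
functions in `Z`, hence a 1-form, and `g` represents every 1-form by a vector field. -/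
lemma PseudoMetric.nabla_spec (X Y Z : VF B) :
    g.toForm (g.nabla X Y) Z = (1 / 2 : ℝ) • g.koszul X Y Z := by
  have hex : ∃ W, ∀ Z, g.toForm W Z = (1 / 2 : ℝ) • g.koszul X Y Z := by
    let η : Form1 B :=
      { toFun := fun Z => (1 / 2 : ℝ) • g.koszul X Y Z
        map_add' := fun Z W => by
          simp only [PseudoMetric.koszul, map_add, lie_add, Derivation.add_apply,
            LinearMap.add_apply]
          algebra
        map_smul' := fun a Z => by
          simp only [PseudoMetric.koszul, map_smul, lie_smul_vf, map_add, Derivation.leibniz,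
            Derivation.smul_apply, LinearMap.add_apply, LinearMap.smul_apply, smul_eq_mul,
            RingHom.id_apply]
          rw [g.symm Z X, g.symm Z Y]
          algebra }
    exact ⟨g.sharp η, fun Z => g.toForm_sharp η Z⟩
  exact Classical.epsilon_spec (p := fun W => ∀ Z, g.toForm W Z = (1 / 2 : ℝ) • g.koszul X Y Z)
    hex Z

lemma PseudoMetric.nabla_add_left (X X' Y : VF B) :
    g.nabla (X + X') Y = g.nabla X Y + g.nabla X' Y := by
  refine g.ext_iff' fun Z => ?_
  simp only [map_add, LinearMap.add_apply, nabla_spec, koszul, add_lie,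
    Derivation.add_apply]
  algebra

lemma PseudoMetric.nabla_smul_left (f : B) (X Y : VF B) :
    g.nabla (f • X) Y = f • g.nabla X Y := by
  refine g.ext_iff' fun Z => ?_
  simp only [map_smul, LinearMap.smul_apply, nabla_spec, koszul, smul_lie_vf, map_sub,
    LinearMap.sub_apply, Derivation.leibniz, Derivation.smul_apply, smul_eq_mul]
  rw [g.symm X Y]
  algebra

lemma PseudoMetric.nabla_add_right (X Y Y' : VF B) :
    g.nabla X (Y + Y') = g.nabla X Y + g.nabla X Y' := by
  refine g.ext_iff' fun Z => ?_
  simp only [map_add, LinearMap.add_apply, nabla_spec, koszul, add_lie, lie_add,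
    Derivation.add_apply]
  algebra

lemma PseudoMetric.nabla_smul_right (f : B) (X Y : VF B) :
    g.nabla X (f • Y) = X f • Y + f • g.nabla X Y := by
  refine g.ext_iff' fun Z => ?_
  simp only [map_smul, map_add, LinearMap.add_apply, LinearMap.smul_apply, nabla_spec, koszul,
    smul_lie_vf, lie_smul_vf, map_sub, LinearMap.sub_apply, Derivation.leibniz,
    Derivation.smul_apply, smul_eq_mul]
  rw [g.symm Y X]
  algebra

lemma PseudoMetric.nabla_sub_left (X X' Y : VF B) :
    g.nabla (X - X') Y = g.nabla X Y - g.nabla X' Y := by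
  have h := g.nabla_add_left (X - X') X' Y
  rw [sub_add_cancel] at h
  rw [h, add_sub_cancel_right]

lemma PseudoMetric.nabla_torsion (X Y : VF B) : g.nabla X Y - g.nabla Y X = ⁅X, Y⁆ := by
  refine g.ext_iff' fun Z => ?_
  simp only [map_sub, LinearMap.sub_apply, nabla_spec, koszul]
  rw [g.symm Y X, ← lie_skew X Y, map_neg, LinearMap.neg_apply]
  algebra

lemma PseudoMetric.nabla_metric (X Y Z : VF B) :
    X (g.toForm Y Z) = g.toForm (g.nabla X Y) Z + g.toForm Y (g.nabla X Z) := by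
  rw [g.symm Y (g.nabla X Z)]
  simp only [nabla_spec, koszul]
  rw [g.symm Z Y, g.symm X Y, g.symm X Z, ← lie_skew Z Y, map_neg, LinearMap.neg_apply,]
  algebra

/-- Metric compatibility applied twice, antisymmetrised in `X` and `Y`: the products of first
derivatives cancel. -/
lemma PseudoMetric.curv_skew (X Y Z W : VF B) :
    g.toForm (curv g.nabla X Y Z) W = -g.toForm Z (curv g.nabla X Y W) := by
  have h1 := congrArg X (g.nabla_metric Y Z W)
  have h2 := congrArg Y (g.nabla_metric X Z W)
  have h3 := g.nabla_metric ⁅X, Y⁆ Z W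
  rw [Derivation.commutator_apply] at h3
  simp only [map_add, g.nabla_metric X, g.nabla_metric Y] at h1 h2 h3
  simp only [curv, map_sub, LinearMap.sub_apply]
  linear_combination h3

/-- Without torsion the cyclic sum collapses to the Jacobi identity of the Lie bracket. -/
lemma PseudoMetric.curv_bianchi (X Y Z : VF B) :
    curv g.nabla X Y Z + curv g.nabla Y Z X + curv g.nabla Z X Y = 0 := by
  have e : ∀ U V W : VF B, g.nabla ⁅U, V⁆ W = g.nabla W ⁅U, V⁆ + ⁅⁅U, V⁆, W⁆ := fun U V W => by
    rw [← g.nabla_torsion ⁅U, V⁆ W]; abel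
  have s : ∀ U V W : VF B, g.nabla W ⁅U, V⁆ = g.nabla W (g.nabla U V) - g.nabla W (g.nabla V U) := by
    intro U V W
    have h := g.nabla_add_right W ⁅U, V⁆ (g.nabla V U)
    rw [← g.nabla_torsion U V, sub_add_cancel] at h
    rw [h, g.nabla_torsion, add_sub_cancel_right]
  have j := lie_jacobi X Y Z
  have j' : ⁅⁅Y, Z⁆, X⁆ + ⁅⁅Z, X⁆, Y⁆ + ⁅⁅X, Y⁆, Z⁆ = 0 := by
    rw [← lie_skew ⁅Y, Z⁆, ← lie_skew ⁅Z, X⁆, ← lie_skew ⁅X, Y⁆, ← neg_eq_zero, ← j]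
    abel
  simp only [curv, e, s]
  rw [← neg_eq_zero, ← j']
  abel

lemma curv_swap (D : VF B → VF B → VF B) (hD : ∀ X Y, D (-X) Y = -D X Y) (X Y Z : VF B) :
    curv D Y X Z = -curv D X Y Z := by
  simp only [curv]
  rw [← lie_skew Y X, hD]
  abel

lemma PseudoMetric.nabla_neg_left (X Y : VF B) : g.nabla (-X) Y = -g.nabla X Y := by
  have h := g.nabla_smul_left (-1) X Y
  rwa [neg_one_smul, neg_one_smul] at h

end LeviCivita

/-! ## Local frames

A ring homomorphism `q` plays the role of the restriction of functions to an open set on which the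
frames are defined. -/

section Frames

variable {B C : Type*} [CommRing B] [Algebra ℝ B] [CommRing C] [Algebra ℝ C]

/-- A functional on vector fields that is linear along `q`. -/
def QLin (q : B →ₐ[ℝ] C) (β : VF B → C) : Prop :=
  (∀ X Y, β (X + Y) = β X + β Y) ∧ ∀ f X, β (f • X) = q f * β X

/-- `e` is a frame with `g`-dual frame `e'` after restriction along `q`, and `q` is compatible with
vector fields. -/
structure QFrame (g : PseudoMetric B) (q : B →ₐ[ℝ] C) {m : ℕ} (e e' : Fin m → VF B) : Prop where
  dual : ∀ i j, q (g.toForm (e i) (e' j)) = if i = j then 1 else 0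
  expand : ∀ β, QLin q β → ∀ X, β X = ∑ i, q (g.toForm X (e' i)) * β (e i)
  deriv : ∀ (X : VF B) b, q b = 0 → q (X b) = 0

namespace QFrame

variable {g : PseudoMetric B} {q : B →ₐ[ℝ] C} {m : ℕ} {e e' : Fin m → VF B} (h : QFrame g q e e')
include h

/-- Expanding the vectors `e'` in the frame `e`, both sides become the contraction of `β` with the
matrix `g(e'_j, e'_k)`, which is symmetric. -/
lemma trace_swap (β : VF B → VF B → C) (h1 : ∀ Y, QLin q fun X => β X Y) (h2 : ∀ X, QLin q (β X)) :
    ∑ j, β (e' j) (e j) = ∑ j, β (e j) (e' j) := by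
  have a1 : ∀ j, β (e' j) (e j) = ∑ k, q (g.toForm (e' j) (e' k)) * β (e k) (e j) := fun j =>
    h.expand (fun X => β X (e j)) (h1 _) _
  have a2 : ∀ j, β (e j) (e' j) = ∑ k, q (g.toForm (e' j) (e' k)) * β (e j) (e k) := fun j =>
    h.expand (β (e j)) (h2 _) _
  simp only [a1, a2]
  rw [Finset.sum_comm]
  refine Finset.sum_congr rfl fun j _ => Finset.sum_congr rfl fun k _ => ?_
  rw [g.symm]

lemma expand' (β : VF B → C) (hβ : QLin q β) (X : VF B) :
    β X = ∑ i, q (g.toForm X (e i)) * β (e' i) := by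
  rw [h.expand β hβ X]
  refine h.trace_swap (fun U W => q (g.toForm X U) * β W) (fun Y => ⟨fun U W => ?_, fun f U => ?_⟩)
    (fun U => ⟨fun Y W => ?_, fun f Y => ?_⟩)
  · simp only [map_add]; ring
  · simp only [map_smul, smul_eq_mul, map_mul]; ring
  · beta_reduce; rw [hβ.1]; ring
  · beta_reduce; rw [hβ.2]; ring

/-- Duality of the frames holds only after `q`. It may be differentiated because the kernel of `q`
is stable under vector fields. -/
lemma deriv_dual (Y : VF B) (i j : Fin m) : q (Y (g.toForm (e i) (e' j))) = 0 := by
  have h1 : q (g.toForm (e i) (e' j) - if i = j then 1 else 0) = 0 := by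
    rw [map_sub, h.dual]
    split_ifs <;> simp
  have h2 := h.deriv Y _ h1
  rw [map_sub, map_sub] at h2
  have h3 : Y (if i = j then (1 : B) else 0) = 0 := by split_ifs <;> simp
  rwa [h3, map_zero, sub_zero] at h2

lemma trace_comp (S T : VF B → VF B) (hS1 : ∀ X Y, S (X + Y) = S X + S Y)
    (hS2 : ∀ (f : B) X, S (f • X) = f • S X) (hT1 : ∀ X Y, T (X + Y) = T X + T Y)
    (hT2 : ∀ (f : B) X, T (f • X) = f • T X) :
    ∑ j, q (g.toForm (S (T (e j))) (e' j)) = ∑ j, q (g.toForm (T (S (e j))) (e' j)) := by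
  have a1 : ∀ j, q (g.toForm (S (T (e j))) (e' j))
      = ∑ k, q (g.toForm (T (e j)) (e' k)) * q (g.toForm (S (e k)) (e' j)) := fun j =>
    h.expand (fun X => q (g.toForm (S X) (e' j))) ⟨fun X Y => by simp [hS1], fun f X => by
      simp [hS2]⟩ _
  have a2 : ∀ j, q (g.toForm (T (S (e j))) (e' j))
      = ∑ k, q (g.toForm (S (e j)) (e' k)) * q (g.toForm (T (e k)) (e' j)) := fun j =>
    h.expand (fun X => q (g.toForm (T X) (e' j))) ⟨fun X Y => by simp [hT1], fun f X => by
      simp [hT2]⟩ _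
  simp only [a1, a2]
  rw [Finset.sum_comm]
  exact Finset.sum_congr rfl fun j _ => Finset.sum_congr rfl fun k _ => mul_comm _ _

/-- The covariant derivative commutes with traces. -/
lemma deriv_trace (Y : VF B) (T : VF B → VF B) (hT1 : ∀ X Y, T (X + Y) = T X + T Y)
    (hT2 : ∀ (f : B) X, T (f • X) = f • T X) :
    q (Y (∑ j, g.toForm (T (e j)) (e' j))) = ∑ j, q (g.toForm (g.nabla Y (T (e j))) (e' j))
      - ∑ j, q (g.toForm (T (g.nabla Y (e j))) (e' j)) := by
  have a1 : ∀ j, q (g.toForm (T (e j)) (g.nabla Y (e' j)))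
      = ∑ k, q (g.toForm (g.nabla Y (e' j)) (e k)) * q (g.toForm (T (e j)) (e' k)) := fun j =>
    h.expand' (fun X => q (g.toForm (T (e j)) X)) ⟨fun X Y => by simp, fun f X => by simp⟩ _
  have a2 : ∀ j, q (g.toForm (T (g.nabla Y (e j))) (e' j))
      = ∑ k, q (g.toForm (g.nabla Y (e j)) (e' k)) * q (g.toForm (T (e k)) (e' j)) := fun j =>
    h.expand (fun X => q (g.toForm (T X) (e' j))) ⟨fun X Y => by simp [hT1], fun f X => by
      simp [hT2]⟩ _
  -- The coefficient matrices of `∇e` and `∇e'` are opposite transposes, because `g(e_k, e'_j)` has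
  -- zero derivative after `q`.
  have a3 : ∑ j, q (g.toForm (T (e j)) (g.nabla Y (e' j)))
      + ∑ j, q (g.toForm (T (g.nabla Y (e j))) (e' j)) = 0 := by
    simp only [a1, a2]
    rw [Finset.sum_comm (f := fun j k => q (g.toForm (g.nabla Y (e j)) (e' k))
      * q (g.toForm (T (e k)) (e' j))), ← Finset.sum_add_distrib]
    refine Finset.sum_eq_zero fun j _ => ?_
    rw [← Finset.sum_add_distrib]
    refine Finset.sum_eq_zero fun k _ => ?_
    have h1 := h.deriv_dual Y k j
    rw [g.nabla_metric, map_add, g.symm (e k)] at h1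
    linear_combination q (g.toForm (T (e j)) (e' k)) * h1
  rw [map_sum, map_sum]
  simp only [g.nabla_metric Y, map_add, Finset.sum_add_distrib]
  linear_combination a3

/-- This is the shape in which Ricci curvature comes out of `trace_gCurv`: a divergence of `∇_Y Z`,
the derivative of the divergence of `Z`, and the trace of a product. Vanishing torsion rewrites
`∇_{[e_j, Y]}`, `deriv_trace` moves `∇_Y` out of the trace, and cyclicity of the trace does the
rest. -/
lemma ric_eq (Y Z : VF B) : ∑ j, q (g.toForm (curv g.nabla (e j) Y Z) (e' j))
    = ∑ j, q (g.toForm (g.nabla (e j) (g.nabla Y Z)) (e' j))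
      - q (Y (∑ j, g.toForm (g.nabla (e j) Z) (e' j)))
      - ∑ j, q (g.toForm (g.nabla (g.nabla (e j) Z) Y) (e' j)) := by
  rw [h.deriv_trace Y (fun X => g.nabla X Z) (fun X X' => g.nabla_add_left X X' Z)
    fun f X => g.nabla_smul_left f X Z]
  rw [h.trace_comp (fun X => g.nabla X Y) (fun X => g.nabla X Z)
    (fun X X' => g.nabla_add_left X X' Y) (fun f X => g.nabla_smul_left f X Y)
    (fun X X' => g.nabla_add_left X X' Z) fun f X => g.nabla_smul_left f X Z]
  simp only [curv, ← g.nabla_torsion, g.nabla_sub_left, map_sub, LinearMap.sub_apply,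
    Finset.sum_sub_distrib]
  ring

/-- By the first Bianchi identity the two sides differ by the trace of `R(Y, Z)`, and an
endomorphism skew for `g` has trace zero. -/
lemma ric_symm (Y Z : VF B) : ∑ j, q (g.toForm (curv g.nabla (e j) Y Z) (e' j))
    = ∑ j, q (g.toForm (curv g.nabla (e j) Z Y) (e' j)) := by
  have key : ∑ j, q (g.toForm (curv g.nabla Y Z (e j)) (e' j)) = 0 := by
    have lin1 : ∀ X X', curv g.nabla Y Z (X + X') = curv g.nabla Y Z X + curv g.nabla Y Z X' := by
      intro X X'
      simp only [curv, g.nabla_add_right]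
      abel
    have lin2 : ∀ (f : B) X, curv g.nabla Y Z (f • X) = f • curv g.nabla Y Z X := by
      intro f X
      simp only [curv, g.nabla_smul_right, g.nabla_add_right, Derivation.commutator_apply,
        sub_smul, smul_sub]
      abel
    have e1 := h.trace_swap (fun X W => q (g.toForm (curv g.nabla Y Z X) W))
      (fun W => ⟨fun X X' => by simp [lin1], fun f X => by simp [lin2]⟩)
      (fun X => ⟨fun W W' => by simp, fun f W => by simp⟩)
    simp only [g.curv_skew Y Z (e' _), g.symm (e' _), map_neg, Finset.sum_neg_distrib] at e1
    have e2 : (2 : ℝ) • ∑ j, q (g.toForm (curv g.nabla Y Z (e j)) (e' j)) = 0 := by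
      linear_combination (norm := algebra) -e1
    have e3 := congrArg (fun c : C => (1 / 2 : ℝ) • c) e2
    simpa [smul_smul] using e3
  have e : ∀ j, curv g.nabla (e j) Y Z = curv g.nabla (e j) Z Y - curv g.nabla Y Z (e j) := by
    intro j
    have b := g.curv_bianchi (e j) Y Z
    rw [curv_swap g.nabla g.nabla_neg_left (e j) Z Y] at b
    rw [eq_sub_iff_add_eq, ← sub_eq_zero, ← b]
    abel
  simp only [e, map_sub, LinearMap.sub_apply, Finset.sum_sub_distrib, key, sub_zero]

variable (H : Form3 B)

lemma HH_symm (Y Z : VF B) : ∑ j, ∑ k, q (H ![e j, Y, e k]) * q (H ![e' j, Z, e' k])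
    = ∑ j, ∑ k, q (H ![e j, Z, e k]) * q (H ![e' j, Y, e' k]) := by
  have s1 : ∀ U U', ∑ k, q (H ![U', Y, e' k]) * q (H ![U, Z, e k])
      = ∑ k, q (H ![U', Y, e k]) * q (H ![U, Z, e' k]) := fun U U' =>
    h.trace_swap (fun W W' => q (H ![U', Y, W]) * q (H ![U, Z, W']))
      (fun W => ⟨fun X X' => by beta_reduce; rw [form3_add₃, map_add]; ring, fun f X => by
        beta_reduce; rw [form3_smul₃, map_mul]; ring⟩)
      (fun W => ⟨fun X X' => by beta_reduce; rw [form3_add₃, map_add]; ring, fun f X => by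
        beta_reduce; rw [form3_smul₃, map_mul]; ring⟩)
  have s2 := h.trace_swap (fun U U' => ∑ k, q (H ![U', Y, e k]) * q (H ![U, Z, e' k]))
      (fun W => ⟨fun X X' => by
          simp only [form3_add₁, map_add, mul_add, Finset.sum_add_distrib], fun f X => by
          simp only [form3_smul₁, map_mul, Finset.mul_sum]
          exact Finset.sum_congr rfl fun _ _ => by ring⟩)
      (fun W => ⟨fun X X' => by
          simp only [form3_add₁, map_add, add_mul, Finset.sum_add_distrib], fun f X => by
          simp only [form3_smul₁, map_mul, Finset.mul_sum]
          exact Finset.sum_congr rfl fun _ _ => by ring⟩)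
  rw [s2]
  refine Finset.sum_congr rfl fun j _ => ?_
  rw [← s1]
  exact Finset.sum_congr rfl fun k _ => mul_comm _ _

/-- The Ricci tensor of a connection with torsion `H`, decomposed into Levi-Civita terms. -/
lemma ric_torsion (Y Z : VF B) :
    q (∑ j, g.toForm (g.nabla (e j) (g.nabla Y Z
        + (1 / 2 : ℝ) • g.sharp (contr2 H Y Z))) (e' j))
      - q (Y (∑ j, g.toForm (g.nabla (e j) Z) (e' j)))
      + ∑ j, q ((1 / 2 : ℝ) • H ![g.nabla (e j) Z + (1 / 2 : ℝ) • g.sharp (contr2 H (e j) Z), Y, e' j]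
        - g.toForm (g.nabla (g.nabla (e j) Z + (1 / 2 : ℝ) • g.sharp (contr2 H (e j) Z)) Y) (e' j))
      = q (∑ j, g.toForm (curv g.nabla (e j) Y Z) (e' j))
        - (1 / 4 : ℝ) • q (∑ j, ∑ k, H ![e j, Y, e k] * H ![e' j, Z, e' k])
        + (1 / 2 : ℝ) • q (∑ j, g.nabla3 H (e j) (e' j) Y Z) := by
  have hs : ∀ X Y W, g.toForm (g.sharp (contr2 H X Y)) W = H ![X, Y, W] := fun X Y W =>
    g.toForm_sharp _ W
  have sm : ∀ X : VF B, (1 / 2 : ℝ) • X = algebraMap ℝ B (1 / 2) • X := fun X =>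
    (algebraMap_smul B (1 / 2 : ℝ) X).symm
  have smq : ∀ b : B, q (algebraMap ℝ B (1 / 2) * b) = (1 / 2 : ℝ) • q b := fun b => by
    rw [← Algebra.smul_def, map_smul]
  have hr := h.ric_eq Y Z
  -- After the Leibniz rule, the terms with `∇Y` and `∇Z` cancel against `t6` and against the term
  -- with `H` evaluated on `∇_{e_j} Z`. Only the divergence of `H` is left.
  have t2 : ∑ j, q (g.toForm (g.nabla (e j) (g.sharp (contr2 H Y Z))) (e' j))
      = ∑ j, q (g.nabla3 H (e j) (e' j) Y Z) + ∑ j, q (H ![g.nabla (e j) Y, Z, e' j])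
        - ∑ j, q (H ![g.nabla (e j) Z, Y, e' j]) := by
    rw [← Finset.sum_add_distrib, ← Finset.sum_sub_distrib]
    refine Finset.sum_congr rfl fun j _ => ?_
    rw [← map_add, ← map_sub]
    congr 1
    have hm := g.nabla_metric (e j) (g.sharp (contr2 H Y Z)) (e' j)
    rw [hs, hs] at hm
    simp only [PseudoMetric.nabla3]
    rw [← form3_rotate H (e' j) Y Z, ← form3_rotate H (g.nabla (e j) (e' j)) Y Z,
      ← form3_rotate H (e' j) (g.nabla (e j) Y) Z, ← form3_rotate H (e' j) Y (g.nabla (e j) Z),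
      form3_swap12 H Y (g.nabla (e j) Z) (e' j)]
    linear_combination -hm
  have t4 : ∑ j, q (H ![g.sharp (contr2 H (e j) Z), Y, e' j])
      = -∑ j, ∑ k, q (H ![e j, Y, e k]) * q (H ![e' j, Z, e' k]) := by
    rw [h.HH_symm, ← Finset.sum_neg_distrib]
    refine Finset.sum_congr rfl fun j _ => ?_
    rw [h.expand' (fun X => q (H ![X, Y, e' j])) ⟨fun X X' => by simp only [form3_add₁, map_add],
      fun f X => by simp only [form3_smul₁, map_mul]⟩, ← Finset.sum_neg_distrib]
    refine Finset.sum_congr rfl fun k _ => ?_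
    rw [hs, form3_swap13 H (e' j), map_neg]
    ring
  have t6 : ∑ j, q (g.toForm (g.nabla (g.sharp (contr2 H (e j) Z)) Y) (e' j))
      = ∑ j, q (H ![g.nabla (e j) Y, Z, e' j]) := by
    rw [h.trace_comp (fun X => g.nabla X Y) (fun X => g.sharp (contr2 H X Z))
      (fun X X' => g.nabla_add_left X X' Y) (fun f X => g.nabla_smul_left f X Y)
      (fun X X' => g.ext_iff' fun W => by
        rw [map_add, LinearMap.add_apply, hs, hs, hs, form3_add₁])
      fun f X => g.ext_iff' fun W => by
        rw [map_smul, LinearMap.smul_apply, hs, hs, form3_smul₁, smul_eq_mul]]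
    simp only [hs]
  simp only [sm, g.nabla_add_left, g.nabla_add_right, g.nabla_smul_left, g.nabla_smul_right,
    form3_add₁, form3_smul₁, map_add, map_smul, LinearMap.add_apply, LinearMap.smul_apply,
    Derivation.map_algebraMap, map_sum, map_sub, zero_smul, zero_add, smul_eq_mul,
    Finset.sum_add_distrib, Finset.sum_sub_distrib, smul_add, smq, map_mul,
    ← Finset.smul_sum] at *
  rw [t2, t4, t6]
  linear_combination (norm := algebra) -hr

end QFrame

end Frames
end Heterotic

namespace Heterotic

/-! ## Reduced Courant algebroids with an admissible metric -/

/-- The algebraic content of a reduced Courant algebroid with sections `S` over the base with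
functions `B`, of an admissible metric `V` and of the data `g, λ, H` that it determines. The pairing
takes values in the algebra `A` of functions on the total space. -/
structure Reduction (A B : Type*) [CommRing A] [Algebra ℝ A] [CommRing B] [Algebra ℝ B] where
  pull : B →ₐ[ℝ] A
  pull_injective : Function.Injective pull
  Hhat : Form3 A
  closed : ∀ X Y Z W, d3 Hhat X Y Z W = 0
  S : Submodule ℝ (GT A)
  smul_mem : ∀ f, ∀ e ∈ S, pull f • e ∈ S
  bracket_mem : ∀ u ∈ S, ∀ v ∈ S, dorfman Hhat u v ∈ S
  proj : GT A → VF B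
  proj_spec : ∀ e ∈ S, ∀ f, e.1 (pull f) = pull (proj e f)
  pair_mem : ∀ u ∈ S, ∀ v ∈ S, ∃ b, pair u v = pull b
  nondeg : ∀ e ∈ S, (∀ f ∈ S, pair e f = 0) → e = 0
  V : Submodule ℝ (GT A)
  V_le : V ≤ S
  V_smul : ∀ f, ∀ v ∈ V, pull f • v ∈ V
  V_nondeg : ∀ v ∈ V, (∀ w ∈ V, pair v w = 0) → v = 0
  plus : GT A → GT A
  plus_mem : ∀ e ∈ S, plus e ∈ V
  plus_orth : ∀ e ∈ S, ∀ w ∈ V, pair (e - plus e) w = 0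
  g : PseudoMetric B
  lift : VF B → GT A
  lift_mem : ∀ X, lift X ∈ V
  proj_lift : ∀ X, proj (lift X) = X
  lift_orth : ∀ X, ∀ v ∈ V, proj v = 0 → pair (lift X) v = 0
  g_eq : ∀ X Y, pair (lift X) (lift Y) = pull (g.toForm X Y)
  lam : VF B → GT A
  lam_mem : ∀ X, lam X ∈ S
  lam_fst : ∀ X, (lam X).1 = (lift X).1
  lam_pair : ∀ X, ∀ e ∈ S,
    pair (lift X) e - pair (lam X) e = (1 / 2 : ℝ) • pull (g.toForm X (proj e))
  H : Form3 B
  H_eq : ∀ X Y Z, pull (H ![X, Y, Z]) = (2 : ℝ) • pair (dorfman Hhat (lam X) (lam Y)) (lam Z)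
  minus_eq_zero : ∀ u ∈ S, proj u = 0 → (∀ v ∈ V, pair u v = 0) → u = 0

namespace Reduction

variable {A B : Type*} [CommRing A] [Algebra ℝ A] [CommRing B] [Algebra ℝ B] (R : Reduction A B)

/-- The bracket. -/
noncomputable abbrev br (u v : GT A) : GT A := dorfman R.Hhat u v

lemma lift_mem_S (X : VF B) : R.lift X ∈ R.S := R.V_le (R.lift_mem X)

lemma proj_eq {e : GT A} (he : e ∈ R.S) {Y : VF B} (h : ∀ f, e.1 (R.pull f) = R.pull (Y f)) :
    R.proj e = Y := by
  ext f
  exact R.pull_injective ((R.proj_spec e he f).symm.trans (h f))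

lemma proj_add {u v : GT A} (hu : u ∈ R.S) (hv : v ∈ R.S) :
    R.proj (u + v) = R.proj u + R.proj v := by
  refine R.proj_eq (R.S.add_mem hu hv) fun f => ?_
  simp only [Prod.fst_add, Derivation.add_apply, R.proj_spec u hu, R.proj_spec v hv, map_add]

lemma proj_sub {u v : GT A} (hu : u ∈ R.S) (hv : v ∈ R.S) :
    R.proj (u - v) = R.proj u - R.proj v := by
  refine R.proj_eq (R.S.sub_mem hu hv) fun f => ?_
  simp only [Prod.fst_sub, Derivation.sub_apply, R.proj_spec u hu, R.proj_spec v hv, map_sub]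

lemma proj_smul {u : GT A} (hu : u ∈ R.S) (a : B) : R.proj (R.pull a • u) = a • R.proj u := by
  refine R.proj_eq (R.smul_mem a u hu) fun f => ?_
  simp only [Prod.smul_fst, Derivation.smul_apply, R.proj_spec u hu, smul_eq_mul, map_mul]

lemma proj_br {u v : GT A} (hu : u ∈ R.S) (hv : v ∈ R.S) :
    R.proj (R.br u v) = ⁅R.proj u, R.proj v⁆ := by
  refine R.proj_eq (R.bracket_mem u hu v hv) fun f => ?_
  simp only [dorfman_fst, Derivation.commutator_apply, R.proj_spec u hu, R.proj_spec v hv,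
    map_sub]

lemma proj_lam (X : VF B) : R.proj (R.lam X) = X := by
  refine R.proj_eq (R.lam_mem X) fun f => ?_
  rw [R.lam_fst, R.proj_spec _ (R.lift_mem_S X), R.proj_lift]

lemma V_ext {v w : GT A} (hv : v ∈ R.V) (hw : w ∈ R.V) (h : ∀ u ∈ R.V, pair v u = pair w u) :
    v = w :=
  sub_eq_zero.mp (R.V_nondeg _ (R.V.sub_mem hv hw) fun u hu => by
    rw [pair_sub_left, h u hu, sub_self])

lemma S_ext {v w : GT A} (hv : v ∈ R.S) (hw : w ∈ R.S) (h : ∀ u ∈ R.S, pair v u = pair w u) :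
    v = w :=
  sub_eq_zero.mp (R.nondeg _ (R.S.sub_mem hv hw) fun u hu => by
    rw [pair_sub_left, h u hu, sub_self])

lemma pair_lift {v : GT A} (hv : v ∈ R.V) (X : VF B) :
    pair (R.lift X) v = R.pull (R.g.toForm X (R.proj v)) := by
  have hS := R.V_le hv
  have h := R.lift_orth X (v - R.lift (R.proj v)) (R.V.sub_mem hv (R.lift_mem _)) (by
    rw [R.proj_sub hS (R.lift_mem_S _), R.proj_lift, sub_self])
  rw [pair_sub_right, sub_eq_zero] at h
  rw [h, R.g_eq]

/-- `lift` and `lam` are given as bare functions. Their linearity is forced by their pairings with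
`V` and with `E`, through nondegeneracy. -/
lemma lift_add (X Y : VF B) : R.lift (X + Y) = R.lift X + R.lift Y := by
  refine R.V_ext (R.lift_mem _) (R.V.add_mem (R.lift_mem _) (R.lift_mem _)) fun u hu => ?_
  rw [pair_add_left, R.pair_lift hu, R.pair_lift hu, R.pair_lift hu, map_add, LinearMap.add_apply,
    map_add]

lemma lift_smul (f : B) (X : VF B) : R.lift (f • X) = R.pull f • R.lift X := by
  refine R.V_ext (R.lift_mem _) (R.V_smul f _ (R.lift_mem _)) fun u hu => ?_
  rw [pair_smul_left', R.pair_lift hu, R.pair_lift hu, map_smul, LinearMap.smul_apply, smul_eq_mul,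
    map_mul]

lemma pair_lam {e : GT A} (he : e ∈ R.S) (X : VF B) : pair (R.lam X) e
    = pair (R.lift X) e - (1 / 2 : ℝ) • R.pull (R.g.toForm X (R.proj e)) := by
  rw [← R.lam_pair X e he]
  ring

lemma lam_add (X Y : VF B) : R.lam (X + Y) = R.lam X + R.lam Y := by
  refine R.S_ext (R.lam_mem _) (R.S.add_mem (R.lam_mem _) (R.lam_mem _)) fun u hu => ?_
  rw [pair_add_left, R.pair_lam hu, R.pair_lam hu, R.pair_lam hu, R.lift_add, pair_add_left,
    map_add, LinearMap.add_apply, map_add]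
  algebra

lemma lam_smul (f : B) (X : VF B) : R.lam (f • X) = R.pull f • R.lam X := by
  refine R.S_ext (R.lam_mem _) (R.smul_mem f _ (R.lam_mem _)) fun u hu => ?_
  rw [pair_smul_left', R.pair_lam hu, R.pair_lam hu, R.lift_smul, pair_smul_left',
    map_smul, LinearMap.smul_apply, smul_eq_mul, map_mul]
  algebra

lemma lam_zero : R.lam 0 = 0 := by
  have h := R.lam_smul 0 0
  simpa using h

lemma lift_zero : R.lift 0 = 0 := by
  have h := R.lift_smul 0 0
  simpa using h

/-- The section of `T*` that is `g(X)`. -/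
noncomputable def flat (X : VF B) : GT A := R.lift X - R.lam X

lemma flat_mem (X : VF B) : R.flat X ∈ R.S := R.S.sub_mem (R.lift_mem_S X) (R.lam_mem X)

lemma flat_fst (X : VF B) : (R.flat X).1 = 0 := by
  rw [flat, Prod.fst_sub, R.lam_fst, sub_self]

lemma proj_flat (X : VF B) : R.proj (R.flat X) = 0 := by
  rw [flat, R.proj_sub (R.lift_mem_S X) (R.lam_mem X), R.proj_lift, R.proj_lam, sub_self]

lemma pair_flat {e : GT A} (he : e ∈ R.S) (X : VF B) :
    pair (R.flat X) e = (1 / 2 : ℝ) • R.pull (R.g.toForm X (R.proj e)) := by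
  rw [flat, pair_sub_left, R.lam_pair X e he]

lemma lift_eq (X : VF B) : R.lift X = R.lam X + R.flat X := by
  rw [flat]
  abel

/-- The section `X^-` of the orthogonal complement of `V` that projects to `X`. -/
noncomputable def low (X : VF B) : GT A := R.lam X - R.flat X

lemma low_mem (X : VF B) : R.low X ∈ R.S := R.S.sub_mem (R.lam_mem X) (R.flat_mem X)

lemma proj_low (X : VF B) : R.proj (R.low X) = X := by
  rw [low, R.proj_sub (R.lam_mem X) (R.flat_mem X), R.proj_flat, R.proj_lam, sub_zero]

lemma pair_lam_V {v : GT A} (hv : v ∈ R.V) (X : VF B) :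
    pair (R.lam X) v = (1 / 2 : ℝ) • R.pull (R.g.toForm X (R.proj v)) := by
  rw [R.pair_lam (R.V_le hv), R.pair_lift hv]
  algebra

/-- Isotropy of the splitting: passing from `lift` to `lam` subtracts half of `g` in each argument,
which uses up `⟨lift X, lift Y⟩ = g(X, Y)`. -/
lemma pair_lam_lam (X Y : VF B) : pair (R.lam X) (R.lam Y) = 0 := by
  rw [R.pair_lam (R.lam_mem Y), pair_symm, R.pair_lam_V (R.lift_mem X), R.proj_lift, R.proj_lam,
    R.g.symm]
  algebra

lemma pair_low_V {v : GT A} (hv : v ∈ R.V) (X : VF B) : pair (R.low X) v = 0 := by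
  rw [low, pair_sub_left, R.pair_lam_V hv, R.pair_flat (R.V_le hv), sub_self]

lemma pair_low_low (X Y : VF B) :
    pair (R.low X) (R.low Y) = -R.pull (R.g.toForm X Y) := by
  rw [low, pair_sub_left, R.pair_flat (R.low_mem Y), R.proj_low, low, pair_sub_right,
    R.pair_lam_lam, pair_symm, R.pair_flat (R.lam_mem X), R.proj_lam, R.g.symm]
  algebra

lemma flat_smul (f : B) (X : VF B) : R.flat (f • X) = R.pull f • R.flat X := by
  rw [flat, flat, R.lam_smul, R.lift_smul, smul_sub]

lemma flat_add (X Y : VF B) : R.flat (X + Y) = R.flat X + R.flat Y := by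
  rw [flat, flat, flat, R.lam_add, R.lift_add]
  abel

lemma low_smul (f : B) (X : VF B) : R.low (f • X) = R.pull f • R.low X := by
  rw [low, low, R.lam_smul, R.flat_smul, smul_sub]

lemma low_add (X Y : VF B) : R.low (X + Y) = R.low X + R.low Y := by
  rw [low, low, low, R.lam_add, R.flat_add]
  abel

/-- A section of the adjoint bundle `V ∩ Ker π`. -/
def IsAd (r : GT A) : Prop := r ∈ R.V ∧ R.proj r = 0

/-- The `ad`-component of a section of `V`. -/
noncomputable def adPart (v : GT A) : GT A := v - R.lift (R.proj v)

lemma isAd_adPart {v : GT A} (hv : v ∈ R.V) : R.IsAd (R.adPart v) :=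
  ⟨R.V.sub_mem hv (R.lift_mem _), by
    rw [adPart, R.proj_sub (R.V_le hv) (R.lift_mem_S _), R.proj_lift, sub_self]⟩

lemma V_eq (v : GT A) : v = R.lift (R.proj v) + R.adPart v := by
  rw [adPart]
  abel

lemma adPart_of_isAd {r : GT A} (hr : R.IsAd r) : R.adPart r = r := by
  rw [adPart, hr.2, R.lift_zero, sub_zero]

lemma adPart_lift (X : VF B) : R.adPart (R.lift X) = 0 := by
  rw [adPart, R.proj_lift, sub_self]

lemma adPart_add {u v : GT A} (hu : u ∈ R.S) (hv : v ∈ R.S) :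
    R.adPart (u + v) = R.adPart u + R.adPart v := by
  rw [adPart, adPart, adPart, R.proj_add hu hv, R.lift_add]
  abel

lemma adPart_smul {u : GT A} (hu : u ∈ R.S) (f : B) :
    R.adPart (R.pull f • u) = R.pull f • R.adPart u := by
  rw [adPart, adPart, R.proj_smul hu, R.lift_smul, smul_sub]

variable {R}

lemma IsAd.mem_S {r : GT A} (hr : R.IsAd r) : r ∈ R.S := R.V_le hr.1

lemma IsAd.pair_lift {r : GT A} (hr : R.IsAd r) (X : VF B) : pair (R.lift X) r = 0 :=
  R.lift_orth X r hr.1 hr.2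

lemma IsAd.pair_lam {r : GT A} (hr : R.IsAd r) (X : VF B) : pair (R.lam X) r = 0 := by
  rw [R.pair_lam_V hr.1, hr.2, map_zero, map_zero, smul_zero]

lemma IsAd.apply_pull {r : GT A} (hr : R.IsAd r) (f : B) : r.1 (R.pull f) = 0 := by
  rw [R.proj_spec r hr.mem_S, hr.2, Derivation.zero_apply, map_zero]

lemma IsAd.apply_pair {r u v : GT A} (hr : R.IsAd r) (hu : u ∈ R.S) (hv : v ∈ R.S) :
    r.1 (pair u v) = 0 := by
  obtain ⟨b, hb⟩ := R.pair_mem u hu v hv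
  rw [hb, hr.apply_pull]

variable (R)

lemma plus_of_mem {v : GT A} (hv : v ∈ R.V) : R.plus v = v := by
  refine R.V_ext (R.plus_mem v (R.V_le hv)) hv fun u hu => ?_
  have h := R.plus_orth v (R.V_le hv) u hu
  rw [pair_sub_left, sub_eq_zero] at h
  exact h.symm

lemma pair_plus {e w : GT A} (he : e ∈ R.S) (hw : w ∈ R.V) : pair (R.plus e) w = pair e w := by
  have h := R.plus_orth e he w hw
  rw [pair_sub_left, sub_eq_zero] at h
  exact h.symm

lemma plus_low (X : VF B) : R.plus (R.low X) = 0 :=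
  R.V_ext (R.plus_mem _ (R.low_mem X)) R.V.zero_mem fun u hu => by
    rw [R.pair_plus (R.low_mem X) hu, R.pair_low_V hu, pair_zero_left]

/-- The projection to the base of the component of a section in the complement of `V`. -/
noncomputable def lowProj (e : GT A) : VF B := R.proj (e - R.plus e)

/-- The difference of the two sides is orthogonal to `V` and projects to zero, so `minus_eq_zero`
applies. Thus the sections of `V_-` are exactly the `X^-`. -/
lemma sub_plus {e : GT A} (he : e ∈ R.S) : e - R.plus e = R.low (R.lowProj e) := by
  have hp := R.V_le (R.plus_mem e he)
  have hs := R.S.sub_mem he hp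
  refine sub_eq_zero.mp (R.minus_eq_zero _ (R.S.sub_mem hs (R.low_mem _)) ?_ fun v hv => ?_)
  · rw [R.proj_sub hs (R.low_mem _), R.proj_low, lowProj, sub_self]
  · rw [pair_sub_left, R.plus_orth e he v hv, R.pair_low_V hv, sub_zero]

lemma S_eq {e : GT A} (he : e ∈ R.S) : e = R.plus e + R.low (R.lowProj e) := by
  rw [← R.sub_plus he]
  abel

lemma plus_add {u v : GT A} (hu : u ∈ R.S) (hv : v ∈ R.S) :
    R.plus (u + v) = R.plus u + R.plus v := by
  refine R.V_ext (R.plus_mem _ (R.S.add_mem hu hv))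
    (R.V.add_mem (R.plus_mem _ hu) (R.plus_mem _ hv)) fun w hw => ?_
  rw [R.pair_plus (R.S.add_mem hu hv) hw, pair_add_left, pair_add_left, R.pair_plus hu hw,
    R.pair_plus hv hw]

lemma eq_low_of_orth {e : GT A} (he : e ∈ R.S) (h : ∀ v ∈ R.V, pair e v = 0) :
    e = R.low (R.proj e) := by
  have h0 : R.plus e = 0 := R.V_ext (R.plus_mem e he) R.V.zero_mem fun u hu => by
    rw [R.pair_plus he hu, h u hu, pair_zero_left]
  have h1 := R.sub_plus he
  rwa [lowProj, h0, sub_zero] at h1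

/-- The component of a section in `V ∩ Ker π`. -/
noncomputable def ad (e : GT A) : GT A := R.adPart (R.plus e)

lemma isAd_ad {e : GT A} (he : e ∈ R.S) : R.IsAd (R.ad e) := R.isAd_adPart (R.plus_mem e he)

lemma pair_ad {e r : GT A} (he : e ∈ R.S) (hr : R.IsAd r) : pair (R.ad e) r = pair e r := by
  rw [ad, adPart, pair_sub_left, hr.pair_lift, sub_zero, R.pair_plus he hr.1]

/-- The decomposition of sections into their components in `T`, `ad` and `T*`. -/
lemma ad_eq {e : GT A} (he : e ∈ R.S) : e = R.lam (R.proj e) + R.ad e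
    + R.flat (R.proj (R.plus e) - R.lowProj e) := by
  have hp := R.plus_mem e he
  have h1 := R.S_eq he
  have h2 := R.V_eq (R.plus e)
  have h3 : R.proj e = R.proj (R.plus e) + R.lowProj e := by
    conv_lhs => rw [h1]
    rw [R.proj_add (R.V_le hp) (R.low_mem _), R.proj_low]
  have h4 : R.flat (R.proj (R.plus e)) = R.flat (R.proj (R.plus e) - R.lowProj e)
      + R.flat (R.lowProj e) := by
    rw [← R.flat_add, sub_add_cancel]
  conv_lhs => rw [h1, h2, R.lift_eq, h4, low]
  rw [h3, R.lam_add, ad]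
  abel

lemma pair_isAd_eq {e r : GT A} (he : e ∈ R.S) (hr : R.IsAd r) :
    pair r e = pair r (R.ad e) := by
  rw [pair_symm, ← R.pair_ad he hr, pair_symm]

lemma V_ext' {v w : GT A} (hv : v ∈ R.V) (hw : w ∈ R.V)
    (h1 : ∀ Z, pair v (R.lift Z) = pair w (R.lift Z))
    (h2 : ∀ r, R.IsAd r → pair v r = pair w r) : v = w := by
  refine R.V_ext hv hw fun u hu => ?_
  rw [R.V_eq u, pair_add_right, pair_add_right, h1, h2 _ (R.isAd_adPart hu)]

/-! ### Brackets -/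

lemma br_mem {u v : GT A} (hu : u ∈ R.S) (hv : v ∈ R.S) : R.br u v ∈ R.S :=
  R.bracket_mem u hu v hv

/-- A section of `T*` pairs only with projections to the base, so invariance of the pairing reduces
its brackets to Lie brackets on `M`. These contributions are the Koszul terms in the mixed brackets
below. -/
lemma pair_br_flat_right {u w : GT A} (hu : u ∈ R.S) (hw : w ∈ R.S) (Z : VF B) :
    pair (R.br u (R.flat Z)) w = (1 / 2 : ℝ) • R.pull (R.proj u (R.g.toForm Z (R.proj w))
      - R.g.toForm Z ⁅R.proj u, R.proj w⁆) := by
  have h := dorfman_pair R.Hhat u (R.flat Z) w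
  rw [R.pair_flat hw, R.pair_flat (R.br_mem hu hw), R.proj_br hu hw, Derivation.map_smul,
    R.proj_spec u hu] at h
  rw [map_sub]
  linear_combination (norm := algebra) -h

lemma pair_br_flat_left {v w : GT A} (hv : v ∈ R.S) (hw : w ∈ R.S) (Y : VF B) :
    pair (R.br (R.flat Y) v) w = (1 / 2 : ℝ) • R.pull (R.proj w (R.g.toForm Y (R.proj v))
      - R.proj v (R.g.toForm Y (R.proj w)) + R.g.toForm Y ⁅R.proj v, R.proj w⁆) := by
  rw [br, pair_dorfman_swap, R.pair_br_flat_right hv hw, R.pair_flat hv, Derivation.map_smul,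
    R.proj_spec w hw]
  simp only [map_sub, map_add]
  algebra

lemma pair_br_flat {u v : GT A} (hu : u ∈ R.S) (hv : v ∈ R.S) (W : VF B) :
    pair (R.br u v) (R.flat W) = (1 / 2 : ℝ) • R.pull (R.g.toForm W ⁅R.proj u, R.proj v⁆) := by
  rw [pair_symm, R.pair_flat (R.br_mem hu hv), R.proj_br hu hv]

lemma pair_br_lam (X Y Z : VF B) : pair (R.br (R.lam X) (R.lam Y)) (R.lam Z)
    = (1 / 2 : ℝ) • R.pull (R.H ![X, Y, Z]) := by
  rw [R.H_eq, smul_smul]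
  norm_num

/-- Expand `Y^- = λY - g(Y)` and `Z^+ = λZ + g(Z)`. Three factors `λ` give half of `H`; one factor
from `T*` gives the terms of Koszul's formula; two or more give nothing. -/
lemma pair_br_low_lift (Y Z W : VF B) : pair (R.br (R.low Y) (R.lift Z)) (R.lift W)
    = R.pull (R.g.toForm (R.g.nabla Y Z) W + (1 / 2 : ℝ) • R.H ![Y, Z, W]) := by
  rw [R.g.nabla_spec, PseudoMetric.koszul]
  simp only [R.lift_eq, low, br, dorfman_sub_left, dorfman_add_right, pair_sub_left, pair_add_left,
    pair_add_right]
  simp only [← br.eq_def, R.pair_br_lam, R.pair_br_flat_right (R.lam_mem Y) (R.lam_mem W),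
    R.pair_br_flat (R.lam_mem Y) (R.lam_mem Z), R.pair_br_flat (R.lam_mem Y) (R.flat_mem Z),
    R.pair_br_flat_left (R.lam_mem Z) (R.lam_mem W), R.pair_br_flat (R.flat_mem Y) (R.lam_mem Z),
    R.pair_br_flat (R.flat_mem Y) (R.flat_mem Z), R.pair_br_flat_left (R.flat_mem Z) (R.lam_mem W),
    R.proj_lam, R.proj_flat, lie_zero, zero_lie, map_zero, Derivation.zero_apply, sub_zero,
    smul_zero, add_zero, sub_zero]
  rw [R.g.symm W ⁅Y, Z⁆, R.g.symm Z ⁅Y, W⁆, R.g.symm Y ⁅Z, W⁆]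
  simp only [map_add, map_sub, map_smul]
  algebra

/-- The sign of `∇` reflects that the pairing on `V_-` is `-g`. Relative to it the torsion is
opposite to that of the other mixed bracket. -/
lemma pair_br_lift_low (Z Y W : VF B) : pair (R.br (R.lift Z) (R.low Y)) (R.low W)
    = R.pull ((1 / 2 : ℝ) • R.H ![Z, Y, W] - R.g.toForm (R.g.nabla Z Y) W) := by
  rw [R.g.nabla_spec, PseudoMetric.koszul]
  simp only [R.lift_eq, low, br, dorfman_sub_right, dorfman_add_left, pair_sub_left, pair_add_left,
    pair_sub_right]
  simp only [← br.eq_def, R.pair_br_lam, R.pair_br_flat_right (R.lam_mem Z) (R.lam_mem W),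
    R.pair_br_flat (R.lam_mem Z) (R.lam_mem Y), R.pair_br_flat (R.lam_mem Z) (R.flat_mem Y),
    R.pair_br_flat_left (R.lam_mem Y) (R.lam_mem W), R.pair_br_flat (R.flat_mem Z) (R.lam_mem Y),
    R.pair_br_flat (R.flat_mem Z) (R.flat_mem Y), R.pair_br_flat_left (R.flat_mem Y) (R.lam_mem W),
    R.proj_lam, R.proj_flat, lie_zero, zero_lie, map_zero, Derivation.zero_apply, sub_zero,
    smul_zero, add_zero, sub_zero]
  rw [R.g.symm W ⁅Z, Y⁆, R.g.symm Z ⁅Y, W⁆, R.g.symm Y ⁅Z, W⁆]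
  simp only [map_add, map_sub, map_smul]
  algebra

variable {R}

lemma IsAd.pair_br_low_lift {r : GT A} (hr : R.IsAd r) (Y Z : VF B) :
    pair (R.br (R.low Y) (R.lift Z)) r = pair (R.br (R.lam Y) (R.lam Z)) r := by
  simp only [R.lift_eq, low, br, dorfman_sub_left, dorfman_add_right, pair_sub_left, pair_add_left]
  simp only [← br.eq_def, R.pair_br_flat_right (R.lam_mem Y) hr.mem_S,
    R.pair_br_flat_left (R.lam_mem Z) hr.mem_S, R.pair_br_flat_left (R.flat_mem Z) hr.mem_S,
    hr.2, R.proj_flat, lie_zero, map_zero, Derivation.zero_apply, sub_zero, smul_zero, add_zero]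

lemma IsAd.pair_br_low_low {r : GT A} (hr : R.IsAd r) (Y Z : VF B) :
    pair (R.br (R.low Y) (R.low Z)) r = pair (R.br (R.lam Y) (R.lam Z)) r := by
  simp only [low, br, dorfman_sub_left, dorfman_sub_right, pair_sub_left]
  simp only [← br.eq_def, R.pair_br_flat_right (R.lam_mem Y) hr.mem_S,
    R.pair_br_flat_left (R.lam_mem Z) hr.mem_S, R.pair_br_flat_left (R.flat_mem Z) hr.mem_S,
    hr.2, R.proj_flat, lie_zero, map_zero, Derivation.zero_apply, sub_zero, smul_zero, add_zero]

/-- `r` is orthogonal to `V_-`, so invariance of the pairing moves the bracket off `r`, and only the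
`ad`-component of `[λY, λW]`, the curvature, is seen. -/
lemma IsAd.pair_br_ad_low {r : GT A} (hr : R.IsAd r) (Y W : VF B) :
    pair (R.br r (R.low Y)) (R.low W) = pair (R.br (R.lam Y) (R.lam W)) r := by
  have h := dorfman_pair R.Hhat (R.low Y) r (R.low W)
  rw [pair_symm r, R.pair_low_V hr.1, map_zero, pair_symm r, hr.pair_br_low_low] at h
  rw [br, pair_dorfman_swap, pair_symm r, R.pair_low_V hr.1, map_zero]
  linear_combination h

lemma IsAd.pair_br_low_ad {r : GT A} (hr : R.IsAd r) (Y W : VF B) :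
    pair (R.br (R.low Y) r) (R.lift W) = -pair (R.br (R.lam Y) (R.lam W)) r := by
  have h := dorfman_pair R.Hhat (R.low Y) r (R.lift W)
  rw [pair_symm r, hr.pair_lift, map_zero, pair_symm r, hr.pair_br_low_lift] at h
  linear_combination -h

lemma IsAd.pair_br_low_ad_ad {r s : GT A} (hr : R.IsAd r) (hs : R.IsAd s) (Y : VF B) :
    pair (R.br (R.low Y) r) s = pair (R.br (R.lam Y) r) s := by
  rw [low, br, dorfman_sub_left, pair_sub_left, ← br.eq_def R (R.flat Y),
    R.pair_br_flat_left hr.mem_S hs.mem_S, hr.2, hs.2]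
  simp

lemma pair_br_lam_swap (X Y : VF B) (r : GT A) :
    pair (R.br (R.lam Y) (R.lam X)) r = -pair (R.br (R.lam X) (R.lam Y)) r := by
  rw [br, pair_dorfman_swap, R.pair_lam_lam, map_zero, add_zero]

lemma IsAd.pair_br_lam_smul {r : GT A} (hr : R.IsAd r) (f : B) (X Y : VF B) :
    pair (R.br (R.lam X) (R.lam (f • Y))) r = R.pull f * pair (R.br (R.lam X) (R.lam Y)) r := by
  rw [R.lam_smul, br, dorfman_smul_right', pair_add_left, pair_smul_left', pair_smul_left',
    hr.pair_lam, mul_zero, zero_add]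

lemma IsAd.pair_br_lam_smul_left {r : GT A} (hr : R.IsAd r) (f : B) (X Y : VF B) :
    pair (R.br (R.lam (f • X)) (R.lam Y)) r = R.pull f * pair (R.br (R.lam X) (R.lam Y)) r := by
  rw [pair_br_lam_swap, hr.pair_br_lam_smul, pair_br_lam_swap]
  ring

lemma br_lam_add (u : GT A) (X Y : VF B) :
    R.br u (R.lam (X + Y)) = R.br u (R.lam X) + R.br u (R.lam Y) := by
  rw [R.lam_add, br, dorfman_add_right]

lemma lam_add_br (u : GT A) (X Y : VF B) :
    R.br (R.lam (X + Y)) u = R.br (R.lam X) u + R.br (R.lam Y) u := by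
  rw [R.lam_add, br, dorfman_add_left]

lemma IsAd.pair_br_lam_ad_smul {r s : GT A} (hr : R.IsAd r) (hs : R.IsAd s) (f : B) (X : VF B) :
    pair (R.br (R.lam (f • X)) r) s = R.pull f * pair (R.br (R.lam X) r) s := by
  rw [R.lam_smul, br, pair_dorfman_smul_left, hr.apply_pull, hs.apply_pull]
  ring

end Reduction
end Heterotic

namespace Heterotic
namespace Reduction

variable {A B : Type*} [CommRing A] [Algebra ℝ A] [CommRing B] [Algebra ℝ B] (R : Reduction A B)

/-! ### The generalized connection -/

/-- The curvature of the splitting, as a section of `V ∩ Ker π`. -/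
noncomputable def cv (X Y : VF B) : GT A := R.ad (R.br (R.lam X) (R.lam Y))

lemma br_lam_mem (X Y : VF B) : R.br (R.lam X) (R.lam Y) ∈ R.S :=
  R.br_mem (R.lam_mem X) (R.lam_mem Y)

lemma isAd_cv (X Y : VF B) : R.IsAd (R.cv X Y) := R.isAd_ad (R.br_lam_mem X Y)

variable {R} in
lemma IsAd.pair_cv {r : GT A} (hr : R.IsAd r) (X Y : VF B) :
    pair (R.cv X Y) r = pair (R.br (R.lam X) (R.lam Y)) r :=
  R.pair_ad (R.br_lam_mem X Y) hr

variable {R} in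
lemma IsAd.ext {r s : GT A} (hr : R.IsAd r) (hs : R.IsAd s)
    (h : ∀ t, R.IsAd t → pair r t = pair s t) : r = s :=
  R.V_ext' hr.1 hs.1 (fun Z => by rw [pair_symm, hr.pair_lift, pair_symm, hs.pair_lift]) h

variable {R} in
lemma IsAd.neg {r : GT A} (hr : R.IsAd r) : R.IsAd (-r) :=
  ⟨R.V.neg_mem hr.1, by
    have h := R.proj_sub R.S.zero_mem hr.mem_S
    have h0 : R.proj 0 = 0 := R.proj_eq R.S.zero_mem fun f => by simp
    rwa [zero_sub, h0, hr.2, sub_zero] at h⟩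

variable {R} in
lemma IsAd.add {r s : GT A} (hr : R.IsAd r) (hs : R.IsAd s) : R.IsAd (r + s) :=
  ⟨R.V.add_mem hr.1 hs.1, by rw [R.proj_add hr.mem_S hs.mem_S, hr.2, hs.2, add_zero]⟩

variable {R} in
lemma IsAd.sub {r s : GT A} (hr : R.IsAd r) (hs : R.IsAd s) : R.IsAd (r - s) :=
  ⟨R.V.sub_mem hr.1 hs.1, by rw [R.proj_sub hr.mem_S hs.mem_S, hr.2, hs.2, sub_zero]⟩

variable {R} in
lemma IsAd.smul {r : GT A} (hr : R.IsAd r) (f : B) : R.IsAd (R.pull f • r) :=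
  ⟨R.V_smul f _ hr.1, by rw [R.proj_smul hr.mem_S, hr.2, smul_zero]⟩

lemma isAd_zero : R.IsAd 0 := ⟨R.V.zero_mem, R.proj_eq R.S.zero_mem fun f => by simp⟩

lemma isAd_sum {ι : Type*} (s : Finset ι) (r : ι → GT A) (hr : ∀ i, R.IsAd (r i)) :
    R.IsAd (∑ i ∈ s, r i) := by
  classical
  induction s using Finset.induction_on with
  | empty => exact R.isAd_zero
  | insert i s hi ih =>
    rw [Finset.sum_insert hi]
    exact (hr i).add ih

lemma cv_swap (X Y : VF B) : R.cv Y X = -R.cv X Y :=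
  (R.isAd_cv Y X).ext (R.isAd_cv X Y).neg fun t ht => by
    rw [pair_neg_left, ht.pair_cv, ht.pair_cv, pair_br_lam_swap]

/-- The Chern-Simons and Weyl terms of the connection, on sections of `V`. -/
noncomputable def chiV (ϕ : Form1 B) (w v u : GT A) : A :=
  (1 / 2 : ℝ) • R.pull (R.H ![R.proj w, R.proj v, R.proj u])
    + pair (R.br (R.lam (R.proj w)) (R.lam (R.proj v))) (R.adPart u)
    - pair (R.br (R.lam (R.proj w)) (R.lam (R.proj u))) (R.adPart v)
    + pair (R.br (R.lam (R.proj v)) (R.lam (R.proj u))) (R.adPart w)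
    + pair (R.adPart w) (R.br (R.adPart v) (R.adPart u))
    + (R.pull (ϕ (R.proj v)) * pair w u - pair w v * R.pull (ϕ (R.proj u)))

/-- The part `∇^g ⊕ ∇^A` of the connection, on sections of `V`. -/
noncomputable def dV (X : VF B) (v u : GT A) : A :=
  R.pull (R.g.toForm (R.g.nabla X (R.proj v)) (R.proj u))
    + pair (R.br (R.lam X) (R.adPart v)) (R.adPart u)

lemma pair_ad_V {e u : GT A} (he : e ∈ R.S) (hu : u ∈ R.V) :
    pair (R.ad e) u = pair e (R.adPart u) := by
  conv_lhs => rw [R.V_eq u]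
  rw [pair_add_right, pair_symm (R.ad e) (R.lift _), (R.isAd_ad he).pair_lift, zero_add,
    R.pair_ad he (R.isAd_adPart hu)]

lemma pair_lift_proj_plus {e u : GT A} (he : e ∈ R.S) (hu : u ∈ R.V) :
    pair (R.lift (R.proj (R.plus e))) u = pair e (R.lift (R.proj u)) := by
  rw [← R.pair_plus he (R.lift_mem _), pair_symm (R.plus e), R.pair_lift hu,
    R.pair_lift (R.plus_mem e he), R.g.symm]

/-- The generalized connection on sections of `V`, in the directions of `V`. -/
noncomputable def conPlus (ϕ : Form1 B) (w v : GT A) : GT A :=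
  R.lift (R.g.nabla (R.proj w) (R.proj v)) + R.ad (R.br (R.lam (R.proj w)) (R.adPart v))
    + (1 / 3 : ℝ) • (R.lift (algebraMap ℝ B (1 / 2) • R.g.sharp (contr2 R.H (R.proj w) (R.proj v)))
      + R.cv (R.proj w) (R.proj v)
      + R.lift (R.proj (R.plus (R.br (R.low (R.proj w)) (R.adPart v))))
      - R.lift (R.proj (R.plus (R.br (R.low (R.proj v)) (R.adPart w))))
      - R.ad (R.br (R.adPart v) (R.adPart w))
      + (R.pull (ϕ (R.proj v)) • w - pair w v • R.lift (R.g.sharp ϕ)))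

lemma conPlus_mem (ϕ : Form1 B) {w v : GT A} (hw : w ∈ R.V) (hv : v ∈ R.V) :
    R.conPlus ϕ w v ∈ R.V := by
  have hs := (R.isAd_adPart hv).mem_S
  have hr := (R.isAd_adPart hw).mem_S
  obtain ⟨b, hb⟩ := R.pair_mem w (R.V_le hw) v (R.V_le hv)
  rw [conPlus, hb]
  refine R.V.add_mem (R.V.add_mem (R.lift_mem _) (R.isAd_ad (R.br_mem (R.lam_mem _) hs)).1)
    (R.V.smul_mem _ (R.V.add_mem (R.V.sub_mem (R.V.sub_mem (R.V.add_mem (R.V.add_mem (R.lift_mem _)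
      (R.isAd_cv _ _).1) (R.lift_mem _)) (R.lift_mem _)) (R.isAd_ad (R.br_mem hs hr)).1)
      (R.V.sub_mem (R.V_smul _ _ hw) (R.V_smul _ _ (R.lift_mem _)))))

/-- Each term of `conPlus` represents one term of the functional on the right. The order of the
brackets in `conPlus` comes from invariance of the pairing on `ad` (`h1`), where derivatives along
`ad` vanish because pairings of sections are pulled back from the base. -/
lemma pair_conPlus (ϕ : Form1 B) {w v u : GT A} (hw : w ∈ R.V) (hv : v ∈ R.V) (hu : u ∈ R.V) :
    pair (R.conPlus ϕ w v) u = R.dV (R.proj w) v u + (1 / 3 : ℝ) • R.chiV ϕ w v u := by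
  have hs := R.isAd_adPart hv
  have hr := R.isAd_adPart hw
  have ht := R.isAd_adPart hu
  have h1 := dorfman_pair R.Hhat (R.adPart v) (R.adPart w) (R.adPart u)
  rw [hs.apply_pair hr.mem_S ht.mem_S] at h1
  have k1 := R.pair_lift_proj_plus (R.br_mem (R.low_mem (R.proj w)) hs.mem_S) hu
  have k2 := R.pair_lift_proj_plus (R.br_mem (R.low_mem (R.proj v)) hr.mem_S) hu
  rw [R.pair_lift hu, hs.pair_br_low_ad] at k1
  rw [R.pair_lift hu, hr.pair_br_low_ad] at k2
  simp only [conPlus, pair_add_left, pair_sub_left, pair_smul_left, pair_smul_left', cv,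
    R.pair_lift hu, R.pair_ad_V (R.br_mem (R.lam_mem _) hs.mem_S) hu,
    R.pair_ad_V (R.br_lam_mem _ _) hu, R.pair_ad_V (R.br_mem hs.mem_S hr.mem_S) hu,
    k1, k2, dV, chiV, map_smul, LinearMap.smul_apply, PseudoMetric.toForm_sharp,
    contr2_apply, smul_eq_mul, map_mul]
  rw [AlgHom.commutes, ← Algebra.smul_def]
  linear_combination (norm := algebra) (1 / 3 : ℝ) • h1

/-- The generalized connection on sections of `V`. -/
noncomputable def con (ϕ : Form1 B) (e v : GT A) : GT A :=
  R.plus (R.br (R.low (R.lowProj e)) v) + R.conPlus ϕ (R.plus e) v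

lemma con_mem (ϕ : Form1 B) {e v : GT A} (he : e ∈ R.S) (hv : v ∈ R.V) : R.con ϕ e v ∈ R.V :=
  R.V.add_mem (R.plus_mem _ (R.br_mem (R.low_mem _) (R.V_le hv)))
    (R.conPlus_mem ϕ (R.plus_mem e he) hv)

lemma proj_zero : R.proj 0 = 0 := R.isAd_zero.2

lemma low_zero : R.low 0 = 0 := by
  have h := R.low_smul 0 0
  simpa using h

lemma plus_zero : R.plus 0 = 0 := R.plus_of_mem R.V.zero_mem

lemma adPart_zero : R.adPart 0 = 0 := R.adPart_of_isAd R.isAd_zero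

lemma br_zero_left (v : GT A) : R.br 0 v = 0 := by
  have h := dorfman_sub_left R.Hhat 0 0 v
  rwa [sub_self, sub_self] at h

lemma br_zero_right (v : GT A) : R.br v 0 = 0 := by
  have h := dorfman_sub_right R.Hhat v 0 0
  rwa [sub_self, sub_self] at h

lemma lowProj_of_mem {v : GT A} (hv : v ∈ R.V) : R.lowProj v = 0 := by
  rw [lowProj, R.plus_of_mem hv, sub_self, R.proj_zero]

lemma con_of_mem (ϕ : Form1 B) {w v : GT A} (hw : w ∈ R.V) : R.con ϕ w v = R.conPlus ϕ w v := by
  rw [con, R.lowProj_of_mem hw, R.plus_of_mem hw, R.low_zero, R.br_zero_left, R.plus_zero,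
    zero_add]

lemma lowProj_low (Y : VF B) : R.lowProj (R.low Y) = Y := by
  rw [lowProj, R.plus_low, sub_zero, R.proj_low]

lemma dV_zero (v u : GT A) : R.dV 0 v u = 0 := by
  have h : R.g.nabla 0 (R.proj v) = 0 := by
    have h := R.g.nabla_smul_left 0 0 (R.proj v)
    simpa using h
  rw [dV, h, R.lam_zero, R.br_zero_left, pair_zero_left, map_zero, LinearMap.zero_apply, map_zero,
    add_zero]

lemma chiV_zero (ϕ : Form1 B) (v u : GT A) : R.chiV ϕ 0 v u = 0 := by
  simp only [chiV, R.proj_zero, R.lam_zero, R.br_zero_left, pair_zero_left, form3_zero₁, map_zero,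
    R.adPart_zero, pair_zero_right, smul_zero, mul_zero, zero_mul, sub_zero, add_zero]

/-- In the directions of `V_-` neither `ϕ` nor the pure-type contorsion contributes. -/
lemma con_low (ϕ : Form1 B) (Y : VF B) {v : GT A} (hv : v ∈ R.V) :
    R.con ϕ (R.low Y) v = R.plus (R.br (R.low Y) v) := by
  have h : R.conPlus ϕ 0 v = 0 := R.V_ext (R.conPlus_mem ϕ R.V.zero_mem hv) R.V.zero_mem
    fun u hu => by
      rw [R.pair_conPlus ϕ R.V.zero_mem hv hu, R.proj_zero, R.dV_zero, R.chiV_zero, smul_zero,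
        add_zero, pair_zero_left]
  rw [con, R.lowProj_low, R.plus_low, h, add_zero]

lemma dV_add (X X' : VF B) (v u : GT A) : R.dV (X + X') v u = R.dV X v u + R.dV X' v u := by
  simp only [dV, R.g.nabla_add_left, map_add, LinearMap.add_apply, lam_add_br, pair_add_left]
  ring

lemma dV_smul (f : B) (X : VF B) {v u : GT A} (hv : v ∈ R.V) (hu : u ∈ R.V) :
    R.dV (f • X) v u = R.pull f * R.dV X v u := by
  simp only [dV, R.g.nabla_smul_left, map_smul, LinearMap.smul_apply, smul_eq_mul, map_mul,
    (R.isAd_adPart hv).pair_br_lam_ad_smul (R.isAd_adPart hu)]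
  ring

lemma chiV_add (ϕ : Form1 B) {w w' : GT A} (hw : w ∈ R.V) (hw' : w' ∈ R.V) (v u : GT A) :
    R.chiV ϕ (w + w') v u = R.chiV ϕ w v u + R.chiV ϕ w' v u := by
  simp only [chiV, R.proj_add (R.V_le hw) (R.V_le hw'), R.adPart_add (R.V_le hw) (R.V_le hw'),
    form3_add₁, map_add, lam_add_br, pair_add_left, pair_add_right]
  algebra

lemma chiV_smul (ϕ : Form1 B) (f : B) {w v u : GT A} (hw : w ∈ R.V) (hv : v ∈ R.V)
    (hu : u ∈ R.V) : R.chiV ϕ (R.pull f • w) v u = R.pull f * R.chiV ϕ w v u := by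
  simp only [chiV, R.proj_smul (R.V_le hw), R.adPart_smul (R.V_le hw), form3_smul₁, map_mul,
    (R.isAd_adPart hu).pair_br_lam_smul_left, (R.isAd_adPart hv).pair_br_lam_smul_left,
    pair_smul_left', pair_smul_right']
  algebra

lemma conPlus_pair_add (ϕ : Form1 B) {w w' v u : GT A} (hw : w ∈ R.V) (hw' : w' ∈ R.V)
    (hv : v ∈ R.V) (hu : u ∈ R.V) : pair (R.conPlus ϕ (w + w') v) u
      = pair (R.conPlus ϕ w v) u + pair (R.conPlus ϕ w' v) u := by
  rw [R.pair_conPlus ϕ (R.V.add_mem hw hw') hv hu, R.pair_conPlus ϕ hw hv hu,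
    R.pair_conPlus ϕ hw' hv hu, R.proj_add (R.V_le hw) (R.V_le hw'), R.dV_add, R.chiV_add ϕ hw hw']
  algebra

lemma conPlus_pair_smul (ϕ : Form1 B) (f : B) {w v u : GT A} (hw : w ∈ R.V) (hv : v ∈ R.V)
    (hu : u ∈ R.V) : pair (R.conPlus ϕ (R.pull f • w) v) u
      = R.pull f * pair (R.conPlus ϕ w v) u := by
  rw [R.pair_conPlus ϕ (R.V_smul f _ hw) hv hu, R.pair_conPlus ϕ hw hv hu,
    R.proj_smul (R.V_le hw), R.dV_smul f _ hv hu, R.chiV_smul ϕ f hw hv hu]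
  algebra

/-! ### Frames of `V` and the Ricci tensor -/

/-- `s` is a frame of `V` with dual frame `s'` after restriction along `q`. -/
structure VFrame {C : Type*} [CommRing C] [Algebra ℝ C] (q : A →ₐ[ℝ] C) {n : ℕ}
    (s s' : Fin n → GT A) : Prop where
  mem : ∀ i, s i ∈ R.V
  mem' : ∀ i, s' i ∈ R.V
  dual : ∀ i j, q (pair (s i) (s' j)) = if i = j then 1 else 0
  expand : ∀ F : GT A → C, (∀ u ∈ R.V, ∀ v ∈ R.V, F (u + v) = F u + F v) →
    (∀ f, ∀ v ∈ R.V, F (R.pull f • v) = q (R.pull f) * F v) →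
    ∀ v ∈ R.V, F v = ∑ i, q (pair v (s' i)) * F (s i)
  deriv : ∀ (X : VF A) a, q a = 0 → q (X a) = 0

variable {C : Type*} [CommRing C] [Algebra ℝ C] {q : A →ₐ[ℝ] C} {n m : ℕ} {s s' : Fin n → GT A}
  {e e' : Fin m → VF B} {R}

namespace VFrame

variable (hs : R.VFrame q s s')
include hs

lemma expand_pair {v u : GT A} (hv : v ∈ R.V) :
    q (pair v u) = ∑ i, q (pair v (s' i)) * q (pair (s i) u) :=
  hs.expand (fun v => q (pair v u)) (fun v _ w _ => by simp only [pair_add_left, map_add])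
    (fun f v _ => by simp only [pair_smul_left', map_mul]) v hv

lemma expand' (F : GT A → C) (h1 : ∀ u ∈ R.V, ∀ v ∈ R.V, F (u + v) = F u + F v)
    (h2 : ∀ f, ∀ v ∈ R.V, F (R.pull f • v) = q (R.pull f) * F v) {v : GT A} (hv : v ∈ R.V) :
    F v = ∑ i, q (pair v (s i)) * F (s' i) := by
  have a1 : ∀ i, q (pair v (s i)) * F (s' i)
      = ∑ k, q (pair v (s i)) * (q (pair (s' i) (s' k)) * F (s k)) := fun i => by
    rw [hs.expand F h1 h2 _ (hs.mem' i), Finset.mul_sum]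
  have a2 : ∀ k, q (pair v (s' k)) = ∑ i, q (pair v (s i)) * q (pair (s' i) (s' k)) := fun k => by
    rw [pair_symm, hs.expand_pair (hs.mem' k)]
    refine Finset.sum_congr rfl fun i _ => ?_
    rw [pair_symm v, pair_symm (s' k)]
    ring
  rw [hs.expand F h1 h2 v hv, Finset.sum_congr rfl fun i _ => a1 i, Finset.sum_comm]
  refine Finset.sum_congr rfl fun k _ => ?_
  rw [a2, Finset.sum_mul]
  exact Finset.sum_congr rfl fun i _ => by ring

/-- The trace is the contraction of `β` with the symmetric matrix `⟨s'_i, s'_k⟩`, so it equals its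
own negative. -/
lemma trace_skew (β : GT A → GT A → C)
    (h2 : ∀ w ∈ R.V, (∀ u ∈ R.V, ∀ v ∈ R.V, β w (u + v) = β w u + β w v) ∧
      ∀ f, ∀ v ∈ R.V, β w (R.pull f • v) = q (R.pull f) * β w v)
    (h : ∀ u ∈ R.V, ∀ v ∈ R.V, β u v = -β v u) : ∑ i, β (s i) (s' i) = 0 := by
  have a : ∑ i, β (s i) (s' i) = ∑ i, ∑ k, q (pair (s' i) (s' k)) * β (s i) (s k) :=
    Finset.sum_congr rfl fun i _ => hs.expand (β (s i)) (h2 _ (hs.mem i)).1 (h2 _ (hs.mem i)).2 _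
      (hs.mem' i)
  have b : ∑ i, β (s i) (s' i) = -∑ i, β (s i) (s' i) := by
    conv_lhs => rw [a, Finset.sum_comm]
    rw [a, ← Finset.sum_neg_distrib]
    refine Finset.sum_congr rfl fun i _ => ?_
    rw [← Finset.sum_neg_distrib]
    refine Finset.sum_congr rfl fun k _ => ?_
    rw [h _ (hs.mem k) _ (hs.mem i), pair_symm]
    ring
  have c : (2 : ℝ) • ∑ i, β (s i) (s' i) = 0 := by
    linear_combination (norm := algebra) b
  have d := congrArg (fun c : C => (1 / 2 : ℝ) • c) c
  simpa [smul_smul] using d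

lemma deriv_dual (X : VF A) (i j : Fin n) : q (X (pair (s i) (s' j))) = 0 := by
  have h1 : q (pair (s i) (s' j) - if i = j then 1 else 0) = 0 := by
    rw [map_sub, hs.dual]
    split_ifs <;> simp
  have h2 := hs.deriv X _ h1
  rw [map_sub, map_sub] at h2
  have h3 : X (if i = j then (1 : A) else 0) = 0 := by split_ifs <;> simp
  rwa [h3, map_zero, sub_zero] at h2

end VFrame

variable (R) in
/-- The divergence on sections of `V`. -/
noncomputable def dive (n : ℕ) (ϕ : Form1 B) (e e' : Fin m → VF B) (v : GT A) : B :=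
  ∑ j, R.g.toForm (R.g.nabla (e j) (R.proj v)) (e' j) + (((n : ℝ) - 1) / 3) • ϕ (R.proj v)

/-- The divergence is the trace of the generalized connection over `V`. -/
lemma trace_con (hs : R.VFrame q s s') (he : QFrame R.g (q.comp R.pull) e e') (ϕ : Form1 B)
    {v : GT A} (hv : v ∈ R.V) :
    ∑ i, q (pair (R.con ϕ (s i) v) (s' i)) = q (R.pull (R.dive n ϕ e e' v)) := by
  -- `dV` sees the direction `s_i` only through its projection, with coefficients `⟨s_i, lift
  -- e'_j⟩`. Summing over `i` puts `lift e'_j` in the last slot, where the `ad`-part disappears.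
  have t1 : ∑ i, q (R.dV (R.proj (s i)) v (s' i))
      = ∑ j, q (R.pull (R.g.toForm (R.g.nabla (e j) (R.proj v)) (e' j))) := by
    have a : ∀ i, q (R.dV (R.proj (s i)) v (s' i))
        = ∑ j, q (pair (s i) (R.lift (e' j))) * q (R.dV (e j) v (s' i)) := fun i => by
      rw [he.expand (fun X => q (R.dV X v (s' i))) ⟨fun X Y => by simp only [R.dV_add, map_add],
        fun f X => by simp only [R.dV_smul f X hv (hs.mem' i), map_mul, AlgHom.comp_apply]⟩]
      refine Finset.sum_congr rfl fun j _ => ?_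
      rw [pair_symm, R.pair_lift (hs.mem i), R.g.symm, AlgHom.comp_apply]
    rw [Finset.sum_congr rfl fun i _ => a i, Finset.sum_comm]
    refine Finset.sum_congr rfl fun j _ => ?_
    have b := hs.expand' (fun u => q (R.dV (e j) v u)) (fun u hu w hw => by
        simp only [dV, R.proj_add (R.V_le hu) (R.V_le hw), R.adPart_add (R.V_le hu) (R.V_le hw),
          map_add, pair_add_right]
        ring) (fun f u hu => by
        simp only [dV, R.proj_smul (R.V_le hu), R.adPart_smul (R.V_le hu), map_smul, smul_eq_mul,
          pair_smul_right', map_mul, map_add]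
        ring) (R.lift_mem (e' j))
    simp only [dV, R.adPart_lift, pair_zero_right, R.proj_lift, add_zero] at b
    rw [b]
    refine Finset.sum_congr rfl fun i _ => ?_
    rw [pair_symm (s i)]
    rfl
  -- Without the Weyl term the contorsion is a 3-form, in particular skew in its first and last
  -- arguments.
  have t2 : ∑ i, q (R.chiV 0 (s i) v (s' i)) = 0 := by
    refine hs.trace_skew (fun w u => q (R.chiV 0 w v u)) (fun w hw => ⟨fun u hu u' hu' => ?_,
      fun f u hu => ?_⟩) fun w hw u hu => ?_
    · simp only [chiV, R.proj_add (R.V_le hu) (R.V_le hu'), R.adPart_add (R.V_le hu) (R.V_le hu'),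
        form3_add₃, map_add, br_lam_add, pair_add_left, pair_add_right, map_sub, br,
        dorfman_add_right, map_smul, LinearMap.zero_apply, map_zero, zero_mul, mul_zero, add_zero]
      algebra
    · have h1 : pair (R.adPart w) (R.br (R.adPart v) (R.pull f • R.adPart u))
          = R.pull f * pair (R.adPart w) (R.br (R.adPart v) (R.adPart u)) := by
        rw [br, dorfman_smul_right', (R.isAd_adPart hv).apply_pull, zero_smul, zero_add,
          pair_smul_right']
      simp only [chiV, R.proj_smul (R.V_le hu), R.adPart_smul (R.V_le hu), form3_smul₃, h1,
        (R.isAd_adPart hv).pair_br_lam_smul, (R.isAd_adPart hw).pair_br_lam_smul, pair_smul_right',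
        map_sub, map_add, map_smul, map_mul, LinearMap.zero_apply, map_zero, zero_mul, mul_zero,
        smul_zero]
      algebra
    · have h1 := dorfman_pair R.Hhat (R.adPart v) (R.adPart w) (R.adPart u)
      rw [(R.isAd_adPart hv).apply_pair (R.isAd_adPart hw).mem_S (R.isAd_adPart hu).mem_S,
        pair_symm (dorfman _ _ _)] at h1
      rw [← map_neg]
      congr 1
      simp only [chiV, LinearMap.zero_apply, map_zero, zero_mul, mul_zero]
      rw [form3_swap13 R.H (R.proj w), map_neg, pair_br_lam_swap (R.proj w) (R.proj v),
        pair_br_lam_swap (R.proj w) (R.proj u), pair_br_lam_swap (R.proj v) (R.proj u)]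
      linear_combination (norm := algebra) -h1
  -- The factor `n - 1`: the sum of `⟨s_i, s'_i⟩` is the rank `n`, and the second Weyl term
  -- reassembles `v` once.
  have t3 : ∑ i, q (R.pull (ϕ (R.proj v)) * pair (s i) (s' i)
      - pair (s i) v * R.pull (ϕ (R.proj (s' i)))) = ((n : ℝ) - 1) • q (R.pull (ϕ (R.proj v))) := by
    have a := hs.expand' (fun v => q (R.pull (ϕ (R.proj v)))) (fun u hu w hw => by
        simp only [R.proj_add (R.V_le hu) (R.V_le hw), map_add]) (fun f u hu => by
        simp only [R.proj_smul (R.V_le hu), map_smul, smul_eq_mul, map_mul]) hv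
    beta_reduce at a
    simp only [map_sub, map_mul, hs.dual, if_true, mul_one, Finset.sum_sub_distrib,
      Finset.sum_const, Finset.card_univ, Fintype.card_fin, sub_smul, one_smul]
    rw [a]
    congr 1
    · rw [Nat.cast_smul_eq_nsmul]
    · exact Finset.sum_congr rfl fun i _ => by rw [pair_symm]
  have hc : ∀ i, q (pair (R.con ϕ (s i) v) (s' i)) = q (R.dV (R.proj (s i)) v (s' i))
      + (1 / 3 : ℝ) • (q (R.chiV 0 (s i) v (s' i)) + q (R.pull (ϕ (R.proj v)) * pair (s i) (s' i)
      - pair (s i) v * R.pull (ϕ (R.proj (s' i))))) := fun i => by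
    rw [R.con_of_mem ϕ (hs.mem i), R.pair_conPlus ϕ (hs.mem i) hv (hs.mem' i), ← map_add,
      ← map_smul, ← map_add]
    congr 3
    simp only [chiV, LinearMap.zero_apply, map_zero, zero_mul, mul_zero]
    ring
  rw [Finset.sum_congr rfl fun i _ => hc i, Finset.sum_add_distrib, ← Finset.smul_sum,
    Finset.sum_add_distrib, t1, t2, t3, zero_add, dive, map_add, map_add, map_sum, map_sum,
    map_smul, map_smul, smul_smul]
  congr 2
  ring

variable (R) in
/-- The generalized curvature. -/
noncomputable def gCurv (ϕ : Form1 B) (u v w : GT A) : GT A :=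
  R.con ϕ u (R.con ϕ v w) - R.con ϕ v (R.con ϕ u w) - R.con ϕ (courant R.Hhat u v) w

/-- The Ricci tensor in terms of the divergence and the brackets. -/
theorem trace_gCurv (hs : R.VFrame q s s') (he : QFrame R.g (q.comp R.pull) e e') (ϕ : Form1 B)
    (Y : VF B) {v : GT A} (hv : v ∈ R.V) :
    ∑ i, q (pair (R.gCurv ϕ (s i) (R.low Y) v) (s' i))
      = q (R.pull (R.dive n ϕ e e' (R.plus (R.br (R.low Y) v))))
        - q (R.pull (Y (R.dive n ϕ e e' v)))
        + ∑ j, q (pair (R.br (R.plus (R.br (R.low (e j)) v)) (R.low Y)) (R.low (e' j))) := by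
  have hvS := R.V_le hv
  have mS := fun i => R.V_le (hs.mem i)
  have mS' := fun i => R.V_le (hs.mem' i)
  have hD := fun i => R.con_mem ϕ (mS i) hv
  have hlv := R.plus_mem _ (R.br_mem (R.low_mem Y) hvS)
  have t1 := trace_con hs he ϕ hlv
  -- The formula for the trace is differentiated along `Y^-`. On `V` the connection in this
  -- direction is the projected bracket, so invariance of the pairing is its product rule.
  have t2 : ∑ i, q (pair (R.con ϕ (R.low Y) (R.con ϕ (s i) v)) (s' i))
      = q (R.pull (Y (R.dive n ϕ e e' v)))
        - ∑ i, q (pair (R.con ϕ (s i) v) (R.plus (R.br (R.low Y) (s' i)))) := by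
    have a : q ((R.low Y).1 (∑ i, pair (R.con ϕ (s i) v) (s' i) - R.pull (R.dive n ϕ e e' v))) = 0 :=
      hs.deriv _ _ (by rw [map_sub, map_sum, trace_con hs he ϕ hv, sub_self])
    rw [map_sub, map_sub, R.proj_spec _ (R.low_mem Y), R.proj_low, map_sum, map_sum] at a
    rw [← sub_eq_zero, ← a, ← sub_eq_zero]
    have b : ∀ i, q ((R.low Y).1 (pair (R.con ϕ (s i) v) (s' i)))
        = q (pair (R.con ϕ (R.low Y) (R.con ϕ (s i) v)) (s' i))
          + q (pair (R.con ϕ (s i) v) (R.plus (R.br (R.low Y) (s' i)))) := fun i => by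
      rw [dorfman_pair R.Hhat, R.con_low ϕ Y (hD i),
        R.pair_plus (R.br_mem (R.low_mem Y) (R.V_le (hD i))) (hs.mem' i),
        pair_symm _ (R.plus _), R.pair_plus (R.br_mem (R.low_mem Y) (mS' i)) (hD i), map_add,
        pair_symm (R.con ϕ (s i) v) (dorfman _ _ _)]
    rw [Finset.sum_congr rfl fun i _ => b i, Finset.sum_add_distrib]
    ring
  -- Bracketing with `Y^-` moves the frame and its dual frame by opposite transposed matrices, since
  -- `⟨s_k, s'_i⟩` has zero derivative after `q`.
  have t3 : ∑ i, q (pair (R.con ϕ (s i) v) (R.plus (R.br (R.low Y) (s' i))))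
      + ∑ i, q (pair (R.conPlus ϕ (R.plus (R.br (R.low Y) (s i))) v) (s' i)) = 0 := by
    have a : ∀ i, q (pair (R.con ϕ (s i) v) (R.plus (R.br (R.low Y) (s' i))))
        = ∑ k, q (pair (R.plus (R.br (R.low Y) (s' i))) (s k))
          * q (pair (R.con ϕ (s i) v) (s' k)) := fun i =>
      hs.expand' (fun u => q (pair (R.con ϕ (s i) v) u))
        (fun u _ w _ => by simp only [pair_add_right, map_add])
        (fun f u _ => by simp only [pair_smul_right', map_mul])
        (R.plus_mem _ (R.br_mem (R.low_mem Y) (mS' i)))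
    have b : ∀ i, q (pair (R.conPlus ϕ (R.plus (R.br (R.low Y) (s i))) v) (s' i))
        = ∑ k, q (pair (R.plus (R.br (R.low Y) (s i))) (s' k))
          * q (pair (R.con ϕ (s k) v) (s' i)) := fun i => by
      rw [hs.expand (fun w => q (pair (R.conPlus ϕ w v) (s' i)))
        (fun u hu w hw => by simp only [R.conPlus_pair_add ϕ hu hw hv (hs.mem' i), map_add])
        (fun f u hu => by simp only [R.conPlus_pair_smul ϕ f hu hv (hs.mem' i), map_mul])
        _ (R.plus_mem _ (R.br_mem (R.low_mem Y) (mS i)))]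
      simp only [R.con_of_mem ϕ (hs.mem _)]
    rw [Finset.sum_congr rfl fun i _ => a i, Finset.sum_congr rfl fun i _ => b i,
      Finset.sum_comm (f := fun i k => q (pair (R.plus (R.br (R.low Y) (s i))) (s' k))
          * q (pair (R.con ϕ (s k) v) (s' i))), ← Finset.sum_add_distrib]
    refine Finset.sum_eq_zero fun i _ => ?_
    rw [← Finset.sum_add_distrib]
    refine Finset.sum_eq_zero fun k _ => ?_
    have d := hs.deriv_dual (R.low Y).1 k i
    rw [dorfman_pair R.Hhat, map_add, pair_symm (s k)] at d
    rw [R.pair_plus (R.br_mem (R.low_mem Y) (mS' i)) (hs.mem k),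
      R.pair_plus (R.br_mem (R.low_mem Y) (mS k)) (hs.mem' i), ← add_mul, add_comm, d, zero_mul]
  -- `[s_i, Y^-]` splits into its `V_-`-part, expanded in the `e_j^-` with a sign because the
  -- pairing there is `-g`, and its `V`-part, which is minus that of `[Y^-, s_i]`.
  have t4 : ∀ i, q (pair (R.con ϕ (courant R.Hhat (s i) (R.low Y)) v) (s' i))
      = -∑ j, q (pair (R.br (s i) (R.low Y)) (R.low (e' j)))
          * q (pair (R.br (R.low (e j)) v) (s' i))
        - q (pair (R.conPlus ϕ (R.plus (R.br (R.low Y) (s i))) v) (s' i)) := fun i => by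
    have hp : pair (s i) (R.low Y) = 0 := by rw [pair_symm, R.pair_low_V (hs.mem i)]
    have hbS := R.br_mem (mS i) (R.low_mem Y)
    have hbS' := R.br_mem (R.low_mem Y) (mS i)
    have h1 : R.plus (R.br (s i) (R.low Y)) = R.pull (-1) • R.plus (R.br (R.low Y) (s i)) := by
      refine R.V_ext (R.plus_mem _ hbS) (R.V_smul _ _ (R.plus_mem _ hbS')) fun u hu => ?_
      rw [pair_smul_left', R.pair_plus hbS hu, R.pair_plus hbS' hu, br, pair_dorfman_swap, hp,
        map_zero, map_neg, map_one]
      ring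
    have h2 : ∀ j, R.pull (R.g.toForm (R.lowProj (R.br (s i) (R.low Y))) (e' j))
        = -pair (R.br (s i) (R.low Y)) (R.low (e' j)) := fun j => by
      have a := R.pair_low_low (R.lowProj (R.br (s i) (R.low Y))) (e' j)
      rw [← R.sub_plus hbS, pair_sub_left, pair_symm (R.plus _), R.pair_low_V (R.plus_mem _ hbS),
        sub_zero] at a
      rw [a, neg_neg]
    rw [courant_eq_dorfman R.Hhat hp, con, pair_add_left,
      R.pair_plus (R.br_mem (R.low_mem _) hvS) (hs.mem' i), ← br.eq_def, h1,
      R.conPlus_pair_smul ϕ _ (R.plus_mem _ hbS') hv (hs.mem' i), map_add, map_neg, map_one,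
      he.expand (fun X => q (pair (R.br (R.low X) v) (s' i))) ⟨fun X X' => by
        simp only [R.low_add, br, dorfman_add_left, pair_add_left, map_add], fun f X => by
        simp only [R.low_smul, br, pair_dorfman_smul_left, R.pair_low_V hv,
          R.pair_low_V (hs.mem' i), mul_zero, sub_zero, add_zero, map_mul, AlgHom.comp_apply]⟩]
    simp only [AlgHom.comp_apply, h2, map_neg, neg_mul, Finset.sum_neg_distrib, one_mul]
    ring
  -- The sum over the frame of `V` reassembles `[e_j^-, v]^+`, so no trace of `s` and `s'` remains
  -- in the result.
  have t5 : ∑ i, ∑ j, q (pair (R.br (s i) (R.low Y)) (R.low (e' j)))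
          * q (pair (R.br (R.low (e j)) v) (s' i))
      = ∑ j, q (pair (R.br (R.plus (R.br (R.low (e j)) v)) (R.low Y)) (R.low (e' j))) := by
    rw [Finset.sum_comm]
    refine Finset.sum_congr rfl fun j _ => ?_
    have hbS := R.br_mem (R.low_mem (e j)) hvS
    rw [hs.expand (fun w => q (pair (R.br w (R.low Y)) (R.low (e' j))))
      (fun u _ w _ => by simp only [br, dorfman_add_left, pair_add_left, map_add])
      (fun f u hu => by
        simp only [br, pair_dorfman_smul_left, pair_symm u, R.pair_low_V hu, mul_zero, sub_zero,
          add_zero, map_mul]) _ (R.plus_mem _ hbS)]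
    refine Finset.sum_congr rfl fun i _ => ?_
    rw [R.pair_plus hbS (hs.mem' i)]
    ring
  simp only [gCurv, pair_sub_left, map_sub, Finset.sum_sub_distrib, t4, Finset.sum_neg_distrib, t5,
    t2, R.con_low ϕ Y hv, t1]
  linear_combination t3

end Reduction
end Heterotic

namespace Heterotic
namespace Reduction

variable {A B : Type*} [CommRing A] [Algebra ℝ A] [CommRing B] [Algebra ℝ B] {R : Reduction A B}

/-! ### The components of the Ricci tensor -/

/-- The horizontal part is the connection with torsion `H`, and the `ad`-part is the curvature of
the splitting. -/
lemma lift_plus_br_low_lift (X Z : VF B) : R.plus (R.br (R.low X) (R.lift Z))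
    = R.lift (R.g.nabla X Z + (1 / 2 : ℝ) • R.g.sharp (contr2 R.H X Z)) + R.cv X Z := by
  have hS := R.br_mem (R.low_mem X) (R.lift_mem_S Z)
  refine R.V_ext' (R.plus_mem _ hS) (R.V.add_mem (R.lift_mem _) (R.isAd_cv X Z).1) (fun W => ?_)
    fun r hr => ?_
  · have h : R.g.toForm (R.g.nabla X Z + (1 / 2 : ℝ) • R.g.sharp (contr2 R.H X Z)) W
        = R.g.toForm (R.g.nabla X Z) W + (1 / 2 : ℝ) • R.H ![X, Z, W] := by
      rw [← algebraMap_smul B (1 / 2 : ℝ) (R.g.sharp _), map_add, map_smul, LinearMap.add_apply,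
        LinearMap.smul_apply, R.g.toForm_sharp, algebraMap_smul, contr2_apply]
    rw [R.pair_plus hS (R.lift_mem W), R.pair_br_low_lift, pair_add_left, R.g_eq, h,
      pair_symm (R.cv X Z), (R.isAd_cv X Z).pair_lift, add_zero]
  · rw [R.pair_plus hS hr.1, hr.pair_br_low_lift, pair_add_left, hr.pair_lift, zero_add,
      hr.pair_cv]

variable (R) in
/-- The vector field `g⁻¹ c(F(X,·), r)`. -/
noncomputable def gyr (r : GT A) (X : VF B) : VF B := R.proj (R.plus (R.br (R.low X) r))

lemma IsAd.pull_gyr {r : GT A} (hr : R.IsAd r) (X W : VF B) :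
    R.pull (R.g.toForm (R.gyr r X) W) = -pair (R.br (R.lam X) (R.lam W)) r := by
  have hS := R.br_mem (R.low_mem X) hr.mem_S
  rw [gyr, R.g.symm, ← R.pair_lift (R.plus_mem _ hS), pair_symm, R.pair_plus hS (R.lift_mem W),
    hr.pair_br_low_ad]

lemma IsAd.plus_br_low {r : GT A} (hr : R.IsAd r) (X : VF B) :
    R.plus (R.br (R.low X) r) = R.lift (R.gyr r X) + R.ad (R.br (R.lam X) r) := by
  have hS := R.br_mem (R.low_mem X) hr.mem_S
  have hS' := R.br_mem (R.lam_mem X) hr.mem_S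
  refine R.V_ext' (R.plus_mem _ hS) (R.V.add_mem (R.lift_mem _) (R.isAd_ad hS').1) (fun W => ?_)
    fun s hs => ?_
  · rw [R.pair_plus hS (R.lift_mem W), hr.pair_br_low_ad, pair_add_left, R.g_eq, hr.pull_gyr,
      pair_symm (R.ad _), (R.isAd_ad hS').pair_lift, add_zero]
  · rw [R.pair_plus hS hs.1, hr.pair_br_low_ad_ad hs, pair_add_left, hs.pair_lift, zero_add,
      R.pair_ad hS' hs]

lemma proj_lift_add_isAd (X : VF B) {r : GT A} (hr : R.IsAd r) : R.proj (R.lift X + r) = X := by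
  rw [R.proj_add (R.lift_mem_S X) hr.mem_S, R.proj_lift, hr.2, add_zero]

lemma pull_gyr_add {r : GT A} (hr : R.IsAd r) (X Y : VF B) :
    R.gyr r (X + Y) = R.gyr r X + R.gyr r Y := by
  refine R.g.ext_iff' fun W => R.pull_injective ?_
  rw [map_add, LinearMap.add_apply, map_add, hr.pull_gyr, hr.pull_gyr, hr.pull_gyr, lam_add_br,
    pair_add_left]
  ring

lemma pull_gyr_smul {r : GT A} (hr : R.IsAd r) (f : B) (X : VF B) :
    R.gyr r (f • X) = f • R.gyr r X := by
  refine R.g.ext_iff' fun W => R.pull_injective ?_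
  rw [map_smul, LinearMap.smul_apply, smul_eq_mul, map_mul, hr.pull_gyr, hr.pull_gyr,
    hr.pair_br_lam_smul_left]
  ring

variable {C : Type*} [CommRing C] [Algebra ℝ C] {q : A →ₐ[ℝ] C} {n m : ℕ} {s s' : Fin n → GT A}
  {e e' : Fin m → VF B}

lemma pair_br_add_low (X Y W : VF B) {r : GT A} (hr : R.IsAd r) :
    pair (R.br (R.lift X + r) (R.low Y)) (R.low W)
      = R.pull ((1 / 2 : ℝ) • R.H ![X, Y, W] - R.g.toForm (R.g.nabla X Y) W)
        + pair (R.br (R.lam Y) (R.lam W)) r := by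
  rw [br, dorfman_add_left, pair_add_left, ← br.eq_def R (R.lift X), R.pair_br_lift_low,
    ← br.eq_def R r, hr.pair_br_ad_low]

/-- The Ricci tensor on `V_- ⊗ T`. -/
theorem trace_gCurv_lift (hs : R.VFrame q s s') (he : QFrame R.g (q.comp R.pull) e e')
    {ϕ : Form1 B} {φ : B} (hϕ : (((n : ℝ) - 1) / 3) • ϕ = (-2 : ℝ) • dFn φ) (Y Z : VF B) :
    ∑ i, q (pair (R.gCurv ϕ (s i) (R.low Y) (R.lift Z)) (s' i))
      = q (R.pull (∑ j, R.g.toForm (curv R.g.nabla (e j) Y Z) (e' j)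
          + (2 : ℝ) • (Y (Z φ) - R.g.nabla Y Z φ)
          - (1 / 4 : ℝ) • ∑ j, ∑ k, R.H ![e j, Y, e k] * R.H ![e' j, Z, e' k]))
        - ∑ j, q (pair (R.cv Y (e j)) (R.cv Z (e' j)))
        + q (R.pull ((1 / 2 : ℝ) • ∑ j, R.g.nabla3 R.H (e j) (e' j) Y Z
          - R.g.sharp (contr2 R.H Y Z) φ)) := by
  have hϕ' : ∀ X : VF B, (((n : ℝ) - 1) / 3) • ϕ X = (-2 : ℝ) • X φ := fun X =>
    congrArg (fun η : Form1 B => η X) hϕ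
  have t := he.ric_torsion R.H Y Z
  -- One interchange of the dual frames and one sign from the skew symmetry of `cv` produce the
  -- trace of `F ∘ F`.
  have c1 : ∑ j, q (pair (R.br (R.lam Y) (R.lam (e' j))) (R.cv (e j) Z))
      = -∑ j, q (pair (R.cv Y (e j)) (R.cv Z (e' j))) := by
    have a := he.trace_swap (fun U W => q (pair (R.br (R.lam Y) (R.lam U)) (R.cv Z W)))
      (fun W => ⟨fun X X' => by simp only [br_lam_add, pair_add_left, map_add], fun f X => by
        simp only [(R.isAd_cv Z W).pair_br_lam_smul, map_mul, AlgHom.comp_apply]⟩)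
      (fun U => ⟨fun X X' => by
          simp only [← (R.isAd_cv _ _).pair_cv Y, pair_symm (R.cv Y U),
            (R.isAd_cv Y U).pair_cv, br_lam_add, pair_add_left, map_add], fun f X => by
          simp only [← (R.isAd_cv _ _).pair_cv Y, pair_symm (R.cv Y U),
            (R.isAd_cv Y U).pair_cv, (R.isAd_cv Y U).pair_br_lam_smul, map_mul,
            AlgHom.comp_apply]⟩)
    simp only [← (R.isAd_cv _ _).pair_cv Y] at a ⊢
    rw [← a, ← Finset.sum_neg_distrib]
    refine Finset.sum_congr rfl fun j _ => ?_
    rw [R.cv_swap Z (e j), pair_neg_right, map_neg]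
  -- The dilaton part of the divergence, evaluated on `∇_Y Z` and on the torsion term: the first
  -- completes the Hessian of `φ`, the second gives the derivative of `φ` along `g⁻¹H(Y, Z, ·)`.
  have f1 := congrArg (fun b => q (R.pull b)) (hϕ' (R.g.nabla Y Z))
  have f2 := congrArg (fun b => q (R.pull b)) (hϕ' ((1 / 2 : ℝ) • R.g.sharp (contr2 R.H Y Z)))
  simp only [map_smul, Derivation.smul_apply] at f1 f2
  rw [trace_gCurv hs he ϕ Y (R.lift_mem Z)]
  simp only [lift_plus_br_low_lift, dive, proj_lift_add_isAd _ (R.isAd_cv _ _), R.proj_lift, hϕ',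
    pair_br_add_low _ _ _ (R.isAd_cv _ _), map_add, Finset.sum_add_distrib, c1, map_sub,
    Derivation.map_smul, map_smul, AlgHom.comp_apply] at t ⊢
  linear_combination (norm := algebra) t + f1 + f2

variable (R) in
/-- The section of `V ∩ Ker π` whose vanishing is the field equation of the curvature. -/
noncomputable def fieldEq (e e' : Fin m → VF B) (w : B) (Y : VF B) : GT A :=
  ∑ j, (R.ad (R.br (R.lam (e j)) (R.pull w • R.cv (e' j) Y))
      - R.pull w • R.cv (R.g.nabla (e j) (e' j)) Y - R.pull w • R.cv (e' j) (R.g.nabla (e j) Y))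
    + R.pull ((1 / 2 : ℝ) • w) • ∑ j, ∑ k, R.pull (R.H ![e' j, Y, e k]) • R.cv (e j) (e' k)

lemma isAd_fieldEq (e e' : Fin m → VF B) (w : B) (Y : VF B) : R.IsAd (R.fieldEq e e' w Y) :=
  (R.isAd_sum _ _ fun _ => ((R.isAd_ad (R.br_mem (R.lam_mem _)
    ((R.isAd_cv _ _).smul w).mem_S)).sub ((R.isAd_cv _ _).smul w)).sub ((R.isAd_cv _ _).smul w)).add
  ((R.isAd_sum _ _ fun _ => R.isAd_sum _ _ fun _ => (R.isAd_cv _ _).smul _).smul _)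

/-- The Ricci tensor on `V_- ⊗ ad`. -/
theorem trace_gCurv_ad (hs : R.VFrame q s s') (he : QFrame R.g (q.comp R.pull) e e')
    {ϕ : Form1 B} {φ w : B} (hϕ : (((n : ℝ) - 1) / 3) • ϕ = (-2 : ℝ) • dFn φ)
    (hw : ∀ X : VF B, X w = (-2 : ℝ) • (w * X φ)) (Y : VF B) {r : GT A} (hr : R.IsAd r) :
    q (R.pull w) * ∑ i, q (pair (R.gCurv ϕ (s i) (R.low Y) r) (s' i))
      = q (pair (R.fieldEq e e' w Y) r) := by
  have hϕ' : ∀ X : VF B, (((n : ℝ) - 1) / 3) • ϕ X = (-2 : ℝ) • X φ := fun X =>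
    congrArg (fun η : Form1 B => η X) hϕ
  have lin1 : ∀ W, QLin (q.comp R.pull) fun X => q (pair (R.br (R.lam X) (R.lam W)) r) := fun W =>
    ⟨fun X X' => by simp only [lam_add_br, pair_add_left, map_add], fun f X => by
      simp only [hr.pair_br_lam_smul_left, map_mul, AlgHom.comp_apply]⟩
  have hadS := fun X => R.br_mem (R.lam_mem X) hr.mem_S
  have hg : ∀ X, R.g.nabla X 0 = 0 := fun X => by
    have h := R.g.nabla_smul_right 0 X 0
    simpa using h
  -- The divergence of `g⁻¹c(F(Y,·), r)` by the product rule. The terms in which `r` is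
  -- differentiated are exactly cancelled by the last sum of `trace_gCurv`, so the result is
  -- tensorial in `r`.
  have t1 : q (R.pull (∑ j, R.g.toForm (R.g.nabla (e j) (R.gyr r Y)) (e' j)))
      + ∑ j, q (pair (R.br (R.lam Y) (R.lam (e' j))) (R.ad (R.br (R.lam (e j)) r)))
      = ∑ j, q (pair (R.br (R.lam Y) (R.lam (R.g.nabla (e j) (e' j)))) r
        - pair (R.br (R.lam (e j)) (R.cv Y (e' j))) r) := by
    rw [map_sum, map_sum, ← Finset.sum_add_distrib]
    refine Finset.sum_congr rfl fun j _ => ?_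
    rw [← map_add]
    congr 1
    have a := congrArg R.pull (R.g.nabla_metric (e j) (R.gyr r Y) (e' j))
    have a' := R.proj_spec (R.lam (e j)) (R.lam_mem _) (R.g.toForm (R.gyr r Y) (e' j))
    rw [R.proj_lam] at a'
    rw [map_add, ← a', hr.pull_gyr, hr.pull_gyr, map_neg] at a
    have b := dorfman_pair R.Hhat (R.lam (e j)) (R.cv Y (e' j)) r
    rw [hr.pair_cv, R.pair_isAd_eq (hadS (e j)) (R.isAd_cv _ _),
      (R.isAd_ad (hadS (e j))).pair_cv] at b
    linear_combination -a - b
  have t2 : ∑ j, q (R.pull (R.H ![R.gyr r (e j), Y, e' j]))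
      = ∑ j, ∑ k, q (R.pull (R.H ![e' j, Y, e k])) * q (pair (R.cv (e j) (e' k)) r) := by
    refine Finset.sum_congr rfl fun j _ => ?_
    rw [he.expand (fun X => q (R.pull (R.H ![X, Y, e' j]))) ⟨fun X X' => by
      simp only [form3_add₁, map_add], fun f X => by
      simp only [form3_smul₁, map_mul, AlgHom.comp_apply]⟩]
    refine Finset.sum_congr rfl fun k _ => ?_
    rw [AlgHom.comp_apply, hr.pull_gyr, hr.pair_cv, form3_swap13 R.H (e' j), map_neg, map_neg,
      map_neg]
    ring
  have t3 : ∑ j, q (R.pull (R.g.toForm (R.g.nabla (R.gyr r (e j)) Y) (e' j)))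
      = -∑ j, q (pair (R.br (R.lam (R.g.nabla (e j) Y)) (R.lam (e' j))) r) := by
    have a := he.trace_comp (fun X => R.g.nabla X Y) (R.gyr r)
      (fun X X' => R.g.nabla_add_left X X' Y) (fun f X => R.g.nabla_smul_left f X Y)
      (pull_gyr_add hr) (pull_gyr_smul hr)
    simp only [AlgHom.comp_apply, hr.pull_gyr, map_neg, Finset.sum_neg_distrib] at a
    exact a
  have t4 : q (R.pull (R.gyr r Y φ))
      = -∑ j, q (pair (R.br (R.lam Y) (R.lam (e' j))) r) * q (R.pull (e j φ)) := by
    rw [he.expand (fun X => q (R.pull (X φ))) ⟨fun X X' => by simp, fun f X => by simp⟩,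
      ← Finset.sum_neg_distrib]
    refine Finset.sum_congr rfl fun j _ => ?_
    rw [AlgHom.comp_apply, hr.pull_gyr, map_neg]
    ring
  -- Differentiating the weight `w`, with `dw = -2w dφ`, produces the dilaton term of the field
  -- equation.
  have t5 : ∀ j, pair (R.ad (R.br (R.lam (e j)) (R.pull w • R.cv (e' j) Y))) r
      = (2 : ℝ) • (R.pull w * R.pull (e j φ) * pair (R.br (R.lam Y) (R.lam (e' j))) r)
        - R.pull w * pair (R.br (R.lam (e j)) (R.cv Y (e' j))) r := fun j => by
    rw [R.pair_ad (R.br_mem (R.lam_mem _) ((R.isAd_cv _ _).smul w).mem_S) hr, br,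
      dorfman_smul_right', R.proj_spec _ (R.lam_mem _), R.proj_lam, hw, pair_add_left,
      pair_smul_left', pair_smul_left', hr.pair_cv, pair_br_lam_swap Y (e' j), R.cv_swap Y (e' j),
      dorfman_neg_right, pair_neg_left, map_smul, map_mul]
    algebra
  rw [trace_gCurv hs he ϕ Y hr.1]
  simp only [hr.plus_br_low, dive, proj_lift_add_isAd _ (R.isAd_ad (hadS _)), hr.2, hϕ', hg,
    pair_br_add_low _ _ _ (R.isAd_ad (hadS _)), map_zero, LinearMap.zero_apply,
    Finset.sum_const_zero, smul_zero, add_zero, sub_zero]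
  simp only [fieldEq, pair_add_left, pair_sum_left, pair_sub_left, pair_smul_left', t5, hr.pair_cv,
    map_add, map_sub, map_mul, map_smul, Finset.sum_add_distrib, Finset.sum_sub_distrib, t3, t4,
    ← Finset.smul_sum, t2, map_sum] at t1 ⊢
  have c1 : ∀ j, q (pair (R.br (R.lam (R.g.nabla (e j) (e' j))) (R.lam Y)) r)
      = -q (pair (R.br (R.lam Y) (R.lam (R.g.nabla (e j) (e' j)))) r) := fun j => by
    rw [pair_br_lam_swap, map_neg]
  have c2 : ∀ j, q (pair (R.br (R.lam (e' j)) (R.lam (R.g.nabla (e j) Y))) r)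
      = -q (pair (R.br (R.lam (R.g.nabla (e j) Y)) (R.lam (e' j))) r) := fun j => by
    rw [pair_br_lam_swap, map_neg]
  have c3 : ∑ j, q (R.pull w) * q (R.pull (e j φ)) * q (pair (R.br (R.lam Y) (R.lam (e' j))) r)
      = q (R.pull w) * ∑ j, q (pair (R.br (R.lam Y) (R.lam (e' j))) r) * q (R.pull (e j φ)) := by
    rw [Finset.mul_sum]
    exact Finset.sum_congr rfl fun j _ => by ring
  simp only [c1, c2, c3, mul_neg, Finset.sum_neg_distrib, ← Finset.mul_sum]
  linear_combination (norm := algebra) q (R.pull w) * t1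

/-! ### The Bianchi identity -/

/-- Decompose `[λZ, λW]` in `T ⊕ ad ⊕ T*`. Its `ad`-component pairs with the curvature, its
`T`-component `λ[Z, W]` gives the first `H`, and its `T*`-component, found by pairing with `λ[X,
Y]`, the second. -/
lemma pair_br_lam_br_lam (X Y Z W : VF B) :
    pair (R.br (R.lam X) (R.lam Y)) (R.br (R.lam Z) (R.lam W)) = pair (R.cv X Y) (R.cv Z W)
      + (1 / 2 : ℝ) • R.pull (R.H ![X, Y, ⁅Z, W⁆]) + (1 / 2 : ℝ) • R.pull (R.H ![Z, W, ⁅X, Y⁆]) := by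
  have h := R.ad_eq (R.br_lam_mem Z W)
  rw [R.proj_br (R.lam_mem Z) (R.lam_mem W), R.proj_lam, R.proj_lam, ← cv] at h
  generalize R.proj (R.plus (R.br (R.lam Z) (R.lam W))) - R.lowProj (R.br (R.lam Z) (R.lam W)) = U
    at h
  have h1 := congrArg (fun u => pair u (R.lam ⁅X, Y⁆)) h
  simp only [pair_add_left, R.pair_br_lam, R.pair_lam_lam, R.pair_flat (R.lam_mem _), R.proj_lam,
    pair_symm (R.cv Z W), (R.isAd_cv Z W).pair_lam, zero_add, add_zero] at h1
  rw [h, pair_add_right, pair_add_right, R.pair_br_lam, (R.isAd_cv Z W).pair_cv,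
    R.pair_br_flat (R.lam_mem X) (R.lam_mem Y), R.proj_lam, R.proj_lam, h1]
  ring

/-- This is the Jacobi identity of `λX, λY, λZ` paired with `λW`. The four-form on the right appears
because brackets of horizontal lifts have `ad`-components. -/
theorem pull_d3 (X Y Z W : VF B) : R.pull (d3 R.H X Y Z W) = (2 : ℝ) • (pair (R.cv X Y) (R.cv Z W)
    - pair (R.cv X Z) (R.cv Y W) + pair (R.cv X W) (R.cv Y Z)) := by
  have hj := congrArg (fun u => pair u (R.lam W))
    (dorfman_jacobi R.Hhat R.closed (R.lam X) (R.lam Y) (R.lam Z))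
  have l : ∀ U V, dorfman R.Hhat (R.lam U) (R.lam V) = R.br (R.lam U) (R.lam V) := fun _ _ => rfl
  have d : ∀ U (b : B), (R.lam U).1 (R.pull b) = R.pull (U b) := fun U b => by
    rw [R.proj_spec _ (R.lam_mem U), R.proj_lam]
  have k : ∀ X u Z, pair (dorfman R.Hhat (R.lam X) u) (R.lam Z) = (R.lam X).1 (pair u (R.lam Z))
      - pair u (dorfman R.Hhat (R.lam X) (R.lam Z)) := fun X u Z => by
    rw [dorfman_pair R.Hhat]
    ring
  simp only [pair_add_left] at hj
  rw [k X (dorfman R.Hhat (R.lam Y) (R.lam Z)), k Y (dorfman R.Hhat (R.lam X) (R.lam Z)),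
    pair_dorfman_swap R.Hhat (dorfman _ _ _), k Z (dorfman R.Hhat (R.lam X) (R.lam Y))] at hj
  simp only [l, R.pair_br_lam, pair_br_lam_br_lam, Derivation.map_smul, d] at hj
  have e1 : pair (R.cv Y Z) (R.cv X W) = pair (R.cv X W) (R.cv Y Z) := pair_symm _ _
  rw [e1] at hj
  simp only [d3, map_add, map_sub]
  rw [← form3_rotate R.H ⁅X, Y⁆ Z W, ← form3_rotate R.H ⁅X, Z⁆ Y W, ← form3_rotate R.H ⁅X, W⁆ Y Z,
    ← form3_rotate R.H ⁅Y, Z⁆ X W, ← form3_rotate R.H ⁅Y, W⁆ X Z, ← form3_rotate R.H ⁅Z, W⁆ X Y]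
  linear_combination (norm := algebra) (2 : ℝ) • hj

/-! ### The connection in terms of the splitting -/

variable (R) in
/-- The pairing of the `ad`-components of two sections in the splitting `T ⊕ ad ⊕ T*`. -/
noncomputable def adPair (e f : GT A) : A :=
  pair e f - pair e (R.lam (R.proj f)) - pair (R.lam (R.proj e)) f

lemma adPair_symm (e f : GT A) : R.adPair e f = R.adPair f e := by
  rw [adPair, adPair, pair_symm e f, pair_symm e (R.lam _), pair_symm (R.lam _) f]
  ring

lemma adPair_add_right (e : GT A) {f f' : GT A} (hf : f ∈ R.S) (hf' : f' ∈ R.S) :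
    R.adPair e (f + f') = R.adPair e f + R.adPair e f' := by
  simp only [adPair, R.proj_add hf hf', R.lam_add, pair_add_right]
  ring

lemma adPair_V {e v : GT A} (he : e ∈ R.S) (hv : v ∈ R.V) :
    R.adPair e v = pair e (R.adPart v) := by
  have h := R.pair_flat he (R.proj v)
  rw [adPair, R.pair_lam_V hv, R.g.symm, ← h, adPart, R.lift_eq, pair_sub_right, pair_add_right,
    pair_symm (R.flat _)]
  ring

lemma adPair_low {e : GT A} (he : e ∈ R.S) (Y : VF B) : R.adPair e (R.low Y) = 0 := by
  have h := R.pair_flat he Y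
  have h' := R.pair_flat (R.lam_mem (R.proj e)) Y
  rw [R.proj_lam, ← h] at h'
  rw [adPair, R.proj_low, low, pair_sub_right, pair_sub_right, R.pair_lam_lam,
    pair_symm (R.lam (R.proj e)), h', pair_symm e (R.flat Y)]
  ring

variable (R) in
/-- The connection `∇^g ⊕ ∇^A ⊕ ∇^{g*}`. -/
noncomputable def dSplit (X : VF B) (v u : GT A) : A :=
  pair (R.lam (R.g.nabla X (R.proj v))) u + R.adPair (R.br (R.lam X) (v - R.lam (R.proj v))) u
    + ((R.lam X).1 (pair v (R.lam (R.proj u))) - pair v (R.lam (R.g.nabla X (R.proj u))))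

variable (R) in
/-- The Chern-Simons form. -/
noncomputable def csSplit (w v u : GT A) : A :=
  -R.adPair (R.br (R.lam (R.proj w)) (R.lam (R.proj v))) u
    + R.adPair (R.br (R.lam (R.proj w)) (R.lam (R.proj u))) v
    - R.adPair (R.br (R.lam (R.proj v)) (R.lam (R.proj u))) w
    - R.adPair w (R.br (v - R.lam (R.proj v)) (u - R.lam (R.proj u)))

variable (R) in
/-- The contorsion. -/
noncomputable def chiSplit (ϕ : Form1 B) (w v u : GT A) : A :=
  (1 / 2 : ℝ) • R.pull (R.H ![R.proj w, R.proj v, R.proj u]) - R.csSplit w v u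
    + (R.pull (ϕ (R.proj v)) * pair w u - pair w v * R.pull (ϕ (R.proj u)))

lemma sub_lam_V (v : GT A) : v - R.lam (R.proj v) = R.adPart v + R.flat (R.proj v) := by
  rw [adPart, R.lift_eq]
  abel

/-- The `T`- and `T*`-components of `v` contribute half of `∇^g` each. Their sum doubles on the
`V`-part of `u` and cancels on its `V_-`-part, so `D'` preserves `V`. -/
lemma dSplit_V (X : VF B) {v u : GT A} (hv : v ∈ R.V) (hu : u ∈ R.S) :
    R.dSplit X v u = R.dV X v (R.plus u) := by
  have hs := R.isAd_adPart hv
  have hp := R.plus_mem u hu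
  have ht := R.isAd_adPart hp
  have hbS := R.br_mem (R.lam_mem X) (R.S.add_mem hs.mem_S (R.flat_mem (R.proj v)))
  have key : R.adPair (R.br (R.lam X) (v - R.lam (R.proj v))) u
      = pair (R.br (R.lam X) (R.adPart v)) (R.adPart (R.plus u)) := by
    rw [sub_lam_V]
    conv_lhs => rw [R.S_eq hu]
    rw [adPair_add_right _ (R.V_le hp) (R.low_mem _), adPair_low hbS, adPair_V hbS hp, br,
      dorfman_add_right, pair_add_left, ← br.eq_def R _ (R.flat _),
      R.pair_br_flat_right (R.lam_mem X) ht.mem_S, ht.2]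
    simp
  have hpr : R.proj u = R.proj (R.plus u) + R.lowProj u := by
    conv_lhs => rw [R.S_eq hu]
    rw [R.proj_add (R.V_le hp) (R.low_mem _), R.proj_low]
  have hlam : ∀ W, pair (R.lam W) u = (1 / 2 : ℝ) • R.pull (R.g.toForm W (R.proj (R.plus u)))
      - (1 / 2 : ℝ) • R.pull (R.g.toForm W (R.lowProj u)) := fun W => by
    conv_lhs => rw [R.S_eq hu]
    rw [pair_add_right, R.pair_lam_V hp, low, pair_sub_right, R.pair_lam_lam, zero_sub,
      pair_symm (R.lam W), R.pair_flat (R.lam_mem W), R.proj_lam, R.g.symm (R.lowProj u), sub_eq_add_neg]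
  have hm := congrArg R.pull (R.g.nabla_metric X (R.proj v) (R.proj u))
  rw [dSplit, key, dV, hlam, pair_symm v, pair_symm v, R.pair_lam_V hv, R.pair_lam_V hv,
    Derivation.map_smul, R.proj_spec _ (R.lam_mem X), R.proj_lam, R.g.symm (R.proj u), hm,
    R.g.symm (R.g.nabla X (R.proj u)), map_add]
  rw [hpr, map_add, map_add]
  algebra

lemma pair_isAd_br_flat {r s : GT A} (hr : R.IsAd r) (hs : R.IsAd s) (Z : VF B) :
    pair r (R.br s (R.flat Z)) = 0 := by
  rw [pair_symm, R.pair_br_flat_right hs.mem_S hr.mem_S, hr.2, hs.2]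
  simp

lemma pair_isAd_br_flat_left {r u : GT A} (hr : R.IsAd r) (hu : u ∈ R.S) (hu0 : R.proj u = 0)
    (Z : VF B) : pair r (R.br (R.flat Z) u) = 0 := by
  rw [pair_symm, R.pair_br_flat_left hu hr.mem_S, hr.2, hu0]
  simp

lemma chiSplit_V (ϕ : Form1 B) {w v u : GT A} (hw : w ∈ R.V) (hv : v ∈ R.V) (hu : u ∈ R.V) :
    R.chiSplit ϕ w v u = R.chiV ϕ w v u := by
  have hr := R.isAd_adPart hw
  have hs := R.isAd_adPart hv
  have ht := R.isAd_adPart hu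
  have k : R.adPair w (R.br (v - R.lam (R.proj v)) (u - R.lam (R.proj u)))
      = pair (R.adPart w) (R.br (R.adPart v) (R.adPart u)) := by
    rw [sub_lam_V, sub_lam_V, adPair_symm, adPair_V (R.br_mem (R.S.add_mem hs.mem_S (R.flat_mem _))
      (R.S.add_mem ht.mem_S (R.flat_mem _))) hw, pair_symm]
    simp only [br, dorfman_add_left, dorfman_add_right, pair_add_right]
    simp only [← br.eq_def, pair_isAd_br_flat hr hs, pair_isAd_br_flat_left hr ht.mem_S ht.2,
      pair_isAd_br_flat_left hr (R.flat_mem _) (R.proj_flat _), add_zero]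
  rw [chiSplit, csSplit, k, chiV, adPair_V (R.br_lam_mem _ _) hu, adPair_V (R.br_lam_mem _ _) hv,
    adPair_V (R.br_lam_mem _ _) hw]
  ring

/-- The contorsion of mixed type, taken with coefficient `1`, is exactly the difference between `D'`
and the projected bracket. The Weyl term drops out because `Y^-` is orthogonal to `V`. -/
lemma chiSplit_low (ϕ : Form1 B) (Y : VF B) {v u : GT A} (hv : v ∈ R.V) (hu : u ∈ R.V) :
    R.dV Y v u + R.chiSplit ϕ (R.low Y) v u = pair (R.br (R.low Y) v) u := by
  have hs := R.isAd_adPart hv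
  have ht := R.isAd_adPart hu
  have k : R.adPair (R.low Y) (R.br (v - R.lam (R.proj v)) (u - R.lam (R.proj u))) = 0 := by
    rw [adPair_symm, adPair_low (R.br_mem (R.S.sub_mem (R.V_le hv) (R.lam_mem _))
      (R.S.sub_mem (R.V_le hu) (R.lam_mem _)))]
  have e1 : pair (R.br (R.low Y) v) u = pair (R.br (R.low Y) (R.lift (R.proj v) + R.adPart v))
      (R.lift (R.proj u) + R.adPart u) := by
    rw [← R.V_eq v, ← R.V_eq u]
  rw [e1, chiSplit, csSplit, k, adPair_V (R.br_lam_mem _ _) hu, adPair_V (R.br_lam_mem _ _) hv,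
    adPair_low (R.br_lam_mem _ _), R.pair_low_V hv, R.pair_low_V hu, R.proj_low, dV]
  simp only [br, dorfman_add_right, pair_add_left, pair_add_right]
  simp only [← br.eq_def, R.pair_br_low_lift, ht.pair_br_low_lift, hs.pair_br_low_ad,
    hs.pair_br_low_ad_ad ht, map_add, map_smul]
  ring

lemma adPair_zero_left (f : GT A) : R.adPair 0 f = 0 := by
  simp only [adPair, pair_zero_left, R.proj_zero, R.lam_zero, sub_zero]

lemma adPair_zero_right (f : GT A) : R.adPair f 0 = 0 := by
  rw [adPair_symm, adPair_zero_left]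

lemma chiSplit_zero_mid (ϕ : Form1 B) (w u : GT A) : R.chiSplit ϕ w 0 u = 0 := by
  simp only [chiSplit, csSplit, R.proj_zero, R.lam_zero, R.br_zero_left, R.br_zero_right,
    adPair_zero_left, adPair_zero_right, form3_zero₂, map_zero, smul_zero, sub_zero, zero_mul,
    pair_zero_right, add_zero, neg_zero]

/-- The pairing that defines the Weyl connection is the one of `con`. -/
theorem pair_con (ϕ : Form1 B) {e v u : GT A} (he : e ∈ R.S) (hv : v ∈ R.V) (hu : u ∈ R.S) :
    pair (R.con ϕ e v) u = R.dSplit (R.proj e) v u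
      + (1 / 3 : ℝ) • R.chiSplit ϕ (R.plus e) (R.plus v) (R.plus u)
      + (1 / 3 : ℝ) • R.chiSplit ϕ (e - R.plus e) (v - R.plus v) (u - R.plus u)
      + R.chiSplit ϕ (e - R.plus e) (R.plus v) (R.plus u)
      + R.chiSplit ϕ (R.plus e) (v - R.plus v) (u - R.plus u) := by
  have hp := R.plus_mem e he
  have hpu := R.plus_mem u hu
  have hpr : R.proj e = R.proj (R.plus e) + R.lowProj e := by
    conv_lhs => rw [R.S_eq he]
    rw [R.proj_add (R.V_le hp) (R.low_mem _), R.proj_low]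
  have h0 : pair (R.con ϕ e v) u = pair (R.con ϕ e v) (R.plus u) := by
    rw [pair_symm, ← sub_eq_zero, pair_symm (R.con ϕ e v), ← pair_sub_left, R.sub_plus hu,
      R.pair_low_V (R.con_mem ϕ he hv)]
  rw [h0, R.plus_of_mem hv, sub_self, chiSplit_zero_mid, chiSplit_zero_mid, chiSplit_V ϕ hp hv hpu,
    dSplit_V _ hv hu, R.sub_plus he, con, pair_add_left,
    R.pair_plus (R.br_mem (R.low_mem _) (R.V_le hv)) hpu, ← chiSplit_low ϕ _ hv hpu,
    R.pair_conPlus ϕ hp hv hpu, hpr, R.dV_add, smul_zero]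
  ring

end Reduction
end Heterotic

namespace Heterotic

lemma fn_sum_apply {E M k : Type*} [NormedAddCommGroup E] [NormedSpace ℝ E] [TopologicalSpace M]
    [ChartedSpace E M] (t : Finset k) (f : k → Fn E M) (z : M) :
    (∑ i ∈ t, f i) z = ∑ i ∈ t, f i z :=
  map_sum (ContMDiffMap.evalRingHom (I := 𝓘(ℝ, E)) z) f t

/-! ## Hadamard's lemma -/

section Hadamard

open MeasureTheory Filter Topology

universe u

variable {E : Type u} [NormedAddCommGroup E] [NormedSpace ℝ E] [FiniteDimensional ℝ E]

lemma hasFDerivAt_integral_of_contDiff {G : Type u} [NormedAddCommGroup G] [NormedSpace ℝ G]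
    [CompleteSpace G] {F : E → ℝ → G} (hF : ContDiff ℝ ∞ (Function.uncurry F)) (y : E) :
    HasFDerivAt (fun y => ∫ t in (0 : ℝ)..1, F y t)
      (∫ t in (0 : ℝ)..1, (fderiv ℝ (Function.uncurry F) (y, t)).comp
        (ContinuousLinearMap.inl ℝ E ℝ)) y := by
  have hc : Continuous fun p : E × ℝ => (fderiv ℝ (Function.uncurry F) p).comp
      (ContinuousLinearMap.inl ℝ E ℝ) :=
    (hF.continuous_fderiv (by simp)).clm_comp continuous_const
  have hcF : ∀ x, Continuous (F x) := fun x =>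
    hF.continuous.comp (continuous_const.prodMk continuous_id)
  have hcF' : ∀ x, Continuous fun t => (fderiv ℝ (Function.uncurry F) (x, t)).comp
      (ContinuousLinearMap.inl ℝ E ℝ) := fun x => hc.comp (continuous_const.prodMk continuous_id)
  have : ProperSpace E := FiniteDimensional.proper ℝ E
  -- Compactness of the ball times `[0,1]` supplies the uniform bound needed to differentiate under
  -- the integral.
  obtain ⟨K, hK⟩ := ((isCompact_closedBall y 1).prod (isCompact_Icc (a := (0 : ℝ)) (b := 1))
    ).exists_bound_of_continuousOn hc.continuousOn
  refine intervalIntegral.hasFDerivAt_integral_of_dominated_of_fderiv_le (bound := fun _ => K)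
    (F' := fun x t => (fderiv ℝ (Function.uncurry F) (x, t)).comp (ContinuousLinearMap.inl ℝ E ℝ))
    (Metric.closedBall_mem_nhds y one_pos)
    (Eventually.of_forall fun x => (hcF x).aestronglyMeasurable) ((hcF y).intervalIntegrable _ _)
    (hcF' y).aestronglyMeasurable (ae_of_all _ fun t ht x hx => ?_) (by simp)
    (ae_of_all _ fun t _ x _ => ?_)
  · rw [Set.uIoc_of_le zero_le_one] at ht
    exact hK (x, t) ⟨hx, ht.1.le, ht.2⟩
  · have h1 : HasFDerivAt (Function.uncurry F) (fderiv ℝ (Function.uncurry F) (x, t)) (x, t) :=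
      ((hF.differentiable (by simp)) (x, t)).hasFDerivAt
    have h2 : HasFDerivAt (fun x : E => (x, t)) (ContinuousLinearMap.inl ℝ E ℝ) x :=
      hasFDerivAt_prodMk_left x t
    exact h1.comp x h2

/-- Induction on the order of differentiability over all target spaces: the derivative is an
integral of the same kind with values in `E →L[ℝ] G`. Hence `E` and `G` share a universe. -/
lemma contDiff_integral_of_contDiff {G : Type u} [NormedAddCommGroup G] [NormedSpace ℝ G]
    [CompleteSpace G] {F : E → ℝ → G} (hF : ContDiff ℝ ∞ (Function.uncurry F)) :
    ContDiff ℝ ∞ fun y => ∫ t in (0 : ℝ)..1, F y t := by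
  rw [contDiff_infty]
  intro n
  induction n generalizing G with
  | zero =>
    exact contDiff_zero.mpr (continuous_iff_continuousAt.mpr fun y =>
      (hasFDerivAt_integral_of_contDiff hF y).continuousAt)
  | succ n ih =>
    refine contDiff_succ_iff_hasFDerivAt.mpr ⟨_, ih (F := fun y t =>
      (fderiv ℝ (Function.uncurry F) (y, t)).comp (ContinuousLinearMap.inl ℝ E ℝ)) ?_,
      hasFDerivAt_integral_of_contDiff hF⟩
    exact (hF.fderiv_right (m := ∞) (by simp)).clm_comp contDiff_const

/-- `L y` is the mean of the derivative of `f` over the segment from `c` to `y`. -/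
lemma exists_hadamard {f : E → ℝ} (hf : ContDiff ℝ ∞ f) (c : E) :
    ∃ L : E → E →L[ℝ] ℝ, ContDiff ℝ ∞ L ∧ L c = fderiv ℝ f c ∧
      ∀ y, f y = f c + L y (y - c) := by
  have hline : ContDiff ℝ ∞ fun p : E × ℝ => c + p.2 • (p.1 - c) := by fun_prop
  refine ⟨fun y => ∫ t in (0 : ℝ)..1, fderiv ℝ f (c + t • (y - c)),
    contDiff_integral_of_contDiff ((hf.fderiv_right (m := ∞) (by simp)).comp hline), ?_,
    fun y => ?_⟩
  · simp
  · have hd : ∀ t ∈ Set.uIcc (0 : ℝ) 1, HasDerivAt (fun t : ℝ => f (c + t • (y - c)))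
        (fderiv ℝ f (c + t • (y - c)) (y - c)) t := fun t _ => by
      have h1 : HasDerivAt (fun t : ℝ => c + t • (y - c)) (y - c) t := by
        simpa using ((hasDerivAt_id t).smul_const (y - c)).const_add c
      exact ((hf.differentiable (by simp)) _).hasFDerivAt.comp_hasDerivAt t h1
    have hc : Continuous fun t : ℝ => fderiv ℝ f (c + t • (y - c)) :=
      (hf.continuous_fderiv (by simp)).comp (by fun_prop)
    have h := intervalIntegral.integral_eq_sub_of_hasDerivAt hd
      ((hc.clm_apply continuous_const).intervalIntegrable _ _)
    change f y = f c + (∫ t in (0 : ℝ)..1, fderiv ℝ f (c + t • (y - c))) (y - c)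
    rw [ContinuousLinearMap.intervalIntegral_apply (hc.intervalIntegrable _ _), h]
    simp

end Hadamard

/-! ## Derivations of the algebra of smooth functions -/

section Tangent

open Filter Topology

variable {E M : Type*} [NormedAddCommGroup E] [NormedSpace ℝ E] [FiniteDimensional ℝ E]
  [TopologicalSpace M] [ChartedSpace E M] [IsManifold 𝓘(ℝ, E) ∞ M] [T2Space M]

lemma contDiff_bump_mul_symm {p : M} (b : SmoothBumpFunction 𝓘(ℝ, E) p) (f : Fn E M) :
    ContDiff ℝ ∞ fun y => b.toContDiffBump y * f ((extChartAt 𝓘(ℝ, E) p).symm y) := by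
  have hsub : Metric.closedBall (extChartAt 𝓘(ℝ, E) p p) b.rOut ⊆ (extChartAt 𝓘(ℝ, E) p).target := by
    have := b.closedBall_subset
    simpa using this
  rw [contDiff_iff_contDiffAt]
  intro y
  by_cases hy : y ∈ Metric.closedBall (extChartAt 𝓘(ℝ, E) p p) b.rOut
  · have h1 : ContMDiffOn 𝓘(ℝ, E) 𝓘(ℝ, ℝ) ∞ (fun y => f ((extChartAt 𝓘(ℝ, E) p).symm y))
        (extChartAt 𝓘(ℝ, E) p).target := f.contMDiff.comp_contMDiffOn (contMDiffOn_extChartAt_symm p)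
    have h2 := h1.contDiffOn.contDiffAt ((isOpen_extChartAt_target p).mem_nhds (hsub hy))
    exact b.toContDiffBump.contDiff.contDiffAt.mul h2
  · have h0 : (fun y => b.toContDiffBump y * f ((extChartAt 𝓘(ℝ, E) p).symm y)) =ᶠ[𝓝 y]
        fun _ => 0 := by
      filter_upwards [Metric.isClosed_closedBall.isOpen_compl.mem_nhds hy] with z hz
      have : b.toContDiffBump z = 0 := b.toContDiffBump.zero_of_le_dist (by
        simp only [Set.mem_compl_iff, Metric.mem_closedBall, not_le] at hz
        exact hz.le)
      rw [this, zero_mul]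
    exact contDiffAt_const.congr_of_eventuallyEq h0

/-- A smooth function in a chart, cut off by a bump function. -/
noncomputable def bumpComp {p : M} (b : SmoothBumpFunction 𝓘(ℝ, E) p) {F : E → ℝ}
    (hF : ContDiff ℝ ∞ F) : Fn E M :=
  ⟨fun x => b x • F (extChartAt 𝓘(ℝ, E) p x), b.contMDiff_smul
    (hF.contMDiff.comp_contMDiffOn (contMDiffOn_extChartAt))⟩

/-- The derivative of a function in a chart at its centre. -/
noncomputable def chartDeriv (p : M) (f : Fn E M) (x : M) : E →L[ℝ] ℝ :=
  fderiv ℝ (fun y => f ((extChartAt 𝓘(ℝ, E) p).symm y)) (extChartAt 𝓘(ℝ, E) p x)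

lemma mfderiv_eq_chartDeriv (p : M) (f : Fn E M) :
    mfderiv 𝓘(ℝ, E) 𝓘(ℝ, ℝ) f p = chartDeriv p f p := by
  have h := ((f.contMDiff.mdifferentiable (by simp)) p).mfderiv
  rw [modelWithCornersSelf_coe, Set.range_id, fderivWithin_univ] at h
  exact h

lemma fderiv_bump_mul_symm {p : M} (b : SmoothBumpFunction 𝓘(ℝ, E) p) (f : Fn E M) :
    fderiv ℝ (fun y => b.toContDiffBump y * f ((extChartAt 𝓘(ℝ, E) p).symm y))
      (extChartAt 𝓘(ℝ, E) p p) = chartDeriv p f p := by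
  rw [chartDeriv]
  refine Filter.EventuallyEq.fderiv_eq ?_
  filter_upwards [b.toContDiffBump.eventuallyEq_one] with y hy
  rw [hy, Pi.one_apply, one_mul]

/-- Derivations of the algebra of smooth functions are given by tangent vectors. -/
lemma exists_tangent (W : VF (Fn E M)) (p : M) :
    ∃ w : E, ∀ f : Fn E M, W f p = mfderiv 𝓘(ℝ, E) 𝓘(ℝ, ℝ) f p w := by
  obtain ⟨b⟩ : Nonempty (SmoothBumpFunction 𝓘(ℝ, E) p) := inferInstance
  set c := extChartAt 𝓘(ℝ, E) p p with hc
  let bs := Module.finBasis ℝ E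
  have hcoord : ∀ i, ContDiff ℝ ∞ fun y => bs.coord i (y - c) := fun i => by
    have : ContDiff ℝ ∞ fun y => LinearMap.toContinuousLinearMap (bs.coord i) (y - c) := by fun_prop
    exact this
  let β : Fn E M := bumpComp b (contDiff_const (c := (1 : ℝ)))
  have hβ : ∀ x, β x = b x := fun x => by simp [β, bumpComp]
  have hβp : β p = 1 := by rw [hβ]; exact b.eq_one
  let x : Fin (Module.finrank ℝ E) → Fn E M := fun i => bumpComp b (hcoord i)
  have hxp : ∀ i, x i p = 0 := fun i => by simp [x, bumpComp, hc]
  -- The term `W β p * f p` is the price of the cut-off `β`. It is removed in `hW`.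
  have key : ∀ f : Fn E M, W β p * f p + W f p = ∑ i, W (x i) p * chartDeriv p f p (bs i) := by
    intro f
    obtain ⟨L, hL, hLc, hLy⟩ := exists_hadamard (contDiff_bump_mul_symm b f) c
    let h : Fin (Module.finrank ℝ E) → Fn E M := fun i => bumpComp b
      (F := fun y => L y (bs i)) (hL.clm_apply contDiff_const)
    have hfp : b.toContDiffBump c * f ((extChartAt 𝓘(ℝ, E) p).symm c) = f p := by
      have h1 : b.toContDiffBump c = 1 := b.toContDiffBump.eventuallyEq_one.eq_of_nhds
      rw [h1, one_mul, hc, extChartAt_to_inv]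
    -- Hadamard's expansion made global: the inner `β` cuts off `f`, the other two match the
    -- cut-offs in `x i` and `h i`. Outside the chart every term contains a vanishing bump function.
    have e : β * β * (β * f - algebraMap ℝ (Fn E M) (f p)) = ∑ i, x i * h i := by
      ext z
      rw [fn_sum_apply]
      change β z * β z * (β z * f z - f p) = ∑ i, (b z • bs.coord i (extChartAt 𝓘(ℝ, E) p z - c))
        * (b z • L (extChartAt 𝓘(ℝ, E) p z) (bs i))
      by_cases hz : z ∈ (chartAt E p).source
      · have h1 := hLy (extChartAt 𝓘(ℝ, E) p z)
        have h2 : b z = b.toContDiffBump (extChartAt 𝓘(ℝ, E) p z) := b.eqOn_source hz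
        have h3 : (extChartAt 𝓘(ℝ, E) p).symm (extChartAt 𝓘(ℝ, E) p z) = z :=
          (extChartAt 𝓘(ℝ, E) p).left_inv (by rwa [extChartAt_source])
        have h4 : L (extChartAt 𝓘(ℝ, E) p z) (extChartAt 𝓘(ℝ, E) p z - c) =
            ∑ i, bs.coord i (extChartAt 𝓘(ℝ, E) p z - c) * L (extChartAt 𝓘(ℝ, E) p z) (bs i) := by
          conv_lhs => rw [← bs.sum_repr (extChartAt 𝓘(ℝ, E) p z - c), map_sum]
          simp
        rw [h3, ← h2, hfp, h4] at h1
        rw [hβ, h1, add_sub_cancel_left, Finset.mul_sum]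
        exact Finset.sum_congr rfl fun i _ => by simp only [smul_eq_mul]; ring
      · have : b z = 0 := by
          by_contra hb
          exact hz (b.support_subset_source hb)
        simp [hβ, this]
    have e' := congrArg (fun u : Fn E M => u p) (congrArg W e)
    have e1 : (W (β * β * (β * f - algebraMap ℝ (Fn E M) (f p)))) p
        = W β p * f p + W f p := by
      rw [Derivation.leibniz, map_sub, Derivation.map_algebraMap, Derivation.leibniz, sub_zero]
      change β p * β p * (β p * W f p + f p * W β p) + (β p * f p - f p) * W (β * β) p = _
      rw [hβp]; ring
    have e2 : (W (∑ i, x i * h i)) p = ∑ i, W (x i) p * chartDeriv p f p (bs i) := by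
      rw [map_sum, fn_sum_apply]
      refine Finset.sum_congr rfl fun i _ => ?_
      rw [Derivation.leibniz]
      change x i p * W (h i) p + h i p * W (x i) p = _
      have h5 : h i p = chartDeriv p f p (bs i) := by
        change b p • L c (bs i) = _
        rw [hLc, fderiv_bump_mul_symm, b.eq_one, one_smul]
      rw [hxp, h5]; ring
    rw [← e1, ← e2]
    exact e'
  -- Apply `key` to the constant function `1`, which has zero derivative on both sides.
  have hW : W β p = 0 := by
    have h1 := key 1
    have h2 : W (1 : Fn E M) p = 0 := by rw [Derivation.map_one_eq_zero]; rfl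
    have h3 : chartDeriv p (1 : Fn E M) p = 0 := by
      rw [chartDeriv]; exact (hasFDerivAt_const (1 : ℝ) _).fderiv
    rw [h2, h3] at h1
    simpa using h1
  refine ⟨∑ i, W (x i) p • bs i, fun f => ?_⟩
  have h1 := key f
  rw [hW, zero_mul, zero_add] at h1
  rw [mfderiv_eq_chartDeriv]
  refine h1.trans ?_
  exact ((map_sum (chartDeriv p f p) _ _).trans (Finset.sum_congr rfl fun i _ =>
    (map_smul (chartDeriv p f p) _ _))).symm

/-- The algebraic Leibniz rule alone does not give this; the chain rule applies because `W` acts by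
a tangent vector at each point. -/
lemma derivation_expFn (W : VF (Fn E M)) (f : Fn E M) : W (expFn f) = expFn f * W f := by
  ext p
  obtain ⟨w, hw⟩ := exists_tangent W p
  have h1 : MDifferentiableAt 𝓘(ℝ, E) 𝓘(ℝ, ℝ) f p := f.contMDiff.mdifferentiable (by simp) p
  have h2 : HasMFDerivAt 𝓘(ℝ, ℝ) 𝓘(ℝ, ℝ) Real.exp (f p) _ :=
    (Real.hasDerivAt_exp (f p)).hasFDerivAt.hasMFDerivAt
  have h3 := (h2.comp p h1.hasMFDerivAt).mfderiv
  change W (expFn f) p = Real.exp (f p) * W f p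
  rw [hw, hw]
  refine (congrArg (fun l : E →L[ℝ] ℝ => l w) h3).trans ?_
  exact mul_comm _ _

end Tangent
end Heterotic

namespace Heterotic

/-! ### Local coordinate fields and the locality of tensors. -/

section Coordinates

open Filter Topology

variable {E M : Type*} [NormedAddCommGroup E] [NormedSpace ℝ E] [FiniteDimensional ℝ E]
  [TopologicalSpace M] [ChartedSpace E M] [IsManifold 𝓘(ℝ, E) ∞ M] [T2Space M]

/-- Where `b'` is nonzero, `b` is identically `1` nearby, so functions and coordinates cut off by
`b` have their true derivatives there. -/
lemma exists_support_subset_ball {p : M} (b : SmoothBumpFunction 𝓘(ℝ, E) p) :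
    ∃ b' : SmoothBumpFunction 𝓘(ℝ, E) p, ∀ z, b' z ≠ 0 → z ∈ (chartAt E p).source ∧
      extChartAt 𝓘(ℝ, E) p z ∈ Metric.ball (extChartAt 𝓘(ℝ, E) p p) b.rIn := by
  have hs : (chartAt E p).source ∩ extChartAt 𝓘(ℝ, E) p ⁻¹'
      Metric.ball (extChartAt 𝓘(ℝ, E) p p) b.rIn ∈ 𝓝 p :=
    inter_mem ((chartAt E p).open_source.mem_nhds (mem_chart_source E p))
      ((continuousAt_extChartAt p).preimage_mem_nhds (Metric.ball_mem_nhds _ b.rIn_pos))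
  obtain ⟨b', -, hb'⟩ := (SmoothBumpFunction.nhds_basis_tsupport (I := 𝓘(ℝ, E)) p).mem_iff.mp hs
  exact ⟨b', fun z hz => hb' (subset_closure hz)⟩

lemma bump_mul_symm_eventuallyEq {p : M} (b : SmoothBumpFunction 𝓘(ℝ, E) p) (f : Fn E M) {z : M}
    (hz : z ∈ (chartAt E p).source) (hz' : extChartAt 𝓘(ℝ, E) p z ∈
      Metric.ball (extChartAt 𝓘(ℝ, E) p p) b.rIn) :
    (f : M → ℝ) =ᶠ[𝓝 z] fun y => b.toContDiffBump (extChartAt 𝓘(ℝ, E) p y) *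
      f ((extChartAt 𝓘(ℝ, E) p).symm (extChartAt 𝓘(ℝ, E) p y)) := by
  have hc : ContinuousAt (extChartAt 𝓘(ℝ, E) p) z := continuousAt_extChartAt' (by
    rwa [extChartAt_source])
  filter_upwards [(chartAt E p).open_source.mem_nhds hz,
    hc.preimage_mem_nhds (Metric.isOpen_ball.mem_nhds hz')] with y hy hy'
  rw [b.toContDiffBump.one_of_mem_closedBall (Metric.ball_subset_closedBall hy'), one_mul,
    (extChartAt 𝓘(ℝ, E) p).left_inv (by rwa [extChartAt_source])]

/-- The derivative along `v` of a function cut off in a chart. -/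
noncomputable def bumpDeriv {p : M} (b : SmoothBumpFunction 𝓘(ℝ, E) p) (v : E) (f : Fn E M)
    (y : E) : ℝ :=
  fderiv ℝ (fun y => b.toContDiffBump y * f ((extChartAt 𝓘(ℝ, E) p).symm y)) y v

/-- A coordinate vector field, cut off by a bump function. -/
noncomputable def coordField {p : M} (b b' : SmoothBumpFunction 𝓘(ℝ, E) p)
    (hb : ∀ z, b' z ≠ 0 → z ∈ (chartAt E p).source ∧
      extChartAt 𝓘(ℝ, E) p z ∈ Metric.ball (extChartAt 𝓘(ℝ, E) p p) b.rIn) (v : E) :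
    VF (Fn E M) :=
  Derivation.mk'
    { toFun := fun f => bumpComp b' (F := bumpDeriv b v f)
        (((contDiff_bump_mul_symm b f).fderiv_right (m := ∞) (by simp)).clm_apply contDiff_const)
      map_add' := fun f h => by
        ext z
        change b' z • bumpDeriv b v (f + h) (extChartAt 𝓘(ℝ, E) p z) = b' z • bumpDeriv b v (f) (extChartAt 𝓘(ℝ, E) p z) +
          b' z • bumpDeriv b v (h) (extChartAt 𝓘(ℝ, E) p z)
        rw [← smul_add]
        congr 1
        have h1 := ((contDiff_bump_mul_symm b f).differentiable (by simp)
          (extChartAt 𝓘(ℝ, E) p z)).hasFDerivAt.add ((contDiff_bump_mul_symm b h).differentiable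
          (by simp) (extChartAt 𝓘(ℝ, E) p z)).hasFDerivAt
        have h2 := h1.congr_of_eventuallyEq (Eventually.of_forall (fun y => by
          change b.toContDiffBump y * (f _ + h _) = b.toContDiffBump y * f _
            + b.toContDiffBump y * h _
          ring) : (fun y => b.toContDiffBump y * (f + h) ((extChartAt 𝓘(ℝ, E) p).symm y))
            =ᶠ[𝓝 (extChartAt 𝓘(ℝ, E) p z)] _)
        exact congrArg (fun l : E →L[ℝ] ℝ => l v) h2.fderiv
      map_smul' := fun t f => by
        ext z
        change b' z • bumpDeriv b v (t • f) (extChartAt 𝓘(ℝ, E) p z) = t • b' z • bumpDeriv b v (f) (extChartAt 𝓘(ℝ, E) p z)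
        rw [smul_comm]
        congr 1
        have h1 := ((contDiff_bump_mul_symm b f).differentiable (by simp)
          (extChartAt 𝓘(ℝ, E) p z)).hasFDerivAt.const_smul t
        have h2 := h1.congr_of_eventuallyEq (Eventually.of_forall (fun y => by
          change b.toContDiffBump y * (t • f _) = t • (b.toContDiffBump y * f _)
          rw [mul_smul_comm]) :
          (fun y => b.toContDiffBump y * (t • f) ((extChartAt 𝓘(ℝ, E) p).symm y))
            =ᶠ[𝓝 (extChartAt 𝓘(ℝ, E) p z)] _)
        exact congrArg (fun l : E →L[ℝ] ℝ => l v) h2.fderiv } fun f h => by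
    ext z
    change b' z • bumpDeriv b v (f * h) (extChartAt 𝓘(ℝ, E) p z) = f z * (b' z • bumpDeriv b v (h) (extChartAt 𝓘(ℝ, E) p z)) +
      h z * (b' z • bumpDeriv b v (f) (extChartAt 𝓘(ℝ, E) p z))
    by_cases hz : b' z = 0
    · rw [hz]; simp
    obtain ⟨hs, hball⟩ := hb z hz
    rw [mul_smul_comm, mul_smul_comm, ← smul_add]
    congr 1
    have h1 := ((contDiff_bump_mul_symm b f).differentiable (by simp)
      (extChartAt 𝓘(ℝ, E) p z)).hasFDerivAt.mul ((contDiff_bump_mul_symm b h).differentiable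
      (by simp) (extChartAt 𝓘(ℝ, E) p z)).hasFDerivAt
    -- Cutting off is multiplicative only where the bump function is `0` or `1`. Here it is `1` near
    -- the point, because `b' z ≠ 0`.
    have h2 := h1.congr_of_eventuallyEq (f₁ := fun y => b.toContDiffBump y * (f * h)
      ((extChartAt 𝓘(ℝ, E) p).symm y)) (by
        filter_upwards [Metric.isOpen_ball.mem_nhds hball] with y hy
        change b.toContDiffBump y * (f _ * h _) = (b.toContDiffBump y * f _) *
          (b.toContDiffBump y * h _)
        rw [b.toContDiffBump.one_of_mem_closedBall (Metric.ball_subset_closedBall hy)]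
        ring)
    have hf := (bump_mul_symm_eventuallyEq b f hs hball).eq_of_nhds
    have hh := (bump_mul_symm_eventuallyEq b h hs hball).eq_of_nhds
    refine (congrArg (fun l : E →L[ℝ] ℝ => l v) h2.fderiv).trans ?_
    conv_rhs => rw [hf, hh]
    rfl

lemma vf_sum_apply {A k : Type*} [CommRing A] [Algebra ℝ A] (t : Finset k) (W : k → VF A) (f : A) :
    (∑ i ∈ t, W i) f = ∑ i ∈ t, W i f :=
  map_sum (AddMonoidHom.mk' (fun W : VF A => W f) fun _ _ => rfl) W t

/-- Near every point the vector fields are the combinations of finitely many, with coefficients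
the derivatives of finitely many functions. -/
lemma exists_local_coords (p : M) : ∃ (ψ : Fn E M) (x : Fin (Module.finrank ℝ E) → Fn E M)
    (D : Fin (Module.finrank ℝ E) → VF (Fn E M)), ψ p = 1 ∧
      ∀ W : VF (Fn E M), ψ • W = ∑ i, W (x i) • D i := by
  obtain ⟨b⟩ : Nonempty (SmoothBumpFunction 𝓘(ℝ, E) p) := inferInstance
  obtain ⟨b', hb⟩ := exists_support_subset_ball b
  let bs := Module.finBasis ℝ E
  have hcoord : ∀ i, ContDiff ℝ ∞ fun y => bs.coord i y := fun i =>
    (LinearMap.toContinuousLinearMap (bs.coord i)).contDiff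
  let ψ : Fn E M := bumpComp b' (contDiff_const (c := (1 : ℝ)))
  have hψ : ∀ z, ψ z = b' z := fun z => by simp [ψ, bumpComp]
  refine ⟨ψ, fun i => bumpComp b (hcoord i), fun i => coordField b b' hb (bs i),
    by rw [hψ]; exact b'.eq_one, fun W => ?_⟩
  ext f z
  have hL : (ψ • W) f z = b' z * W f z := by rw [← hψ]; rfl
  have hR : (∑ i, W (bumpComp b (hcoord i)) • coordField b b' hb (bs i)) f z =
      ∑ i, W (bumpComp b (hcoord i)) z * (b' z • fderiv ℝ (fun y => b.toContDiffBump y *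
        f ((extChartAt 𝓘(ℝ, E) p).symm y)) (extChartAt 𝓘(ℝ, E) p z) (bs i)) := by
    rw [vf_sum_apply, fn_sum_apply]
    rfl
  rw [hL, hR]
  by_cases hz : b' z = 0
  · simp [hz]
  obtain ⟨hs, hball⟩ := hb z hz
  obtain ⟨w, hw⟩ := exists_tangent W z
  have hφ : MDifferentiableAt 𝓘(ℝ, E) 𝓘(ℝ, E) (extChartAt 𝓘(ℝ, E) p) z :=
    mdifferentiableAt_extChartAt hs
  let u : E := mfderiv 𝓘(ℝ, E) 𝓘(ℝ, E) (extChartAt 𝓘(ℝ, E) p) z w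
  have chain : ∀ (h : Fn E M) (F : E → ℝ), ContDiff ℝ ∞ F →
      (h : M → ℝ) =ᶠ[𝓝 z] (fun y => F (extChartAt 𝓘(ℝ, E) p y)) →
      W h z = fderiv ℝ F (extChartAt 𝓘(ℝ, E) p z) u := by
    intro h F hF he
    have h1 : HasMFDerivAt 𝓘(ℝ, E) 𝓘(ℝ, ℝ) F (extChartAt 𝓘(ℝ, E) p z) _ :=
      (hF.differentiable (by simp) _).hasFDerivAt.hasMFDerivAt
    have h2 := (h1.comp z hφ.hasMFDerivAt).mfderiv
    rw [hw]
    exact congrArg (fun l : E →L[ℝ] ℝ => l w) (he.mfderiv_eq.trans h2)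
  rw [chain f _ (contDiff_bump_mul_symm b f) (bump_mul_symm_eventuallyEq b f hs hball)]
  have hx : ∀ i, W (bumpComp b (hcoord i)) z = bs.coord i u := fun i => by
    rw [chain (bumpComp b (hcoord i)) _ (hcoord i)]
    · exact congrArg (fun l : E →L[ℝ] ℝ => l u)
        (LinearMap.toContinuousLinearMap (bs.coord i)).fderiv
    · have hc : ContinuousAt (extChartAt 𝓘(ℝ, E) p) z := continuousAt_extChartAt' (by
        rwa [extChartAt_source])
      filter_upwards [(chartAt E p).open_source.mem_nhds hs,
        hc.preimage_mem_nhds (Metric.isOpen_ball.mem_nhds hball)] with y hy hy'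
      change b y • bs.coord i (extChartAt 𝓘(ℝ, E) p y) = _
      have h2 : b y = b.toContDiffBump (extChartAt 𝓘(ℝ, E) p y) := b.eqOn_source hy
      rw [h2, b.toContDiffBump.one_of_mem_closedBall (Metric.ball_subset_closedBall hy'), one_smul]
  conv_lhs => rw [← bs.sum_repr u, map_sum, Finset.mul_sum]
  refine Finset.sum_congr rfl fun i _ => ?_
  rw [hx, map_smul]
  simp only [smul_eq_mul, Module.Basis.coord_apply]
  ring

/-- Linear maps on vector fields are local. -/
lemma map_vf_eq_zero_of_vanish {N U : Type*} [AddCommGroup N] [Module (Fn E M) N]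
    [AddCommGroup U] [Module ℝ U] (l : VF (Fn E M) →ₗ[Fn E M] N) (p : M) (ev : N →+ U)
    (hev : ∀ (a : Fn E M) n, ev (a • n) = a p • ev n) {W : VF (Fn E M)} (hW : ∀ f, W f p = 0) :
    ev (l W) = 0 := by
  obtain ⟨ψ, x, D, hψ, h⟩ := exists_local_coords (E := E) p
  have h1 := congrArg (fun Z => ev (l Z)) (h W)
  simp only [map_smul, map_sum, hev, hW, zero_smul, Finset.sum_const_zero, hψ, one_smul] at h1
  exact h1

lemma form1_eq_zero_of_vanish (η : Form1 (Fn E M)) (p : M) {W : VF (Fn E M)}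
    (hW : ∀ f, W f p = 0) : η W p = 0 :=
  map_vf_eq_zero_of_vanish η p (ContMDiffMap.evalRingHom (I := 𝓘(ℝ, E)) p).toAddMonoidHom
    (fun _ _ => rfl) hW

end Coordinates
end Heterotic

namespace Heterotic

/-! ## Principal bundles -/

namespace PrincipalBundle

variable {EG HG G EP P EM M : Type*}
  [NormedAddCommGroup EG] [NormedSpace ℝ EG] [TopologicalSpace HG] {IG : ModelWithCorners ℝ EG HG}
  [TopologicalSpace G] [ChartedSpace HG G] [Group G] [LieGroup IG ∞ G]
  [NormedAddCommGroup EP] [NormedSpace ℝ EP] [TopologicalSpace P] [ChartedSpace EP P]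
  [IsManifold 𝓘(ℝ, EP) ∞ P]
  [NormedAddCommGroup EM] [NormedSpace ℝ EM] [TopologicalSpace M] [ChartedSpace EM M]
  (Q : PrincipalBundle G EP P EM M IG)

lemma proj_surjective : Function.Surjective Q.proj := fun x => by
  obtain ⟨U, -, hx, σ, γ, -, -, h, -⟩ := Q.locally_trivial x
  exact ⟨σ x, h x hx⟩

lemma pull_apply (f : Fn EM M) (p : P) : Q.pull f p = f (Q.proj p) := rfl

lemma pull_injective : Function.Injective Q.pull := fun f h e => by
  ext x
  obtain ⟨p, rfl⟩ := Q.proj_surjective x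
  exact congrArg (fun u : Fn EP P => u p) e

lemma rpull_pull (a : G) (f : Fn EM M) : Q.rpull a (Q.pull f) = Q.pull f := by
  ext p
  change f (Q.proj (Q.act p a)) = f (Q.proj p)
  rw [Q.proj_act]

lemma rpull_inv_rpull (a : G) (f : Fn EP P) : Q.rpull a⁻¹ (Q.rpull a f) = f := by
  simpa using Q.rpull_rpull_inv a⁻¹ f

lemma fund_pull (z : EG) (f : Fn EM M) : Q.fund z (Q.pull f) = 0 := by
  ext p
  change mfderiv IG 𝓘(ℝ, ℝ) (fun a : G => f (Q.proj (Q.act p a))) 1 z = 0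
  have h : (fun a : G => f (Q.proj (Q.act p a))) = fun _ => f (Q.proj p) := by
    funext a
    rw [Q.proj_act]
  rw [h, mfderiv_const]
  rfl

/-- Invariant functions are pulled back from the base. -/
lemma exists_pull_of_invariant (f : Fn EP P) (hf : ∀ a, Q.rpull a f = f) : ∃ h, f = Q.pull h := by
  have hact : ∀ p a, f (Q.act p a) = f p := fun p a => congrArg (fun u : Fn EP P => u p) (hf a)
  -- An arbitrary set-theoretic section suffices: `f` is constant on fibres, so `f ∘ τ` agrees
  -- locally with `f ∘ σ` for a smooth local section `σ`.
  let τ : M → P := Function.surjInv Q.proj_surjective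
  have hτ : ∀ x, Q.proj (τ x) = x := Function.surjInv_eq _
  have hproj : ∀ p p', Q.proj p = Q.proj p' → f p = f p' := by
    intro p p' e
    obtain ⟨U, -, hx, σ, γ, -, -, -, h⟩ := Q.locally_trivial (Q.proj p)
    rw [h p hx, h p' (e ▸ hx), hact, hact, e]
  refine ⟨⟨fun x => f (τ x), fun x => ?_⟩, ?_⟩
  · obtain ⟨U, hU, hx, σ, γ, hσ, -, hs, -⟩ := Q.locally_trivial x
    refine ((f.contMDiff.comp_contMDiffOn hσ).contMDiffAt (hU.mem_nhds hx)
      ).congr_of_eventuallyEq ?_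
    filter_upwards [hU.mem_nhds hx] with y hy
    exact hproj _ _ ((hτ y).trans (hs y hy).symm)
  · ext p
    exact hproj _ _ (hτ _).symm

lemma rpullVF_lie (a : G) (X Y : VF (Fn EP P)) :
    Q.rpullVF a ⁅X, Y⁆ = ⁅Q.rpullVF a X, Q.rpullVF a Y⁆ := by
  refine Derivation.ext fun f => ?_
  rw [rpullVF_apply, Derivation.commutator_apply, Derivation.commutator_apply, map_sub,
    rpullVF_apply, rpullVF_apply, rpullVF_apply, rpullVF_apply, rpull_inv_rpull, rpull_inv_rpull]

lemma rpullVF_smul (a : G) (f : Fn EP P) (X : VF (Fn EP P)) :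
    Q.rpullVF a (f • X) = Q.rpull a f • Q.rpullVF a X := by
  refine Derivation.ext fun h => ?_
  rw [rpullVF_apply, Derivation.smul_apply, Derivation.smul_apply, rpullVF_apply, smul_eq_mul,
    map_mul, smul_eq_mul]

lemma rpull_apply_vf (a : G) (X : VF (Fn EP P)) (f : Fn EP P) :
    Q.rpull a (X f) = Q.rpullVF a X (Q.rpull a f) := by
  rw [rpullVF_apply, rpull_inv_rpull]

/-- Invariant vector fields are projectable. -/
lemma exists_related (X : VF (Fn EP P)) (hX : ∀ a, Q.rpullVF a X = X) : ∃ Y, Q.Related X Y := by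
  have h : ∀ f, ∃ b, X (Q.pull f) = Q.pull b := fun f =>
    Q.exists_pull_of_invariant _ fun a => by rw [rpull_apply_vf, hX, rpull_pull]
  choose Y hY using h
  refine ⟨Derivation.mk' { toFun := Y, map_add' := fun f h => ?_, map_smul' := fun t f => ?_ }
    fun f h => ?_, hY⟩
  · refine Q.pull_injective ?_
    rw [← hY, map_add, map_add, map_add, hY, hY]
  · refine Q.pull_injective ?_
    rw [← hY, map_smul, Derivation.map_smul, hY, ← map_smul]
    rfl
  · refine Q.pull_injective ?_
    change Q.pull (Y (f * h)) = Q.pull (f * Y h + h * Y f)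
    rw [← hY, map_mul, Derivation.leibniz, map_add, map_mul, map_mul, ← hY, ← hY]
    rfl

lemma related_unique {X : VF (Fn EP P)} {Y Y' : VF (Fn EM M)} (h : Q.Related X Y)
    (h' : Q.Related X Y') : Y = Y' :=
  Derivation.ext fun f => Q.pull_injective ((h f).symm.trans (h' f))

lemma push_eq {X : VF (Fn EP P)} {Y : VF (Fn EM M)} (h : Q.Related X Y) : Q.push X = Y :=
  Q.related_unique (Classical.epsilon_spec (p := Q.Related X) ⟨Y, h⟩) h

lemma push_related {X : VF (Fn EP P)} (hX : ∀ a, Q.rpullVF a X = X) : Q.Related X (Q.push X) := by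
  obtain ⟨Y, hY⟩ := Q.exists_related X hX
  rwa [Q.push_eq hY]

variable {Q} {c : LinearMap.BilinForm ℝ EG} (L : Q.LiftedAction c)

namespace LiftedAction

lemma smul_mem_sections (f : Fn EM M) {e : GT (Fn EP P)} (he : e ∈ L.sections) :
    Q.pull f • e ∈ L.sections := by
  obtain ⟨h1, h2, h3, h4⟩ := he
  refine ⟨fun z => ?_, fun a => ?_, fun a X => ?_, fun z => ?_⟩
  · rw [pair_smul_left', h1, mul_zero]
  · rw [Prod.smul_fst, rpullVF_smul, rpull_pull, h2]
  · rw [Prod.smul_snd, LinearMap.smul_apply, LinearMap.smul_apply, h3, smul_eq_mul, smul_eq_mul,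
      map_mul, rpull_pull]
  · rw [dorfman_smul_right', h4]
    change Q.fund z (Q.pull f) • e + _ = _
    rw [Q.fund_pull]
    simp

/-- Orthogonality to `ρ(z)` passes to the bracket by invariance of the pairing, infinitesimal
invariance by the Jacobi identity, and invariance under `G` by that of `Hhat`. -/
lemma dorfman_mem_sections {u v : GT (Fn EP P)} (hu : u ∈ L.sections) (hv : v ∈ L.sections) :
    dorfman L.Hhat u v ∈ L.sections := by
  obtain ⟨h1, h2, h3, h4⟩ := hu
  obtain ⟨k1, k2, k3, k4⟩ := hv
  refine ⟨fun z => ?_, fun a => ?_, fun a X => ?_, fun z => ?_⟩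
  · have e1 := dorfman_pair L.Hhat u v (L.rho z)
    have e2 := pair_dorfman_swap L.Hhat u (L.rho z) v
    rw [h4, h1, pair_zero_left, map_zero, neg_zero, add_zero] at e2
    rw [k1, map_zero, pair_symm v, e2, add_zero] at e1
    exact e1.symm
  · rw [dorfman_fst, rpullVF_lie, h2, k2]
  · have e1 : ∀ Y, v.2 ⁅u.1, Q.rpullVF a Y⁆ = Q.rpull a (v.2 ⁅u.1, Y⁆) := fun Y => by
      rw [← k3, rpullVF_lie, h2]
    have e2 : ∀ Y, u.2 ⁅v.1, Q.rpullVF a Y⁆ = Q.rpull a (u.2 ⁅v.1, Y⁆) := fun Y => by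
      rw [← h3, rpullVF_lie, k2]
    have e3 := L.invariant a u.1 v.1 X
    rw [h2, k2] at e3
    have e4 : ∀ f, u.1 (Q.rpull a f) = Q.rpull a (u.1 f) := fun f => by rw [rpull_apply_vf, h2]
    have e5 : ∀ f, v.1 (Q.rpull a f) = Q.rpull a (v.1 f) := fun f => by rw [rpull_apply_vf, k2]
    have e6 : Q.rpull a (u.2 v.1) = u.2 v.1 := by rw [← h3, k2]
    have e7 : Q.rpull a (X (u.2 v.1)) = Q.rpullVF a X (u.2 v.1) := by rw [rpull_apply_vf, e6]
    rw [dorfman_snd_apply, dorfman_snd_apply, e1, e2, e3, h3, k3, e4, e5, ← e7]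
    simp only [map_sub, map_add]
  · have e := dorfman_jacobi L.Hhat L.closed (L.rho z) u v
    have z1 : dorfman L.Hhat 0 v = 0 := by simpa using dorfman_sub_left L.Hhat u u v
    have z2 : dorfman L.Hhat u 0 = 0 := by simpa using dorfman_sub_right L.Hhat u v v
    rw [h4, k4, z1, z2, add_zero] at e
    exact e

lemma rpull_pair {u v : GT (Fn EP P)} (hu : u ∈ L.sections) (hv : v ∈ L.sections) (a : G) :
    Q.rpull a (pair u v) = pair u v := by
  obtain ⟨-, h2, h3, -⟩ := hu
  obtain ⟨-, k2, k3, -⟩ := hv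
  rw [pair, map_smul, map_add, ← h3, ← k3, h2, k2]

lemma section_related {e : GT (Fn EP P)} (he : e ∈ L.sections) : Q.Related e.1 (Q.push e.1) :=
  Q.push_related he.2.1

variable {L}

lemma IsFrame.pair_apply {W : Submodule ℝ (GT (Fn EP P))} {χ : Fn EM M} {m : ℕ}
    {s s' : Fin m → GT (Fn EP P)} (h : IsFrame (Q := Q) W χ s s') {p : P} (hp : χ (Q.proj p) ≠ 0)
    {e : GT (Fn EP P)} (he : e ∈ W) (f : GT (Fn EP P)) :
    pair e f p = ∑ i, pair e (s' i) p * pair (s i) f p := by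
  have h1 := congrArg (fun u => pair u f p) (h.2.2 e he)
  simp only [pair_smul_left', pair_sum_left] at h1
  have h2 : χ (Q.proj p) * pair e f p
      = χ (Q.proj p) * (∑ i, pair e (s' i) * pair (s i) f : Fn EP P) p := h1
  rw [mul_right_inj' hp] at h2
  rw [h2]
  exact fn_sum_apply _ _ _

/-- At a point, pairing with a section of `W` factors through its `m` frame coefficients, so at most
`m` sections can be told apart linearly by pairings. -/
lemma IsFrame.card_le {W : Submodule ℝ (GT (Fn EP P))} {χ : Fn EM M} {m : ℕ}
    {s s' : Fin m → GT (Fn EP P)} (h : IsFrame (Q := Q) W χ s s') {p : P} (hp : χ (Q.proj p) ≠ 0)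
    {k : Type*} [Fintype k] (v : k → GT (Fn EP P)) (hv : ∀ a, v a ∈ W)
    (hind : ∀ w : k → ℝ, (∀ f ∈ W, ∑ a, w a * pair (v a) f p = 0) → w = 0) :
    Fintype.card k ≤ m := by
  have hl : LinearIndependent ℝ fun a : k => fun i : Fin m => pair (v a) (s' i) p := by
    rw [Fintype.linearIndependent_iff]
    intro w hw
    have := hind w fun f _ => ?_
    · exact fun i => congrFun this i
    · have hw' : ∀ i, ∑ a, w a * pair (v a) (s' i) p = 0 := fun i => by
        simpa using congrFun hw i
      simp only [h.pair_apply hp (hv _) f, Finset.mul_sum]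
      rw [Finset.sum_comm]
      refine Finset.sum_eq_zero fun i _ => ?_
      simp only [← mul_assoc]
      rw [← Finset.sum_mul, hw', zero_mul]
  simpa using hl.fintype_card_le_finrank

lemma HasRank.nondeg {W : Submodule ℝ (GT (Fn EP P))} {m : ℕ} (h : HasRank Q W m)
    {e : GT (Fn EP P)} (he : e ∈ W) (h0 : ∀ f ∈ W, pair e f = 0) : e = 0 := by
  have key : ∀ p : P, ∃ χ : Fn EM M, χ (Q.proj p) ≠ 0 ∧ Q.pull χ • e = 0 := fun p => by
    obtain ⟨χ, s, s', hχ, hf⟩ := h (Q.proj p)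
    refine ⟨χ, hχ, ?_⟩
    rw [hf.2.2 e he, Finset.sum_eq_zero, smul_zero]
    intro i _
    rw [h0 _ (hf.1 i).2, zero_smul]
  refine Prod.ext (Derivation.ext fun f => ?_) (LinearMap.ext fun X => ?_)
  · ext p
    obtain ⟨χ, hχ, hc⟩ := key p
    have h1 : χ (Q.proj p) * e.1 f p = 0 :=
      congrArg (fun u : GT (Fn EP P) => u.1 f p) hc
    exact (mul_eq_zero.mp h1).resolve_left hχ
  · ext p
    obtain ⟨χ, hχ, hc⟩ := key p
    have h1 : χ (Q.proj p) * e.2 X p = 0 :=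
      congrArg (fun u : GT (Fn EP P) => u.2 X p) hc
    exact (mul_eq_zero.mp h1).resolve_left hχ

namespace GenMetric

variable {n : ℕ} {𝒱 : L.GenMetric n}

lemma plus_spec {e : GT (Fn EP P)} (he : e ∈ L.sections) :
    𝒱.plus e ∈ 𝒱.V ∧ ∀ w ∈ 𝒱.V, pair (e - 𝒱.plus e) w = 0 :=
  Classical.epsilon_spec (p := fun v => v ∈ 𝒱.V ∧ ∀ w ∈ 𝒱.V, pair (e - v) w = 0)
    (by obtain ⟨v, hv, h⟩ := 𝒱.decomp e he; exact ⟨v, hv, h⟩)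

namespace Fields

variable (ℱ : 𝒱.Fields)

lemma pair_lift_mem (X : VF (Fn EM M)) {v : GT (Fn EP P)} (hv : v ∈ 𝒱.V) :
    pair (ℱ.lift X) v = Q.pull (ℱ.g.toForm X (Q.push v.1)) := by
  have h := ℱ.lift_orth X (v - ℱ.lift (Q.push v.1)) (𝒱.V.sub_mem hv (ℱ.lift_mem _)) fun f => by
    rw [Prod.fst_sub, Derivation.sub_apply, L.section_related (𝒱.le hv), ℱ.lift_related, sub_self]
  rw [pair_sub_right, sub_eq_zero] at h
  rw [h, ℱ.g_eq]

lemma pair_lam_mem (X : VF (Fn EM M)) {e : GT (Fn EP P)} (he : e ∈ L.sections) :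
    pair (ℱ.lift X) e - pair (ℱ.lam X) e
      = (1 / 2 : ℝ) • Q.pull (ℱ.g.toForm X (Q.push e.1)) := by
  rw [← ℱ.lam_snd X e.1 _ (L.section_related he), pair, pair, ℱ.lam_fst, ← smul_sub]
  congr 1
  ring

/-- The section of `V_-` over `X`. -/
noncomputable def lower (X : VF (Fn EM M)) : GT (Fn EP P) := (2 : ℝ) • ℱ.lam X - ℱ.lift X

lemma lower_mem (X : VF (Fn EM M)) : ℱ.lower X ∈ L.sections :=
  L.sections.sub_mem (L.sections.smul_mem _ (ℱ.lam_mem X)) (𝒱.le (ℱ.lift_mem X))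

lemma pair_lower_mem (X : VF (Fn EM M)) {v : GT (Fn EP P)} (hv : v ∈ 𝒱.V) :
    pair (ℱ.lower X) v = 0 := by
  have h := ℱ.pair_lam_mem X (𝒱.le hv)
  rw [ℱ.pair_lift_mem X hv, sub_eq_iff_eq_add, ← sub_eq_iff_eq_add'] at h
  rw [lower, pair_sub_left, pair_smul_left, ← h, ℱ.pair_lift_mem X hv]
  algebra

lemma push_lower (X : VF (Fn EM M)) : Q.push (ℱ.lower X).1 = X := by
  refine Q.push_eq fun f => ?_
  rw [lower, Prod.fst_sub, Prod.smul_fst, Derivation.sub_apply, Derivation.smul_apply, ℱ.lam_fst,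
    ℱ.lift_related]
  algebra

lemma pair_lower_lower (X Y : VF (Fn EM M)) :
    pair (ℱ.lower X) (ℱ.lower Y) = -Q.pull (ℱ.g.toForm X Y) := by
  have h := ℱ.pair_lam_mem X (ℱ.lower_mem Y)
  rw [pair_symm (ℱ.lift X), ℱ.pair_lower_mem Y (ℱ.lift_mem X), push_lower, zero_sub] at h
  rw [lower, pair_sub_left, pair_smul_left, ← neg_eq_iff_eq_neg.mpr h.symm,
    pair_symm (ℱ.lift X), ℱ.pair_lower_mem Y (ℱ.lift_mem X)]
  algebra

lemma pair_lower_of_vertical {u : GT (Fn EP P)} (hu : u ∈ L.sections) (hu0 : Q.push u.1 = 0)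
    (hV : ∀ v ∈ 𝒱.V, pair u v = 0) (X : VF (Fn EM M)) : pair (ℱ.lower X) u = 0 := by
  have h := ℱ.pair_lam_mem X hu
  rw [hu0, map_zero, map_zero, smul_zero, sub_eq_zero] at h
  rw [lower, pair_sub_left, pair_smul_left, ← h, pair_symm, hV _ (ℱ.lift_mem X), smul_zero,
    sub_zero]

/-- The metric has frames near every point. -/
def FrameExists (g : PseudoMetric (Fn EM M)) : Prop := ∀ x : M, ∃ (χ : Fn EM M)
  (e e' : Fin 10 → VF (Fn EM M)), χ x ≠ 0 ∧ g.IsFrame χ e e'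

lemma toForm_frame_apply {g : PseudoMetric (Fn EM M)} {χ : Fn EM M} {e e' : Fin 10 → VF (Fn EM M)}
    (h : g.IsFrame χ e e') {x : M} (hx : χ x ≠ 0) (i j : Fin 10) :
    g.toForm (e i) (e' j) x = if i = j then 1 else 0 := by
  have h1 : χ x * g.toForm (e i) (e' j) x = (if i = j then χ else 0 : Fn EM M) x :=
    congrArg (fun u : Fn EM M => u x) (h.1 i j)
  split_ifs at h1 ⊢
  · exact mul_left_cancel₀ hx (h1.trans (mul_one _).symm)
  · exact (mul_eq_zero.mp h1).resolve_left hx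

/-- The lifts of a frame of `TM` are independent in `V_+`. In particular `n - 1 ≠ 0`, so the Weyl
1-form has its intended meaning. -/
lemma le_rank (hg : FrameExists ℱ.g) (x : M) : 10 ≤ n := by
  obtain ⟨χ, e, e', hχ, he⟩ := hg x
  obtain ⟨χ', s, s', hχ', hs⟩ := 𝒱.hasRank x
  obtain ⟨p, rfl⟩ := Q.proj_surjective x
  have := hs.card_le hχ' (fun j => ℱ.lift (e j)) (fun j => ℱ.lift_mem _) fun w hw => by
    funext j
    have h := hw _ (ℱ.lift_mem (e' j))
    simp only [← ℱ.g_eq, Q.pull_apply, toForm_frame_apply he hχ] at h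
    simpa using h
  simpa using this

/-- A section of `V_-` is determined by its projection to `M`. -/
lemma eq_zero_of_orth (hg : FrameExists ℱ.g) (hM : Module.finrank ℝ EM = 10)
    (hE : HasRank Q L.sections (n + Module.finrank ℝ EM)) {u : GT (Fn EP P)}
    (hu : u ∈ L.sections) (hu0 : Q.push u.1 = 0) (hV : ∀ v ∈ 𝒱.V, pair u v = 0) : u = 0 := by
  refine hE.nondeg hu fun f hf => ?_
  ext p
  by_contra hne
  obtain ⟨χ, e, e', hχ, he⟩ := hg (Q.proj p)
  obtain ⟨χ₁, s, s', hχ₁, hs⟩ := 𝒱.hasRank (Q.proj p)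
  obtain ⟨χ₂, t, t', hχ₂, ht⟩ := hE (Q.proj p)
  have hdual : ∀ i j, pair (s i) (s' j) p = if i = j then 1 else 0 := fun i j => by
    have h1 : χ₁ (Q.proj p) * pair (s i) (s' j) p = (if i = j then Q.pull χ₁ else 0 : Fn EP P) p :=
      congrArg (fun u : Fn EP P => u p) (hs.2.1 i j)
    split_ifs at h1 ⊢
    · exact mul_left_cancel₀ hχ₁ (h1.trans (mul_one _).symm)
    · exact (mul_eq_zero.mp h1).resolve_left hχ₁
  have hlow : ∀ X, pair u (ℱ.lower X) = 0 := fun X => by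
    rw [pair_symm, ℱ.pair_lower_of_vertical hu hu0 hV]
  -- If `u` were nonzero at `p`, detected by `f`, then `u`, a frame of `V_+` and ten sections of
  -- `V_-` would be `n + 11` independent sections in a bundle of rank `n + 10`.
  have hcard := ht.card_le hχ₂ (k := Option (Fin n ⊕ Fin 10))
    (fun a => a.elim u (Sum.elim s fun j => ℱ.lower (e j))) (fun a => by
      rcases a with _ | a | j
      · exact hu
      · exact 𝒱.le (hs.1 a).1
      · exact ℱ.lower_mem _) fun w hw => by
    simp only [Fintype.sum_option, Fintype.sum_sum_type, Option.elim_none, Option.elim_some,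
      Sum.elim_inl, Sum.elim_inr] at hw
    have w1 : ∀ i, w (some (Sum.inl i)) = 0 := fun i => by
      have h := hw _ (𝒱.le (hs.1 i).2)
      simp only [hV _ (hs.1 i).2, ℱ.pair_lower_mem _ (hs.1 i).2, hdual] at h
      simpa using h
    have w2 : ∀ j, w (some (Sum.inr j)) = 0 := fun j => by
      have h := hw _ (ℱ.lower_mem (e' j))
      simp only [hlow, w1, ℱ.pair_lower_lower] at h
      have h' : ∑ x, w (some (Sum.inr x)) * (-ℱ.g.toForm (e x) (e' j) (Q.proj p)) = 0 := by
        simpa [Q.pull_apply] using h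
      simp only [toForm_frame_apply he hχ] at h'
      simpa using h'
    have w3 : w none = 0 := by
      have h := hw f hf
      simp only [w1, w2, zero_mul, Finset.sum_const_zero, add_zero] at h
      exact (mul_eq_zero.mp h).resolve_right hne
    funext a
    rcases a with _ | a | j
    · exact w3
    · exact w1 a
    · exact w2 j
  simp [hM] at hcard

end Fields
end GenMetric
end LiftedAction
end PrincipalBundle
end Heterotic

/-! ### The geometric data as an algebraic reduction. -/

namespace Heterotic

lemma lie_add_vf {A : Type*} [CommRing A] [Algebra ℝ A] (X Y Z : VF A) :
    ⁅X, Y + Z⁆ = ⁅X, Y⁆ + ⁅X, Z⁆ := lie_add X Y Z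

lemma lie_zero_vf {A : Type*} [CommRing A] [Algebra ℝ A] (X : VF A) : ⁅X, (0 : VF A)⁆ = 0 :=
  lie_zero X

namespace PrincipalBundle

variable {EG HG G EP P EM M : Type*}
  [NormedAddCommGroup EG] [NormedSpace ℝ EG] [TopologicalSpace HG] {IG : ModelWithCorners ℝ EG HG}
  [TopologicalSpace G] [ChartedSpace HG G] [Group G] [LieGroup IG ∞ G]
  [NormedAddCommGroup EP] [NormedSpace ℝ EP] [TopologicalSpace P] [ChartedSpace EP P]
  [IsManifold 𝓘(ℝ, EP) ∞ P]
  [NormedAddCommGroup EM] [NormedSpace ℝ EM] [TopologicalSpace M] [ChartedSpace EM M]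
  {Q : PrincipalBundle G EP P EM M IG} {c : LinearMap.BilinForm ℝ EG} {L : Q.LiftedAction c}
  {n : ℕ} {𝒱 : L.GenMetric n}

/-- The lifted action, extended to `𝔤`-valued functions. -/
noncomputable def LiftedAction.rhoLin (L : Q.LiftedAction c) :
    Fn EP P ⊗[ℝ] EG →ₗ[Fn EP P] GT (Fn EP P) :=
  (Q.fund.prod L.xi).liftBaseChange (Fn EP P)

/-- The vertical vector field of a `𝔤`-valued function. -/
noncomputable def fundLin (Q : PrincipalBundle G EP P EM M IG) :
    Fn EP P ⊗[ℝ] EG →ₗ[Fn EP P] VF (Fn EP P) := Q.fund.liftBaseChange (Fn EP P)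

lemma fundLin_tmul (a : Fn EP P) (z : EG) :
    Q.fundLin (a ⊗ₜ z) = a • Q.fund z := LinearMap.liftBaseChange_tmul _ _ _ _

lemma LiftedAction.rhoLin_tmul (a : Fn EP P) (z : EG) : L.rhoLin (a ⊗ₜ z) = a • L.rho z :=
  LinearMap.liftBaseChange_tmul _ _ _ _

lemma LiftedAction.rhoLin_fst (r : Fn EP P ⊗[ℝ] EG) : (L.rhoLin r).1 = Q.fundLin r := by
  induction r with
  | zero => simp
  | tmul a z => rw [LiftedAction.rhoLin_tmul, fundLin_tmul]; rfl
  | add x y hx hy => rw [map_add, map_add, Prod.fst_add, hx, hy]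

lemma LiftedAction.pair_rhoLin {e : GT (Fn EP P)} (he : e ∈ L.sections) (r : Fn EP P ⊗[ℝ] EG) :
    pair e (L.rhoLin r) = 0 := by
  induction r with
  | zero => rw [map_zero, pair_zero_right]
  | tmul a z => rw [LiftedAction.rhoLin_tmul, pair_smul_right', he.1, mul_zero]
  | add x y hx hy => rw [map_add, pair_add_right, hx, hy, add_zero]

lemma LiftedAction.pair_rhoLin_rhoLin (r t : Fn EP P ⊗[ℝ] EG) :
    pair (L.rhoLin r) (L.rhoLin t) = -L.cPair r t := by
  rw [LiftedAction.cPair]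
  induction r with
  | zero => simp [pair_zero_left]
  | add x y hx hy =>
    rw [map_add, pair_add_left, hx, hy, map_add, LinearMap.add_apply, neg_add]
  | tmul a z =>
    induction t with
    | zero => simp [pair_zero_right]
    | add x y hx hy => rw [map_add, pair_add_right, hx, hy, map_add, neg_add]
    | tmul b w =>
      rw [LiftedAction.rhoLin_tmul, LiftedAction.rhoLin_tmul, pair_smul_left', pair_smul_right',
        LinearMap.BilinForm.baseChange_tmul]
      have h := L.quadratic z w
      rw [LiftedAction.rho, LiftedAction.rho, h]
      simp only [map_neg, Algebra.algebraMap_eq_smul_one]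
      algebra

lemma Connection.form_fundLin (A : Q.Connection)
    (r : Fn EP P ⊗[ℝ] EG) : A.form (Q.fundLin r) = r := by
  induction r with
  | zero => simp
  | tmul a z => rw [fundLin_tmul, map_smul, A.form_fund, TensorProduct.smul_tmul', smul_eq_mul,
      mul_one]
  | add x y hx hy => rw [map_add, map_add, hx, hy]

lemma fundLin_pull (r : Fn EP P ⊗[ℝ] EG) (f : Fn EM M) :
    Q.fundLin r (Q.pull f) = 0 := by
  induction r with
  | zero => simp
  | tmul a z => rw [fundLin_tmul, Derivation.smul_apply, Q.fund_pull, smul_zero]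
  | add x y hx hy => rw [map_add, Derivation.add_apply, hx, hy, add_zero]

/-- Evaluation at a point of vector-valued functions. -/
noncomputable def evalTensor {U : Type*} [AddCommGroup U] [Module ℝ U] (p : P) :
    Fn EP P ⊗[ℝ] U →ₗ[ℝ] U :=
  TensorProduct.lift (LinearMap.mk₂ ℝ (fun (a : Fn EP P) (u : U) => a p • u)
    (fun a b u => add_smul (a p) (b p) u) (fun t a u => by
      change (t * a p) • u = t • a p • u
      rw [mul_smul])
    (fun a u v => smul_add _ _ _) (fun t a u => smul_comm _ _ _))

lemma evalTensor_tmul {U : Type*} [AddCommGroup U] [Module ℝ U] (p : P) (a : Fn EP P) (u : U) :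
    evalTensor p (a ⊗ₜ[ℝ] u) = a p • u := rfl

lemma evalTensor_smul {U : Type*} [AddCommGroup U] [Module ℝ U] (p : P) (a : Fn EP P)
    (r : Fn EP P ⊗[ℝ] U) : evalTensor p (a • r) = a p • evalTensor p r := by
  induction r with
  | zero => simp
  | tmul b u =>
    rw [TensorProduct.smul_tmul', evalTensor_tmul, evalTensor_tmul, smul_smul]
    rfl
  | add x y hx hy => rw [smul_add, map_add, hx, hy, map_add, smul_add]

namespace LiftedAction.GenMetric.Fields

/-- The algebraic data of the reduced Courant algebroid with its admissible metric. -/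
noncomputable def reduction (ℱ : 𝒱.Fields) (hg : FrameExists ℱ.g) (hM : Module.finrank ℝ EM = 10)
    (h𝒱 : 𝒱.Admissible) : Reduction (Fn EP P) (Fn EM M) where
  pull := Q.pull
  pull_injective := Q.pull_injective
  Hhat := L.Hhat
  closed := L.closed
  S := L.sections
  smul_mem f _ he := L.smul_mem_sections f he
  bracket_mem _ hu _ hv := L.dorfman_mem_sections hu hv
  proj e := Q.push e.1
  proj_spec _ he := L.section_related he
  pair_mem _ hu _ hv := Q.exists_pull_of_invariant _ fun a => L.rpull_pair hu hv a
  nondeg _ he h := h𝒱.2.nondeg he h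
  V := 𝒱.V
  V_le := 𝒱.le
  V_smul := 𝒱.smul_mem
  V_nondeg _ hv h := 𝒱.hasRank.nondeg hv h
  plus := 𝒱.plus
  plus_mem _ he := (plus_spec he).1
  plus_orth _ he := (plus_spec he).2
  g := ℱ.g
  lift := ℱ.lift
  lift_mem := ℱ.lift_mem
  proj_lift X := Q.push_eq (ℱ.lift_related X)
  lift_orth X v hv h0 := ℱ.lift_orth X v hv fun f => by
    rw [L.section_related (𝒱.le hv), h0, Derivation.zero_apply, map_zero]
  g_eq X Y := (ℱ.g_eq X Y).symm
  lam := ℱ.lam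
  lam_mem := ℱ.lam_mem
  lam_fst := ℱ.lam_fst
  lam_pair X _ he := ℱ.pair_lam_mem X he
  H := ℱ.H
  H_eq := ℱ.H_eq
  minus_eq_zero _ hu hu0 hV := ℱ.eq_zero_of_orth hg hM h𝒱.2 hu hu0 hV

variable (ℱ : 𝒱.Fields)

lemma hor_related (X : VF (Fn EM M)) : Q.Related (ℱ.hor X) X := by
  rw [hor, ℱ.lam_fst]
  exact ℱ.lift_related X

/-- Horizontal lifts commute with fundamental fields by infinitesimal invariance, so the bracket
differentiates only the coefficients. -/
lemma lie_hor_fundLin (X : VF (Fn EM M)) (r : Fn EP P ⊗[ℝ] EG) :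
    ⁅ℱ.hor X, Q.fundLin r⁆ = Q.fundLin (ℱ.covD X r) := by
  induction r with
  | zero => rw [covD, map_zero, map_zero, map_zero, lie_zero_vf]
  | tmul a z =>
    have h1 := congrArg Prod.fst ((ℱ.lam_mem X).2.2.2 z)
    have h2 : ⁅Q.fund z, ℱ.hor X⁆ = 0 := h1
    rw [fundLin_tmul, lie_smul_vf, ← lie_skew, h2, neg_zero, smul_zero, add_zero]
    exact (fundLin_tmul _ _).symm
  | add x y hx hy => rw [covD, map_add, map_add, lie_add_vf, hx, hy, map_add]; rfl

variable (Q) in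
/-- The vector fields tangent to the fibres are those tangent to the orbits. -/
def VerticalIsFund : Prop :=
  ∀ (W : VF (Fn EP P)) (p : P), Q.Vertical W → ∃ z, ∀ f, W f p = Q.fund z f p

variable [FiniteDimensional ℝ EP] [T2Space P] (hQ : VerticalIsFund Q)
include hQ

/-- At each point `W` has the value of some fundamental field `fund z`, and the connection form,
being local, recovers `z` from that value. -/
lemma eq_zero_of_vertical (A : Q.Connection) {W : VF (Fn EP P)} (hW : Q.Vertical W)
    (h0 : A.form W = 0) : W = 0 := by
  refine Derivation.ext fun f => ?_
  ext p
  obtain ⟨z, hz⟩ := hQ W p hW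
  have h1 := map_vf_eq_zero_of_vanish A.form p (evalTensor p).toAddMonoidHom (evalTensor_smul p)
    (W := W - Q.fund z) fun f => sub_eq_zero.mpr (hz f)
  have h2 : z = 0 := by
    rw [map_sub, h0, A.form_fund, zero_sub, map_neg, neg_eq_zero] at h1
    have h3 : evalTensor p ((1 : Fn EP P) ⊗ₜ[ℝ] z) = 0 := h1
    rw [evalTensor_tmul] at h3
    exact (one_smul ℝ z).symm.trans h3
  rw [hz, h2, map_zero]

lemma eq_hor_add_vert {Z : VF (Fn EP P)} {Y : VF (Fn EM M)} (h : Q.Related Z Y) :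
    Z - ℱ.hor Y = Q.fundLin (ℱ.conn.form Z) := by
  refine sub_eq_zero.mp (eq_zero_of_vertical hQ ℱ.conn (fun f => ?_) ?_)
  · rw [Derivation.sub_apply, Derivation.sub_apply, h, ℱ.hor_related, fundLin_pull]
    simp
  · rw [map_sub, map_sub, ℱ.conn.form_fundLin, hor, ℱ.conn_lam]
    simp

variable (hg : FrameExists ℱ.g) (hM : Module.finrank ℝ EM = 10) (h𝒱 : 𝒱.Admissible)

/-- Removing `λ` and `ρ` of the connection form leaves pure 1-forms, and two of these pair to zero.
Expanding, the cross terms vanish since `E` is orthogonal to `ρ`, and `ρ` carries `-c`, so `c`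
equals the pairing of the parts complementary to `λ`. -/
lemma cPair_form {e f : GT (Fn EP P)} (he : e ∈ L.sections) (hf : f ∈ L.sections) :
    L.cPair (ℱ.conn.form e.1) (ℱ.conn.form f.1) = (ℱ.reduction hg hM h𝒱).adPair e f := by
  have ha := L.sections.sub_mem he (ℱ.lam_mem (Q.push e.1))
  have hb := L.sections.sub_mem hf (ℱ.lam_mem (Q.push f.1))
  have h1 : (e - ℱ.lam (Q.push e.1) - L.rhoLin (ℱ.conn.form e.1)).1 = 0 := by
    rw [Prod.fst_sub, Prod.fst_sub, rhoLin_fst, ← ℱ.eq_hor_add_vert hQ (L.section_related he)]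
    exact sub_self _
  have h2 : (f - ℱ.lam (Q.push f.1) - L.rhoLin (ℱ.conn.form f.1)).1 = 0 := by
    rw [Prod.fst_sub, Prod.fst_sub, rhoLin_fst, ← ℱ.eq_hor_add_vert hQ (L.section_related hf)]
    exact sub_self _
  have h3 : pair (e - ℱ.lam (Q.push e.1) - L.rhoLin (ℱ.conn.form e.1))
      (f - ℱ.lam (Q.push f.1) - L.rhoLin (ℱ.conn.form f.1)) = 0 := by
    rw [pair, h1, h2, map_zero, map_zero, add_zero, smul_zero]
  rw [pair_sub_left, pair_sub_right, pair_sub_right (L.rhoLin _), pair_rhoLin ha,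
    pair_symm (L.rhoLin _) (f - _), pair_rhoLin hb, pair_rhoLin_rhoLin, pair_sub_left,
    pair_sub_right, pair_sub_right] at h3
  have h4 : pair (ℱ.lam (Q.push e.1)) (ℱ.lam (Q.push f.1)) = 0 :=
    (ℱ.reduction hg hM h𝒱).pair_lam_lam _ _
  rw [h4] at h3
  change _ = pair e f - pair e (ℱ.lam (Q.push f.1)) - pair (ℱ.lam (Q.push e.1)) f
  linear_combination -h3

lemma covD_form (X : VF (Fn EM M)) {e : GT (Fn EP P)} (he : e ∈ L.sections) :
    ℱ.covD X (ℱ.conn.form e.1)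
      = ℱ.conn.form (dorfman L.Hhat (ℱ.lam X) (e - ℱ.lam (Q.push e.1))).1 := by
  rw [dorfman_fst, Prod.fst_sub]
  change _ = ℱ.conn.form ⁅ℱ.hor X, e.1 - ℱ.hor _⁆
  rw [ℱ.eq_hor_add_vert hQ (L.section_related he), ℱ.lie_hor_fundLin, Connection.form_fundLin]

lemma dPrime_eq {e₁ e₂ e₃ : GT (Fn EP P)} (h₂ : e₂ ∈ L.sections) (h₃ : e₃ ∈ L.sections) :
    ℱ.dPrime e₁ e₂ e₃ = (ℱ.reduction hg hM h𝒱).dSplit (Q.push e₁.1) e₂ e₃ := by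
  rw [dPrime, ℱ.covD_form hQ _ h₂, ℱ.cPair_form hQ hg hM h𝒱 (L.dorfman_mem_sections (ℱ.lam_mem _)
    (L.sections.sub_mem h₂ (ℱ.lam_mem _))) h₃]
  rfl

lemma cPair_curvature (X Y : VF (Fn EM M)) {e : GT (Fn EP P)} (he : e ∈ L.sections) :
    L.cPair (ℱ.curvature X Y) (ℱ.conn.form e.1)
      = -(ℱ.reduction hg hM h𝒱).adPair (dorfman L.Hhat (ℱ.lam X) (ℱ.lam Y)) e := by
  rw [← ℱ.cPair_form hQ hg hM h𝒱 (L.dorfman_mem_sections (ℱ.lam_mem X) (ℱ.lam_mem Y)) he, cPair,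
    cPair, curvature, map_neg, LinearMap.neg_apply]
  rfl

lemma cs_eq {e₁ e₂ e₃ : GT (Fn EP P)} (h₁ : e₁ ∈ L.sections) (h₂ : e₂ ∈ L.sections)
    (h₃ : e₃ ∈ L.sections) : ℱ.cs e₁ e₂ e₃ = (ℱ.reduction hg hM h𝒱).csSplit e₁ e₂ e₃ := by
  have hv : ∀ {e}, e ∈ L.sections → ℱ.vert e.1 = (e - ℱ.lam (Q.push e.1)).1 := fun {e} he =>
    (ℱ.eq_hor_add_vert hQ (L.section_related he)).symm
  have hb := L.dorfman_mem_sections (L.sections.sub_mem h₂ (ℱ.lam_mem (Q.push e₂.1)))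
    (L.sections.sub_mem h₃ (ℱ.lam_mem (Q.push e₃.1)))
  have h4 := ℱ.cPair_form hQ hg hM h𝒱 h₁ hb
  rw [dorfman_fst] at h4
  rw [cs, hv h₂, hv h₃, h4, ℱ.cPair_curvature hQ hg hM h𝒱 _ _ h₁,
    ℱ.cPair_curvature hQ hg hM h𝒱 _ _ h₂, ℱ.cPair_curvature hQ hg hM h𝒱 _ _ h₃, Reduction.csSplit,
    sub_neg_eq_add, ← sub_eq_add_neg]
  rfl

lemma chi_eq (ϕ : Form1 (Fn EM M)) {e₁ e₂ e₃ : GT (Fn EP P)} (h₁ : e₁ ∈ L.sections)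
    (h₂ : e₂ ∈ L.sections) (h₃ : e₃ ∈ L.sections) :
    ℱ.chi ϕ e₁ e₂ e₃ = (ℱ.reduction hg hM h𝒱).chiSplit ϕ e₁ e₂ e₃ := by
  rw [chi, ℱ.cs_eq hQ hg hM h𝒱 h₁ h₂ h₃]
  rfl

lemma weylForm_eq (ϕ : Form1 (Fn EM M)) {e v u : GT (Fn EP P)} (he : e ∈ L.sections)
    (hv : v ∈ 𝒱.V) (hu : u ∈ L.sections) :
    ℱ.weylForm ϕ e v u = pair ((ℱ.reduction hg hM h𝒱).con ϕ e v) u := by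
  have hp : ∀ {e}, e ∈ L.sections → 𝒱.plus e ∈ L.sections := fun he => 𝒱.le (plus_spec he).1
  have hm : ∀ {e}, e ∈ L.sections → 𝒱.minus e ∈ L.sections := fun he =>
    L.sections.sub_mem he (hp he)
  have hvS := 𝒱.le hv
  rw [(ℱ.reduction hg hM h𝒱).pair_con ϕ he hv hu, weylForm, ℱ.dPrime_eq hQ hg hM h𝒱 hvS hu,
    ℱ.chi_eq hQ hg hM h𝒱 ϕ (hp he) (hp hvS) (hp hu),
    ℱ.chi_eq hQ hg hM h𝒱 ϕ (hm he) (hm hvS) (hm hu),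
    ℱ.chi_eq hQ hg hM h𝒱 ϕ (hm he) (hp hvS) (hp hu),
    ℱ.chi_eq hQ hg hM h𝒱 ϕ (hp he) (hm hvS) (hm hu)]
  rfl

/-- The explicit section `con` has the pairings that define `conD`, and nondegeneracy on `E` leaves
no other choice. -/
lemma conD_eq (ϕ : Form1 (Fn EM M)) {e v : GT (Fn EP P)} (he : e ∈ L.sections) (hv : v ∈ 𝒱.V) :
    ℱ.conD ϕ e v = (ℱ.reduction hg hM h𝒱).con ϕ e v := by
  have hmem : (ℱ.reduction hg hM h𝒱).con ϕ e v ∈ L.sections :=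
    𝒱.le ((ℱ.reduction hg hM h𝒱).con_mem ϕ he hv)
  have h := Classical.epsilon_spec (p := fun u => u ∈ L.sections ∧ ∀ e₃ ∈ L.sections,
    pair u e₃ = ℱ.weylForm ϕ e v e₃) ⟨_, hmem, fun u hu =>
      (ℱ.weylForm_eq hQ hg hM h𝒱 ϕ he hv hu).symm⟩
  exact (ℱ.reduction hg hM h𝒱).S_ext h.1 hmem fun u hu =>
    (h.2 u hu).trans (ℱ.weylForm_eq hQ hg hM h𝒱 ϕ he hv hu)

lemma GR_eq (ϕ : Form1 (Fn EM M)) {u v w : GT (Fn EP P)} (hu : u ∈ L.sections)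
    (hv : v ∈ L.sections) (hw : w ∈ 𝒱.V) :
    ℱ.GR ϕ u v w = (ℱ.reduction hg hM h𝒱).gCurv ϕ u v w := by
  have h1 := (ℱ.reduction hg hM h𝒱).con_mem ϕ hv hw
  have h2 := (ℱ.reduction hg hM h𝒱).con_mem ϕ hu hw
  have h3 : courant L.Hhat u v ∈ L.sections := L.sections.smul_mem _ (L.sections.sub_mem
    (L.dorfman_mem_sections hu hv) (L.dorfman_mem_sections hv hu))
  rw [GR, ℱ.conD_eq hQ hg hM h𝒱 ϕ hv hw, ℱ.conD_eq hQ hg hM h𝒱 ϕ hu hw,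
    ℱ.conD_eq hQ hg hM h𝒱 ϕ h3 hw]
  rw [ℱ.conD_eq hQ hg hM h𝒱 ϕ hu h1, ℱ.conD_eq hQ hg hM h𝒱 ϕ hv h2]
  rfl

end LiftedAction.GenMetric.Fields
end PrincipalBundle
end Heterotic

namespace Heterotic

/-! ## Vector-valued functions -/

section Coeff

variable {A U : Type*} [CommRing A] [Algebra ℝ A] [AddCommGroup U] [Module ℝ U]

/-- A linear functional applied to a vector-valued function. -/
noncomputable def coeff (l : U →ₗ[ℝ] ℝ) : A ⊗[ℝ] U →ₗ[A] A :=
  ((Algebra.linearMap ℝ A).comp l).liftBaseChange A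

lemma coeff_tmul (l : U →ₗ[ℝ] ℝ) (a : A) (u : U) :
    coeff l (a ⊗ₜ[ℝ] u) = a * algebraMap ℝ A (l u) :=
  LinearMap.liftBaseChange_tmul _ _ _ _

lemma lTensor_smulRight (l : U →ₗ[ℝ] ℝ) {U' : Type*} [AddCommGroup U'] [Module ℝ U'] (u : U')
    (t : A ⊗[ℝ] U) : (l.smulRight u).lTensor A t = coeff l t ⊗ₜ[ℝ] u := by
  induction t with
  | zero => simp
  | tmul a v =>
    rw [LinearMap.lTensor_tmul, coeff_tmul, LinearMap.smulRight_apply, ← TensorProduct.smul_tmul,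
      Algebra.smul_def, mul_comm]
  | add x y hx hy => rw [map_add, map_add, hx, hy, TensorProduct.add_tmul]

lemma lTensor_smul {U' : Type*} [AddCommGroup U'] [Module ℝ U'] (l : U →ₗ[ℝ] U') (a : A)
    (t : A ⊗[ℝ] U) : l.lTensor A (a • t) = a • l.lTensor A t := by
  induction t with
  | zero => simp
  | tmul b u => rfl
  | add x y hx hy => rw [smul_add, map_add, hx, hy, map_add, smul_add]

lemma derivation_coeff (l : U →ₗ[ℝ] ℝ) (X : VF A) (t : A ⊗[ℝ] U) :
    X (coeff l t) = coeff l ((X : A →ₗ[ℝ] A).rTensor U t) := by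
  induction t with
  | zero => simp
  | tmul a u =>
    rw [LinearMap.rTensor_tmul, coeff_tmul, coeff_tmul, Derivation.leibniz,
      Derivation.map_algebraMap, smul_zero, zero_add, smul_eq_mul, mul_comm]
    rfl
  | add x y hx hy => rw [map_add, map_add, map_add, map_add, hx, hy]

lemma rTensor_lTensor {U' : Type*} [AddCommGroup U'] [Module ℝ U'] (l : U →ₗ[ℝ] U')
    (D : A →ₗ[ℝ] A) (t : A ⊗[ℝ] U) :
    l.lTensor A (D.rTensor U t) = D.rTensor U' (l.lTensor A t) := by
  rw [← LinearMap.comp_apply, ← LinearMap.comp_apply, LinearMap.lTensor_comp_rTensor,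
    LinearMap.rTensor_comp_lTensor]

end Coeff

/-! ## The solder form -/

section Solder

variable {EK K ES S EP P EM M : Type*}
  [NormedAddCommGroup EK] [NormedSpace ℝ EK]
  [TopologicalSpace K] [ChartedSpace EK K] [Group K] [LieGroup 𝓘(ℝ, EK) ∞ K]
  [NormedAddCommGroup ES] [NormedSpace ℝ ES]
  [TopologicalSpace S] [ChartedSpace ES S] [Group S] [LieGroup 𝓘(ℝ, ES) ∞ S]
  [NormedAddCommGroup EP] [NormedSpace ℝ EP] [TopologicalSpace P] [ChartedSpace EP P]
  [IsManifold 𝓘(ℝ, EP) ∞ P]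
  [NormedAddCommGroup EM] [NormedSpace ℝ EM] [TopologicalSpace M] [ChartedSpace EM M]
  {ι : SLIso ES S} {Q : PrincipalBundle (K × S) EP P EM M (𝓘(ℝ, EK).prod 𝓘(ℝ, ES))}

namespace SLIso

variable (EK) in
/-- The matrix entries of the `𝔰𝔩(10,ℝ)`-component. -/
noncomputable def entry (ι : SLIso ES S) (i j : Fin 10) : EK × ES →ₗ[ℝ] ℝ :=
  LinearMap.proj j ∘ₗ LinearMap.proj i ∘ₗ ι.diff ∘ₗ LinearMap.snd ℝ EK ES

lemma entry_apply (i j : Fin 10) (z : EK × ES) : ι.entry EK i j z = ι.diff z.2 i j := rfl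

lemma diff_injective (ι : SLIso ES S) : Function.Injective ι.diff := by
  rw [← LinearMap.ker_eq_bot, LinearMap.ker_eq_bot']
  intro z hz
  obtain ⟨z', -, hu⟩ := ι.bijective 0 (by simp)
  have h1 : ∀ i j, dOne 𝓘(ℝ, ES) (fun s : S => (ι.toEquiv s).1 i j) z
      = (0 : Matrix (Fin 10) (Fin 10) ℝ) i j := fun i j => congrFun (congrFun hz i) j
  have h2 : ∀ i j, dOne 𝓘(ℝ, ES) (fun s : S => (ι.toEquiv s).1 i j) 0
      = (0 : Matrix (Fin 10) (Fin 10) ℝ) i j := fun i j =>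
    map_zero (mfderiv 𝓘(ℝ, ES) 𝓘(ℝ, ℝ) (fun s : S => (ι.toEquiv s).1 i j) 1)
  rw [hu z h1, hu 0 h2]

/-- Through a left inverse of `diff`, the projection to the second factor is a combination of the
matrix entries with constant coefficients. -/
lemma lTensor_snd_eq_zero {A : Type*} [CommRing A] [Algebra ℝ A] (ι : SLIso ES S)
    {t : A ⊗[ℝ] (EK × ES)} (h : ∀ i j, coeff (ι.entry EK i j) t = 0) :
    (LinearMap.snd ℝ EK ES).lTensor A t = 0 := by
  obtain ⟨r, hr⟩ := ι.diff.exists_leftInverse_of_injective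
    (LinearMap.ker_eq_bot.mpr ι.diff_injective)
  have hs : LinearMap.snd ℝ EK ES = ∑ i, ∑ j,
      (ι.entry EK i j).smulRight (r (Matrix.single i j 1)) := by
    refine LinearMap.ext fun z => ?_
    have h1 : r (ι.diff z.2) = z.2 := congrArg (fun l => l z.2) hr
    conv_lhs => rw [LinearMap.snd_apply, ← h1, Matrix.matrix_eq_sum_single (ι.diff z.2)]
    simp only [map_sum, LinearMap.sum_apply, LinearMap.smulRight_apply, entry_apply, ← map_smul,
      Matrix.smul_single, smul_eq_mul, mul_one]
  rw [hs, ← LinearMap.coe_lTensorHom, map_sum, LinearMap.sum_apply]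
  refine Finset.sum_eq_zero fun i _ => ?_
  rw [map_sum, LinearMap.sum_apply]
  refine Finset.sum_eq_zero fun j _ => ?_
  rw [LinearMap.coe_lTensorHom, lTensor_smulRight, h, TensorProduct.zero_tmul]

/-- The pairing on `𝔤`-valued functions in terms of matrix entries. -/
lemma pairing_baseChange {A : Type*} [CommRing A] [Algebra ℝ A] (ι : SLIso ES S) (α κ : ℝ)
    (trk : LinearMap.BilinForm ℝ EK) (r t : A ⊗[ℝ] (EK × ES)) :
    (ι.pairing α κ trk).baseChange A r t
      = (α * κ) • ∑ i, ∑ j, coeff (ι.entry EK i j) r * coeff (ι.entry EK j i) t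
        - α • trk.baseChange A ((LinearMap.fst ℝ EK ES).lTensor A r)
          ((LinearMap.fst ℝ EK ES).lTensor A t) := by
  induction r with
  | zero => simp
  | add x y hx hy =>
    simp only [map_add, LinearMap.add_apply, hx, hy, add_mul, Finset.sum_add_distrib, smul_add]
    ring
  | tmul a z =>
    induction t with
    | zero => simp
    | add x y hx hy =>
      simp only [map_add, hx, hy, mul_add, Finset.sum_add_distrib, smul_add]
      ring
    | tmul b w =>
      have h : ι.pairing α κ trk z w = α * κ * (∑ i, ∑ j, ι.entry EK i j z * ι.entry EK j i w)
          - α * trk z.1 w.1 := by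
        simp only [pairing, traceForm, LinearMap.smul_apply, LinearMap.sub_apply,
          LinearMap.compl₁₂_apply, LinearMap.compr₂_apply, LinearMap.mul_apply', smul_eq_mul,
          Matrix.traceLinearMap_apply, Matrix.trace, Matrix.diag, Matrix.mul_apply, entry_apply,
          LinearMap.snd_apply, LinearMap.fst_apply]
        ring
      simp only [LinearMap.lTensor_tmul, LinearMap.BilinForm.baseChange_tmul, h, coeff_tmul,
        LinearMap.fst_apply]
      have h2 : ∀ i j, a * algebraMap ℝ A (ι.entry EK i j z)
          * (b * algebraMap ℝ A (ι.entry EK j i w))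
          = (ι.entry EK i j z * ι.entry EK j i w) • (b * a) := fun i j => by
        rw [Algebra.smul_def, map_mul]; ring
      simp only [h2, ← Finset.sum_smul]
      algebra

end SLIso

namespace SolderForm

variable (θ : SolderForm ι Q)

/-- On an invariant field the solder form transforms by `a⁻¹` along an orbit, so multiplying its
coordinates by the matrix of `a` gives a constant. -/
lemma mul_entry_theta {Z : VF (Fn EP P)} (hZ : ∀ a, Q.rpullVF a Z = Z) (k : Fin 10) (p : P)
    (a : K × S) : ∑ i, (ι.toEquiv a.2).1 k i * θ.theta i Z (Q.act p a) = θ.theta k Z p := by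
  have h : ∀ i, θ.theta i Z (Q.act p a) = ∑ j, (ι.toEquiv a.2⁻¹).1 i j * θ.theta j Z p :=
    fun i => by
      have h1 := congrArg (fun u : Fn EP P => u p) (θ.equivariant a i Z)
      simp only [hZ] at h1
      refine h1.trans ?_
      exact fn_sum_apply _ _ _
  have hinv : (ι.toEquiv a.2).1 * (ι.toEquiv a.2⁻¹).1 = 1 := by
    rw [← Matrix.SpecialLinearGroup.coe_mul, ← map_mul, mul_inv_cancel, map_one]
    rfl
  simp only [h, Finset.mul_sum]
  rw [Finset.sum_comm]
  simp only [← mul_assoc, ← Finset.sum_mul, ← Matrix.mul_apply, hinv]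
  simp [Matrix.one_apply]

lemma mdifferentiableAt_entry (k i : Fin 10) :
    MDifferentiableAt 𝓘(ℝ, ES) 𝓘(ℝ, ℝ) (fun s : S => (ι.toEquiv s).1 k i) 1 :=
  (ι.smooth k i).mdifferentiable (by simp) 1

lemma dOne_entry (k i : Fin 10) (z : EK × ES) :
    dOne (𝓘(ℝ, EK).prod 𝓘(ℝ, ES)) (fun a : K × S => (ι.toEquiv a.2).1 k i) z = ι.diff z.2 k i := by
  have h1 : HasMFDerivAt (𝓘(ℝ, EK).prod 𝓘(ℝ, ES)) 𝓘(ℝ, ES) (Prod.snd : K × S → S) 1 _ :=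
    hasMFDerivAt_snd 1
  have h2 := ((mdifferentiableAt_entry (ι := ι) k i).hasMFDerivAt.comp (1 : K × S) h1).mfderiv
  exact congrArg (fun l : EK × ES →L[ℝ] ℝ => l z) h2

/-- The derivative at `a = 1` of the constant in `mul_entry_theta`; the sign is that of moving the
matrix derivative to the other side. -/
lemma fund_theta {Z : VF (Fn EP P)} (hZ : ∀ a, Q.rpullVF a Z = Z) (k : Fin 10) (z : EK × ES) :
    Q.fund z (θ.theta k Z) = -∑ i, algebraMap ℝ (Fn EP P) (ι.entry EK k i z) * θ.theta i Z := by
  ext p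
  have hent : ∀ i, MDifferentiableAt (𝓘(ℝ, EK).prod 𝓘(ℝ, ES)) 𝓘(ℝ, ℝ)
      (fun a : K × S => (ι.toEquiv a.2).1 k i) 1 := fun i =>
    (mdifferentiableAt_entry (ι := ι) k i).comp (1 : K × S) mdifferentiableAt_snd
  have hd : ∀ i, HasMFDerivAt (𝓘(ℝ, EK).prod 𝓘(ℝ, ES)) 𝓘(ℝ, ℝ)
      ((fun a : K × S => (ι.toEquiv a.2).1 k i) * fun a => θ.theta i Z (Q.act p a)) 1 _ := fun i =>
    (hent i).hasMFDerivAt.mul (Q.orbit_mdiff (θ.theta i Z) p).hasMFDerivAt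
  have hsum := (HasMFDerivAt.sum (t := Finset.univ) fun i _ => hd i).mfderiv
  have hconst : (∑ i, ((fun a : K × S => (ι.toEquiv a.2).1 k i) *
      fun a => θ.theta i Z (Q.act p a))) = fun _ => θ.theta k Z p := by
    funext a
    rw [Finset.sum_apply]
    exact θ.mul_entry_theta hZ k p a
  rw [hconst, mfderiv_const] at hsum
  have h1 := congrArg (fun l : EK × ES →L[ℝ] ℝ => l z) hsum
  have h2 : (0 : ℝ) = ∑ i, ((ι.toEquiv (1 : S)).1 k i * Q.fund z (θ.theta i Z) p
      + θ.theta i Z (Q.act p 1) * ι.diff z.2 k i) := by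
    refine h1.trans ?_
    refine (map_sum (AddMonoidHom.mk' (fun l : EK × ES →L[ℝ] ℝ => l z) fun _ _ => rfl) _
      Finset.univ).trans (Finset.sum_congr rfl fun i _ => ?_)
    rw [← dOne_entry (K := K)]
    rfl
  rw [Q.act_one, map_one, Finset.sum_add_distrib] at h2
  simp only [Matrix.SpecialLinearGroup.coe_one, Matrix.one_apply, ite_mul, one_mul, zero_mul,
    Finset.sum_ite_eq, Finset.mem_univ, if_true] at h2
  have h3 : (-∑ i, algebraMap ℝ (Fn EP P) (ι.entry EK k i z) * θ.theta i Z) p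
      = -∑ i, ι.diff z.2 k i * θ.theta i Z p := congrArg Neg.neg (fn_sum_apply _ _ _)
  rw [h3]
  simp only [mul_comm (ι.diff z.2 k _)]
  linarith

lemma fundLin_theta {Z : VF (Fn EP P)} (hZ : ∀ a, Q.rpullVF a Z = Z) (k : Fin 10)
    (r : Fn EP P ⊗[ℝ] (EK × ES)) :
    Q.fundLin r (θ.theta k Z) = -∑ i, coeff (ι.entry EK k i) r * θ.theta i Z := by
  induction r with
  | zero => simp
  | tmul a z =>
    rw [PrincipalBundle.fundLin_tmul, Derivation.smul_apply, θ.fund_theta hZ, smul_neg,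
      Finset.smul_sum]
    simp only [coeff_tmul, smul_eq_mul, mul_assoc]
  | add x y hx hy =>
    simp only [map_add, Derivation.add_apply, hx, hy, add_mul, Finset.sum_add_distrib, neg_add]

end SolderForm

namespace PrincipalBundle.LiftedAction.GenMetric.Fields

variable {c : LinearMap.BilinForm ℝ (EK × ES)} {L : Q.LiftedAction c} {n : ℕ} {𝒱 : L.GenMetric n}
  (ℱ : 𝒱.Fields) (θ : SolderForm ι Q)

lemma hor_invariant (X : VF (Fn EM M)) (a : K × S) : Q.rpullVF a (ℱ.hor X) = ℱ.hor X :=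
  (ℱ.lam_mem X).2.1 a

lemma apply_eq_zero_of_theta {X : VF (Fn EM M)} {p : P}
    (h : ∀ i, θ.theta i (ℱ.hor X) p = 0) (f : Fn EM M) : X f (Q.proj p) = 0 := by
  obtain ⟨z, hz⟩ := θ.kernel p (ℱ.hor X) h
  have h1 := hz (Q.pull f)
  rw [ℱ.hor_related, Q.fund_pull] at h1
  exact h1

lemma eq_zero_of_theta {X : VF (Fn EM M)} (h : ∀ i, θ.theta i (ℱ.hor X) = 0) : X = 0 := by
  refine Derivation.ext fun f => ?_
  ext x
  obtain ⟨p, rfl⟩ := Q.proj_surjective x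
  exact ℱ.apply_eq_zero_of_theta θ (fun i => by rw [h]; rfl) f

/-- The matrix of a frame of `TM` in the frame `p`. -/
noncomputable def frameMatrix (e : Fin 10 → VF (Fn EM M)) (p : P) : Matrix (Fin 10) (Fin 10) ℝ :=
  Matrix.of fun i l => θ.theta i (ℱ.hor (e l)) p

variable (hg : FrameExists ℱ.g) (hM : Module.finrank ℝ EM = 10) (h𝒱 : 𝒱.Admissible)
include hg hM h𝒱

lemma hor_add (X Y : VF (Fn EM M)) : ℱ.hor (X + Y) = ℱ.hor X + ℱ.hor Y :=
  congrArg Prod.fst ((ℱ.reduction hg hM h𝒱).lam_add X Y)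

lemma hor_smul (f : Fn EM M) (X : VF (Fn EM M)) : ℱ.hor (f • X) = Q.pull f • ℱ.hor X :=
  congrArg Prod.fst ((ℱ.reduction hg hM h𝒱).lam_smul f X)

/-- The horizontal lift as an additive map. -/
noncomputable def horHom : VF (Fn EM M) →+ VF (Fn EP P) :=
  AddMonoidHom.mk' ℱ.hor (ℱ.hor_add hg hM h𝒱)

lemma hor_sub (X Y : VF (Fn EM M)) : ℱ.hor (X - Y) = ℱ.hor X - ℱ.hor Y :=
  map_sub (ℱ.horHom hg hM h𝒱) X Y

lemma hor_neg (X : VF (Fn EM M)) : ℱ.hor (-X) = -ℱ.hor X := map_neg (ℱ.horHom hg hM h𝒱) X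

lemma hor_sum {k : Type*} (t : Finset k) (X : k → VF (Fn EM M)) :
    ℱ.hor (∑ i ∈ t, X i) = ∑ i ∈ t, ℱ.hor (X i) := map_sum (ℱ.horHom hg hM h𝒱) X t

lemma frame_expand {χ : Fn EM M} {e e' : Fin 10 → VF (Fn EM M)} (he : ℱ.g.IsFrame χ e e') {p : P}
    (hp : χ (Q.proj p) ≠ 0) (η : Form1 (Fn EP P)) (X : VF (Fn EM M)) :
    η (ℱ.hor X) p = ∑ l, η (ℱ.hor (e l)) p * ℱ.g.toForm X (e' l) (Q.proj p) := by
  have h1 := congrArg (fun Z => η (ℱ.hor Z) p) (he.2 X)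
  simp only [ℱ.hor_smul hg hM h𝒱, ℱ.hor_sum hg hM h𝒱, map_smul, map_sum] at h1
  have h3 : χ (Q.proj p) * η (ℱ.hor X) p = χ (Q.proj p) *
      (∑ i, Q.pull (ℱ.g.toForm X (e' i)) * η (ℱ.hor (e i)) : Fn EP P) p := h1
  rw [mul_right_inj' hp, fn_sum_apply] at h3
  rw [h3]
  exact Finset.sum_congr rfl fun i _ => mul_comm _ _

variable [FiniteDimensional ℝ EM] [IsManifold 𝓘(ℝ, EM) ∞ M] [T2Space M]
  {χ : Fn EM M} {e e' : Fin 10 → VF (Fn EM M)}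

omit hM h𝒱 hg in
-- The values at `x` of a local frame are independent, because the 1-forms `g(·, e'_m)` depend only
-- on the value of a field at `x`.
lemma coords_eq_zero (he : ℱ.g.IsFrame χ e e') {x : M} (hx : χ x ≠ 0) {v : Fin 10 → ℝ}
    (h : ∀ f, ∑ l, v l * e l f x = 0) : v = 0 := by
  funext m
  have h1 := form1_eq_zero_of_vanish (ℱ.g.toForm.flip (e' m)) x (W := ∑ l, v l • e l) fun f => by
    rw [vf_sum_apply, fn_sum_apply]
    exact h f
  rw [map_sum, fn_sum_apply] at h1
  have h2 : ∀ l, ℱ.g.toForm.flip (e' m) (v l • e l) x = v l * (if l = m then 1 else 0) := fun l => by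
    rw [← toForm_frame_apply he hx, LinearMap.map_smul_of_tower]
    rfl
  rw [Finset.sum_congr rfl fun l _ => h2 l] at h1
  simpa using h1

/-- A vector in the kernel gives a combination of horizontal lifts that the solder form annihilates
at `p`. It is vertical there, so the combination of the `e l` vanishes on `M`, and with it the
coefficients. -/
lemma frameMatrix_isUnit (he : ℱ.g.IsFrame χ e e') {p : P} (hp : χ (Q.proj p) ≠ 0) :
    IsUnit (ℱ.frameMatrix θ e p) := by
  rw [← Matrix.mulVec_injective_iff_isUnit]
  refine (injective_iff_map_eq_zero (Matrix.mulVecLin _)).mpr fun v hv => ?_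
  have h1 : ∀ i, θ.theta i (ℱ.hor (∑ l, v l • e l)) p = 0 := fun i => by
    have h2 : θ.theta i (ℱ.hor (∑ l, v l • e l)) = ∑ l, v l • θ.theta i (ℱ.hor (e l)) := by
      rw [ℱ.hor_sum hg hM h𝒱, map_sum]
      refine Finset.sum_congr rfl fun l _ => ?_
      have h3 := ℱ.hor_smul hg hM h𝒱 (algebraMap ℝ _ (v l)) (e l)
      rw [algebraMap_smul, AlgHom.commutes, algebraMap_smul] at h3
      rw [h3, LinearMap.map_smul_of_tower]
    rw [h2, fn_sum_apply]
    refine Eq.trans ?_ (congrFun hv i)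
    exact Finset.sum_congr rfl fun l _ => mul_comm _ _
  refine ℱ.coords_eq_zero he hp fun f => ?_
  have h2 := ℱ.apply_eq_zero_of_theta θ h1 f
  rw [vf_sum_apply, fn_sum_apply] at h2
  exact h2

end PrincipalBundle.LiftedAction.GenMetric.Fields
end Solder
end Heterotic

/-! ### Curvature and field equation of `∇^T` through the solder form. -/

namespace Heterotic
namespace PrincipalBundle.LiftedAction.GenMetric.Fields

variable {EK K ES S EP P EM M : Type*}
  [NormedAddCommGroup EK] [NormedSpace ℝ EK]
  [TopologicalSpace K] [ChartedSpace EK K] [Group K] [LieGroup 𝓘(ℝ, EK) ∞ K]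
  [NormedAddCommGroup ES] [NormedSpace ℝ ES]
  [TopologicalSpace S] [ChartedSpace ES S] [Group S] [LieGroup 𝓘(ℝ, ES) ∞ S]
  [NormedAddCommGroup EP] [NormedSpace ℝ EP] [TopologicalSpace P] [ChartedSpace EP P]
  [IsManifold 𝓘(ℝ, EP) ∞ P]
  [NormedAddCommGroup EM] [NormedSpace ℝ EM] [TopologicalSpace M] [ChartedSpace EM M]
  {ι : SLIso ES S} {Q : PrincipalBundle (K × S) EP P EM M (𝓘(ℝ, EK).prod 𝓘(ℝ, ES))}
  {c : LinearMap.BilinForm ℝ (EK × ES)} {L : Q.LiftedAction c} {n : ℕ} {𝒱 : L.GenMetric n}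
  (ℱ : 𝒱.Fields) (θ : SolderForm ι Q) (hg : FrameExists ℱ.g) (hM : Module.finrank ℝ EM = 10)
  (h𝒱 : 𝒱.Admissible) [FiniteDimensional ℝ EM] [IsManifold 𝓘(ℝ, EM) ∞ M] [T2Space M]
  {χ : Fn EM M} {e e' : Fin 10 → VF (Fn EM M)}

section
include hg hM h𝒱

/-- The vector fields tangent to the fibres are those tangent to the orbits. -/
lemma verticalIsFund (θ : SolderForm ι Q) : VerticalIsFund Q := by
  intro W p hW
  obtain ⟨χ, e, e', hp, he⟩ := hg (Q.proj p)
  -- `v` gives the horizontal combination with the solder coordinates of `W` at `p`. The difference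
  -- is a fundamental field at `p`, and since `W` is vertical, projecting to `M` forces `v = 0`.
  obtain ⟨v, hv⟩ := Matrix.mulVec_surjective_iff_isUnit.mpr
    (ℱ.frameMatrix_isUnit θ hg hM h𝒱 he hp) fun i => θ.theta i W p
  obtain ⟨z, hz⟩ := θ.kernel p (W - ∑ l, v l • ℱ.hor (e l)) fun i => by
    rw [map_sub, map_sum]
    have h1 : θ.theta i W p = ∑ l, θ.theta i (ℱ.hor (e l)) p * v l := (congrFun hv i).symm
    change θ.theta i W p - (∑ l, θ.theta i (v l • ℱ.hor (e l))) p = 0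
    rw [fn_sum_apply, h1, sub_eq_zero]
    refine Finset.sum_congr rfl fun l _ => ?_
    rw [LinearMap.map_smul_of_tower]
    exact mul_comm _ _
  have key : ∀ f, W f p - ∑ l, v l * ℱ.hor (e l) f p = Q.fund z f p := fun f => by
    rw [← hz f, Derivation.sub_apply, vf_sum_apply]
    change _ = W f p - (∑ l, (v l • ℱ.hor (e l)) f) p
    rw [fn_sum_apply]
    rfl
  have hv0 : v = 0 := ℱ.coords_eq_zero he hp fun f => by
    have h1 := key (Q.pull f)
    rw [hW, Q.fund_pull] at h1
    simp only [ℱ.hor_related (e _) f] at h1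
    have h2 : (0 : ℝ) - ∑ l, v l * e l f (Q.proj p) = 0 := h1
    linarith
  refine ⟨z, fun f => ?_⟩
  rw [← key f, hv0]
  simp

variable [FiniteDimensional ℝ EP] [T2Space P]
  {nablaT : VF (Fn EM M) → VF (Fn EM M) → VF (Fn EM M)} (hT : ℱ.Induces θ nablaT)
include hT

/-- In solder coordinates `∇^T` is differentiation along horizontal lifts, so its curvature is the
derivative along the vertical part of their bracket. That part is the fundamental field of `-F`, and
fundamental fields act on solder coordinates by minus their matrix. -/
lemma theta_curv (X Y U : VF (Fn EM M)) (i : Fin 10) : θ.theta i (ℱ.hor (curv nablaT X Y U))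
    = ∑ k, coeff (ι.entry EK i k) (ℱ.curvature X Y) * θ.theta k (ℱ.hor U) := by
  have hQ := ℱ.verticalIsFund hg hM h𝒱 θ
  have hrel : Q.Related ⁅ℱ.hor X, ℱ.hor Y⁆ ⁅X, Y⁆ := fun f => by
    rw [Derivation.commutator_apply, Derivation.commutator_apply, ℱ.hor_related, ℱ.hor_related,
      ℱ.hor_related, ℱ.hor_related, map_sub]
  have h1 := congrArg (fun Z : VF (Fn EP P) => Z (θ.theta i (ℱ.hor U))) (ℱ.eq_hor_add_vert hQ hrel)
  simp only [Derivation.sub_apply, Derivation.commutator_apply] at h1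
  rw [curv, ℱ.hor_sub hg hM h𝒱, ℱ.hor_sub hg hM h𝒱, map_sub, map_sub, hT, hT, hT, hT, hT, h1,
    θ.fundLin_theta (ℱ.hor_invariant U), curvature, ← Finset.sum_neg_distrib]
  simp only [map_neg, neg_mul]

/-- The trace form of the curvature of `∇^T` in terms of the curvature of the connection on `P`. -/
lemma trR_eq (he : ℱ.g.IsFrame χ e e') {p : P} (hp : χ (Q.proj p) ≠ 0) (X Y Z W : VF (Fn EM M)) :
    ℱ.trR e e' nablaT X Y Z W (Q.proj p)
      = (∑ i, ∑ j, coeff (ι.entry EK i j) (ℱ.curvature X Y)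
        * coeff (ι.entry EK j i) (ℱ.curvature Z W)) p := by
  let Θ := ℱ.frameMatrix θ e p
  let N : VF (Fn EM M) → VF (Fn EM M) → Matrix (Fin 10) (Fin 10) ℝ := fun X Y =>
    Matrix.of fun i j => coeff (ι.entry EK i j) (ℱ.curvature X Y) p
  let C : Matrix (Fin 10) (Fin 10) ℝ := Matrix.of fun m l =>
    ℱ.g.toForm (curv nablaT X Y (curv nablaT Z W (e l))) (e' m) (Q.proj p)
  have hcurv : ∀ X Y U i, θ.theta i (ℱ.hor (curv nablaT X Y U)) p
      = ∑ k, N X Y i k * θ.theta k (ℱ.hor U) p := fun X Y U i => by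
    rw [ℱ.theta_curv θ hg hM h𝒱 hT, fn_sum_apply]
    rfl
  -- `Θ` is the change of basis from the frame `e` to the frame `p`, in which the curvatures act by
  -- the matrices `N`. The trace is unchanged by conjugation.
  have hC : Θ * C = N X Y * (N Z W * Θ) := by
    ext i l
    rw [Matrix.mul_apply, Matrix.mul_apply]
    refine (ℱ.frame_expand hg hM h𝒱 he hp (θ.theta i) _).symm.trans ?_
    rw [hcurv]
    refine Finset.sum_congr rfl fun k _ => ?_
    rw [hcurv, Matrix.mul_apply]
    rfl
  have hu : IsUnit Θ.det := (Matrix.isUnit_iff_isUnit_det _).mp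
    (ℱ.frameMatrix_isUnit θ hg hM h𝒱 he hp)
  have htr : C.trace = (N X Y * N Z W).trace := by
    have h1 : C = Θ⁻¹ * (N X Y * (N Z W * Θ)) := by
      rw [← hC, ← Matrix.mul_assoc, Matrix.nonsing_inv_mul _ hu, Matrix.one_mul]
    rw [h1, Matrix.trace_mul_comm, Matrix.mul_assoc, Matrix.mul_assoc, Matrix.mul_nonsing_inv _ hu,
      Matrix.mul_one]
  have h1 : ℱ.trR e e' nablaT X Y Z W (Q.proj p) = C.trace := by
    rw [trR, PseudoMetric.tr, fn_sum_apply]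
    rfl
  rw [h1, htr, fn_sum_apply]
  refine Finset.sum_congr rfl fun i _ => ?_
  rw [fn_sum_apply]
  exact Matrix.mul_apply

end

/-- `d^*(wF)(Y) + ½ w *(F ∧ *H)(Y)` for the curvature `F` of the connection on `P`. -/
noncomputable def fieldTensor (e e' : Fin 10 → VF (Fn EM M)) (w : Fn EM M) (Y : VF (Fn EM M)) :
    Fn EP P ⊗[ℝ] (EK × ES) :=
  -∑ j, (ℱ.covD (e j) (Q.pull w • ℱ.curvature (e' j) Y)
    - Q.pull w • ℱ.curvature (ℱ.g.nabla (e j) (e' j)) Y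
    - Q.pull w • ℱ.curvature (e' j) (ℱ.g.nabla (e j) Y))
  + Q.pull ((1 / 2 : ℝ) • w) • -∑ j, ∑ k, Q.pull (ℱ.H ![e' j, Y, e k]) • ℱ.curvature (e j) (e' k)

lemma lTensor_fst_fieldTensor (e e' : Fin 10 → VF (Fn EM M)) (w : Fn EM M) (Y : VF (Fn EM M)) :
    (LinearMap.fst ℝ EK ES).lTensor (Fn EP P) (ℱ.fieldTensor e e' w Y)
      = ℱ.dstarF e e' w Y + Q.pull ((1 / 2 : ℝ) • w) • ℱ.starF e e' Y := by
  simp only [fieldTensor, dstarF, starF, FA, map_add, map_neg, map_sum, map_sub, lTensor_smul, covD,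
    rTensor_lTensor]

section
include hg hM h𝒱
variable [FiniteDimensional ℝ EP] [T2Space P]
  {nablaT : VF (Fn EM M) → VF (Fn EM M) → VF (Fn EM M)} (hT : ℱ.Induces θ nablaT)
include hT

/-- Besides the coefficients, the horizontal derivative also hits the coordinates of `U`; this term
cancels against the one in `dstarR` where the curvature acts on `∇^T U`. -/
lemma theta_fieldTensor (e e' : Fin 10 → VF (Fn EM M)) (w : Fn EM M) (Y U : VF (Fn EM M))
    (i : Fin 10) : θ.theta i (ℱ.hor (ℱ.dstarR e e' nablaT w Y U
      + ((1 / 2 : ℝ) • w) • ℱ.starR e e' nablaT Y U))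
    = ∑ k, coeff (ι.entry EK i k) (ℱ.fieldTensor e e' w Y) * θ.theta k (ℱ.hor U) := by
  let Φ : Fn EP P ⊗[ℝ] (EK × ES) →ₗ[Fn EP P] Fn EP P :=
    ∑ k, θ.theta k (ℱ.hor U) • coeff (ι.entry EK i k)
  have hΦ : ∀ t, Φ t = ∑ k, coeff (ι.entry EK i k) t * θ.theta k (ℱ.hor U) := fun t => by
    simp only [Φ, LinearMap.sum_apply, LinearMap.smul_apply, smul_eq_mul, mul_comm]
  have hc : ∀ X Z, θ.theta i (ℱ.hor (curv nablaT X Z U)) = Φ (ℱ.curvature X Z) := fun X Z => by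
    rw [ℱ.theta_curv θ hg hM h𝒱 hT, hΦ]
  have hw : ∀ j, θ.theta i (ℱ.hor (nablaT (e j) (w • curv nablaT (e' j) Y U)))
      = Φ (ℱ.covD (e j) (Q.pull w • ℱ.curvature (e' j) Y))
        + Q.pull w * θ.theta i (ℱ.hor (curv nablaT (e' j) Y (nablaT (e j) U))) := fun j => by
    rw [hT, ℱ.hor_smul hg hM h𝒱, map_smul, ℱ.theta_curv θ hg hM h𝒱 hT,
      ℱ.theta_curv θ hg hM h𝒱 hT, hΦ, Finset.smul_sum, map_sum, Finset.mul_sum,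
      ← Finset.sum_add_distrib]
    refine Finset.sum_congr rfl fun k _ => ?_
    rw [hT, smul_eq_mul, ← mul_assoc, Derivation.leibniz, covD, ← derivation_coeff, map_smul,
      smul_eq_mul, smul_eq_mul, smul_eq_mul]
    ring
  rw [← hΦ]
  simp only [dstarR, starR, ℱ.hor_add hg hM h𝒱, ℱ.hor_smul hg hM h𝒱, ℱ.hor_neg hg hM h𝒱,
    ℱ.hor_sum hg hM h𝒱, ℱ.hor_sub hg hM h𝒱, map_add, map_smul, map_neg, map_sum, map_sub, hw,
    hc, fieldTensor, smul_eq_mul]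
  congr 2
  refine Finset.sum_congr rfl fun j _ => ?_
  ring

/-- The field equation of the connection on `P` is the pair of the field equations of `A` and of
`∇^T`. -/
lemma smul_fieldTensor_eq_zero_iff (he : ℱ.g.IsFrame χ e e') (w : Fn EM M) (Y : VF (Fn EM M)) :
    Q.pull χ • ℱ.fieldTensor e e' w Y = 0 ↔
      Q.pull χ • (ℱ.dstarF e e' w Y + Q.pull ((1 / 2 : ℝ) • w) • ℱ.starF e e' Y) = 0 ∧
      ∀ U, χ • (ℱ.dstarR e e' nablaT w Y U + ((1 / 2 : ℝ) • w) • ℱ.starR e e' nablaT Y U) = 0 := by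
  have hθ : ∀ U i, θ.theta i (ℱ.hor (χ • (ℱ.dstarR e e' nablaT w Y U
      + ((1 / 2 : ℝ) • w) • ℱ.starR e e' nablaT Y U)))
      = ∑ k, coeff (ι.entry EK i k) (Q.pull χ • ℱ.fieldTensor e e' w Y) * θ.theta k (ℱ.hor U) :=
    fun U i => by
      rw [ℱ.hor_smul hg hM h𝒱, map_smul, ℱ.theta_fieldTensor θ hg hM h𝒱 hT, Finset.smul_sum]
      simp only [map_smul, smul_eq_mul, mul_assoc]
  constructor
  · intro h
    refine ⟨by rw [← lTensor_fst_fieldTensor, ← lTensor_smul, h, map_zero], fun U => ?_⟩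
    refine ℱ.eq_zero_of_theta θ fun i => ?_
    rw [hθ, h]
    simp
  · rintro ⟨h1, h2⟩
    have h3 : (LinearMap.snd ℝ EK ES).lTensor (Fn EP P) (Q.pull χ • ℱ.fieldTensor e e' w Y) = 0 := by
      refine ι.lTensor_snd_eq_zero fun i j => ?_
      ext p
      by_cases hp : χ (Q.proj p) = 0
      · rw [map_smul]
        change χ (Q.proj p) * _ = 0
        rw [hp, zero_mul]
      -- The equation tested on `U = e l` says that the `i`-th row of the matrix of the tensor is
      -- annihilated by the invertible frame matrix.
      have h4 : Matrix.vecMul (fun k => coeff (ι.entry EK i k)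
          (Q.pull χ • ℱ.fieldTensor e e' w Y) p) (ℱ.frameMatrix θ e p) = 0 := by
        funext l
        have h5 := congrArg (fun u : Fn EP P => u p) (hθ (e l) i)
        have h6 : ℱ.hor 0 = 0 := map_zero (ℱ.horHom hg hM h𝒱)
        simp only [h2, h6, map_zero] at h5
        rw [fn_sum_apply] at h5
        exact h5.symm
      have h7 := Matrix.vecMul_injective_iff_isUnit.mpr (ℱ.frameMatrix_isUnit θ hg hM h𝒱 he hp)
      exact congrFun (h7 (h4.trans (Matrix.zero_vecMul _).symm)) j
    rw [← lTensor_fst_fieldTensor, ← lTensor_smul] at h1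
    have hid : (LinearMap.inl ℝ EK ES ∘ₗ LinearMap.fst ℝ EK ES
        + LinearMap.inr ℝ EK ES ∘ₗ LinearMap.snd ℝ EK ES) = LinearMap.id := by
      refine LinearMap.ext fun z => ?_
      simp
    have h8 := congrArg (fun l => LinearMap.lTensor (Fn EP P) l
      (Q.pull χ • ℱ.fieldTensor e e' w Y)) hid
    simp only [LinearMap.lTensor_add, LinearMap.lTensor_comp, LinearMap.add_apply,
      LinearMap.comp_apply, h1, h3, map_zero, add_zero, LinearMap.lTensor_id,
      LinearMap.id_apply] at h8
    exact h8.symm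

end

end PrincipalBundle.LiftedAction.GenMetric.Fields
end Heterotic

namespace Heterotic
namespace Reduction

/-! ### Vanishing of the Ricci tensor -/

variable {A B C : Type*} [CommRing A] [Algebra ℝ A] [CommRing B] [Algebra ℝ B] [CommRing C]
  [Algebra ℝ C] {R : Reduction A B} {q : A →ₐ[ℝ] C} {n m : ℕ} {s s' : Fin n → GT A}
  {e e' : Fin m → VF B}

lemma dive_add (n : ℕ) (ϕ : Form1 B) (e e' : Fin m → VF B) {u v : GT A} (hu : u ∈ R.S)
    (hv : v ∈ R.S) : R.dive n ϕ e e' (u + v) = R.dive n ϕ e e' u + R.dive n ϕ e e' v := by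
  simp only [dive, R.proj_add hu hv, PseudoMetric.nabla_add_right, map_add, LinearMap.add_apply,
    Finset.sum_add_distrib, smul_add]
  ring

/-- Every term on the right of `trace_gCurv` is additive in `v`, so `V` can be treated as the sum of
its horizontal and `ad` parts. -/
lemma trace_gCurv_add (hs : R.VFrame q s s') (he : QFrame R.g (q.comp R.pull) e e') (ϕ : Form1 B)
    (Y : VF B) {u v : GT A} (hu : u ∈ R.V) (hv : v ∈ R.V) :
    ∑ i, q (pair (R.gCurv ϕ (s i) (R.low Y) (u + v)) (s' i))
      = ∑ i, q (pair (R.gCurv ϕ (s i) (R.low Y) u) (s' i))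
        + ∑ i, q (pair (R.gCurv ϕ (s i) (R.low Y) v) (s' i)) := by
  have hb : ∀ X {v}, v ∈ R.V → R.br (R.low X) v ∈ R.S := fun X v hv =>
    R.br_mem (R.low_mem X) (R.V_le hv)
  have hp : ∀ X {v}, v ∈ R.V → R.plus (R.br (R.low X) v) ∈ R.S := fun X v hv =>
    R.V_le (R.plus_mem _ (hb X hv))
  have hadd : ∀ X, R.plus (R.br (R.low X) (u + v))
      = R.plus (R.br (R.low X) u) + R.plus (R.br (R.low X) v) := fun X => by
    rw [← R.plus_add (hb X hu) (hb X hv), br, dorfman_add_right]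
  rw [trace_gCurv hs he ϕ Y hu, trace_gCurv hs he ϕ Y hv, trace_gCurv hs he ϕ Y (R.V.add_mem hu hv)]
  simp only [hadd, dive_add n ϕ e e' (hp _ hu) (hp _ hv), dive_add n ϕ e e' (R.V_le hu) (R.V_le hv),
    map_add, br, dorfman_add_left, pair_add_left, Finset.sum_add_distrib]
  ring

lemma nabla3_smul (g : PseudoMetric B) (H : Form3 B) (w : B) (X Y Z W : VF B) :
    g.nabla3 (w • H) X Y Z W = w * g.nabla3 H X Y Z W + X w * H ![Y, Z, W] := by
  simp only [PseudoMetric.nabla3, AlternatingMap.smul_apply, smul_eq_mul, Derivation.leibniz]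
  ring

lemma nabla3_swap (g : PseudoMetric B) (H : Form3 B) (X Y Z W : VF B) :
    g.nabla3 H X Y W Z = -g.nabla3 H X Y Z W := by
  simp only [PseudoMetric.nabla3]
  rw [form3_swap23 H Y Z W, form3_swap23 H (g.nabla X Y) Z W, form3_swap23 H Y Z (g.nabla X W),
    form3_swap23 H Y (g.nabla X Z) W, map_neg]
  ring

lemma sharp_apply (he : QFrame R.g (q.comp R.pull) e e') (η : Form1 B) (φ : B) :
    q (R.pull (R.g.sharp η φ)) = ∑ j, q (R.pull (η (e' j))) * q (R.pull (e j φ)) := by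
  have h := he.expand (fun X => q (R.pull (X φ))) ⟨fun X Y => by simp, fun f X => by simp⟩
    (R.g.sharp η)
  simpa only [PseudoMetric.toForm_sharp, AlgHom.comp_apply] using h

/-- With `dw = -2w dφ`, the weighted codifferential of `H` is `-2w` times the skew part of the Ricci
tensor in `trace_gCurv_lift`. -/
lemma q_dstar (he : QFrame R.g (q.comp R.pull) e e') {φ w : B}
    (hw : ∀ X : VF B, X w = (-2 : ℝ) • (w * X φ)) (Y Z : VF B) :
    q (R.pull (-∑ j, R.g.nabla3 (w • R.H) (e j) (e' j) Y Z))
      = (-2 : ℝ) • (q (R.pull w) * q (R.pull ((1 / 2 : ℝ) • ∑ j, R.g.nabla3 R.H (e j) (e' j) Y Z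
          - R.g.sharp (contr2 R.H Y Z) φ))) := by
  have h := sharp_apply he (contr2 R.H Y Z) φ
  simp only [contr2_apply, form3_rotate R.H (e' _) Y Z] at h
  simp only [nabla3_smul, hw, Finset.sum_add_distrib, map_neg, map_add, map_sub, map_sum, map_mul,
    map_smul, h, ← Finset.mul_sum]
  have h2 : ∑ j, (-2 : ℝ) • (q (R.pull w) * q (R.pull (e j φ))) * q (R.pull (R.H ![e' j, Y, Z]))
      = (-2 : ℝ) • (q (R.pull w) * ∑ j, q (R.pull (R.H ![e' j, Y, Z])) * q (R.pull (e j φ))) := by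
    rw [Finset.mul_sum, Finset.smul_sum]
    exact Finset.sum_congr rfl fun j _ => by algebra
  rw [h2]
  algebra

lemma cv_trace_symm (he : QFrame R.g (q.comp R.pull) e e') (Y Z : VF B) :
    ∑ j, q (pair (R.cv Y (e j)) (R.cv Z (e' j))) = ∑ j, q (pair (R.cv Z (e j)) (R.cv Y (e' j))) := by
  have lin : ∀ (Y : VF B) {r : GT A}, R.IsAd r →
      QLin (q.comp R.pull) fun U => q (pair (R.cv Y U) r) := fun Y r hr =>
    ⟨fun X X' => by simp only [hr.pair_cv, br_lam_add, pair_add_left, map_add], fun f X => by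
      simp only [hr.pair_cv, hr.pair_br_lam_smul, map_mul, AlgHom.comp_apply]⟩
  have h := he.trace_swap (fun U W => q (pair (R.cv Z U) (R.cv Y W))) (fun W => lin Z (R.isAd_cv Y W))
    (fun U => by
      have := lin Y (R.isAd_cv Z U)
      simpa only [pair_symm (R.cv Z U)] using this)
  rw [← h]
  exact Finset.sum_congr rfl fun j _ => by rw [pair_symm]

/-- The Ricci tensor vanishes if and only if its symmetric and skew-symmetric parts on `V_- ⊗ T` and
its part on `V_- ⊗ ad` vanish. -/
theorem ricci_eq_zero_iff (hs : R.VFrame q s s') (he : QFrame R.g (q.comp R.pull) e e')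
    {ϕ : Form1 B} {φ w : B} (hϕ : (((n : ℝ) - 1) / 3) • ϕ = (-2 : ℝ) • dFn φ)
    (hw : ∀ X : VF B, X w = (-2 : ℝ) • (w * X φ)) (hu : IsUnit (q (R.pull w))) :
    (∀ Y, ∀ v ∈ R.V, ∑ i, q (pair (R.gCurv ϕ (s i) (R.low Y) v) (s' i)) = 0) ↔
      (∀ Y Z, q (R.pull (∑ j, R.g.toForm (curv R.g.nabla (e j) Y Z) (e' j)
          + (2 : ℝ) • (Y (Z φ) - R.g.nabla Y Z φ)
          - (1 / 4 : ℝ) • ∑ j, ∑ k, R.H ![e j, Y, e k] * R.H ![e' j, Z, e' k]))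
        - ∑ j, q (pair (R.cv Y (e j)) (R.cv Z (e' j))) = 0) ∧
      (∀ Y Z, q (R.pull (-∑ j, R.g.nabla3 (w • R.H) (e j) (e' j) Y Z)) = 0) ∧
      ∀ Y r, R.IsAd r → q (pair (R.fieldEq e e' w Y) r) = 0 := by
  have two_inj : ∀ {x : C}, (2 : ℝ) • x = 0 → x = 0 := fun {x} h =>
    (smul_eq_zero_iff_right (by norm_num : (2 : ℝ) ≠ 0)).mp h
  have skew : ∀ Y Z, q (R.pull ((1 / 2 : ℝ) • ∑ j, R.g.nabla3 R.H (e j) (e' j) Z Y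
      - R.g.sharp (contr2 R.H Z Y) φ)) = -q (R.pull ((1 / 2 : ℝ) • ∑ j, R.g.nabla3 R.H (e j) (e' j) Y Z
      - R.g.sharp (contr2 R.H Y Z) φ)) := fun Y Z => by
    simp only [map_sub, sharp_apply he, contr2_apply, nabla3_swap R.g R.H _ _ Y Z,
      form3_swap12 R.H Y Z, map_neg, neg_mul, Finset.sum_neg_distrib, smul_neg]
    ring
  have symm : ∀ Y Z, q (R.pull (∑ j, R.g.toForm (curv R.g.nabla (e j) Z Y) (e' j)
          + (2 : ℝ) • (Z (Y φ) - R.g.nabla Z Y φ)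
          - (1 / 4 : ℝ) • ∑ j, ∑ k, R.H ![e j, Z, e k] * R.H ![e' j, Y, e' k]))
        - ∑ j, q (pair (R.cv Z (e j)) (R.cv Y (e' j)))
      = q (R.pull (∑ j, R.g.toForm (curv R.g.nabla (e j) Y Z) (e' j)
          + (2 : ℝ) • (Y (Z φ) - R.g.nabla Y Z φ)
          - (1 / 4 : ℝ) • ∑ j, ∑ k, R.H ![e j, Y, e k] * R.H ![e' j, Z, e' k]))
        - ∑ j, q (pair (R.cv Y (e j)) (R.cv Z (e' j))) := fun Y Z => by
    have h1 := he.ric_symm Y Z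
    have h2 := he.HH_symm R.H Y Z
    have h3 : Y (Z φ) - R.g.nabla Y Z φ = Z (Y φ) - R.g.nabla Z Y φ := by
      have h := congrArg (fun X : VF B => X φ) (R.g.nabla_torsion Y Z)
      simp only [Derivation.sub_apply, Derivation.commutator_apply] at h
      linear_combination -h
    simp only [AlgHom.comp_apply] at h1 h2
    rw [cv_trace_symm he Y Z, h3]
    simp only [map_add, map_sub, map_smul, map_sum, map_mul, h1, h2]
  constructor
  · intro h
    -- By `symm` and `skew`, interchanging `Y` and `Z` keeps the first summand and negates the
    -- second, so both vanish when their sum does for all `Y` and `Z`.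
    have hadd : ∀ Y Z, _ + _ = (0 : C) := fun Y Z =>
      (trace_gCurv_lift hs he hϕ Y Z).symm.trans (h Y _ (R.lift_mem Z))
    refine ⟨fun Y Z => ?_, fun Y Z => ?_, fun Y r hr => ?_⟩
    · have h1 := hadd Y Z
      have h2 := hadd Z Y
      rw [symm Y Z, skew Y Z] at h2
      refine two_inj ?_
      linear_combination (norm := algebra) h1 + h2
    · have h1 := hadd Y Z
      have h2 := hadd Z Y
      rw [symm Y Z, skew Y Z] at h2
      have h3 := two_inj (x := q (R.pull ((1 / 2 : ℝ) • ∑ j, R.g.nabla3 R.H (e j) (e' j) Y Z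
          - R.g.sharp (contr2 R.H Y Z) φ))) (by linear_combination (norm := algebra) h1 - h2)
      rw [q_dstar he hw, h3, mul_zero, smul_zero]
    · rw [← trace_gCurv_ad hs he hϕ hw Y hr, h Y r hr.1, mul_zero]
  · rintro ⟨h1, h2, h3⟩ Y v hv
    have hr := R.isAd_adPart hv
    rw [R.V_eq v, trace_gCurv_add hs he ϕ Y (R.lift_mem _) hr.1, trace_gCurv_lift hs he hϕ, h1]
    have k1 := h2 Y (R.proj v)
    rw [q_dstar he hw, smul_eq_zero_iff_right (by norm_num : (-2 : ℝ) ≠ 0),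
      hu.mul_right_eq_zero] at k1
    have k2 := trace_gCurv_ad hs he hϕ hw Y hr
    rw [h3 Y _ hr, hu.mul_right_eq_zero] at k2
    rw [k1, k2]
    simp

end Reduction
end Heterotic

namespace Heterotic

/-! ## Restriction to open sets -/

section Restriction

variable {EG HG G EP P EM M : Type*}
  [NormedAddCommGroup EG] [NormedSpace ℝ EG] [TopologicalSpace HG] {IG : ModelWithCorners ℝ EG HG}
  [TopologicalSpace G] [ChartedSpace HG G] [Group G] [LieGroup IG ∞ G]
  [NormedAddCommGroup EP] [NormedSpace ℝ EP] [TopologicalSpace P] [ChartedSpace EP P]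
  [IsManifold 𝓘(ℝ, EP) ∞ P]
  [NormedAddCommGroup EM] [NormedSpace ℝ EM] [TopologicalSpace M] [ChartedSpace EM M]
  (Q : PrincipalBundle G EP P EM M IG)

namespace PrincipalBundle

/-- Restriction of functions on `P` to the open set over which `χ` does not vanish. -/
noncomputable def restr (χ : Fn EM M) : Fn EP P →ₐ[ℝ] ({p : P // χ (Q.proj p) ≠ 0} → ℝ) where
  toFun f p := f p.1
  map_one' := rfl
  map_mul' _ _ := rfl
  map_zero' := rfl
  map_add' _ _ := rfl
  commutes' _ := rfl

lemma restr_eq_zero (χ : Fn EM M) (f : Fn EP P) : Q.restr χ f = 0 ↔ Q.pull χ * f = 0 := by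
  constructor
  · intro h
    ext p
    change χ (Q.proj p) * f p = 0
    by_cases hp : χ (Q.proj p) = 0
    · rw [hp, zero_mul]
    · have h1 : f p = 0 := congrFun h ⟨p, hp⟩
      rw [h1, mul_zero]
  · intro h
    funext p
    have h1 : χ (Q.proj p.1) * f p.1 = 0 := congrArg (fun u : Fn EP P => u p.1) h
    exact (mul_eq_zero.mp h1).resolve_left p.2

/-- Locality of derivations without cut-off functions: the extra factor `a` in the Leibniz rule for
`a * b = 0` kills the term containing `X a`. -/
lemma mul_derivation_eq_zero {A : Type*} [CommRing A] [Algebra ℝ A] {a b : A} (h : a * b = 0)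
    (X : VF A) : a * a * X b = 0 := by
  have h1 : X (a * b) = 0 := by rw [h, map_zero]
  rw [Derivation.leibniz, smul_eq_mul, smul_eq_mul] at h1
  linear_combination a * h1 - X a * h

lemma restr_derivation (χ : Fn EM M) (X : VF (Fn EP P)) {f : Fn EP P} (h : Q.restr χ f = 0) :
    Q.restr χ (X f) = 0 := by
  have h1 := mul_derivation_eq_zero ((Q.restr_eq_zero χ f).mp h) X
  funext p
  have h2 : χ (Q.proj p.1) * χ (Q.proj p.1) * X f p.1 = 0 :=
    congrArg (fun u : Fn EP P => u p.1) h1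
  exact (mul_eq_zero.mp h2).resolve_left (mul_ne_zero p.2 p.2)

lemma restr_pull_derivation (χ : Fn EM M) (X : VF (Fn EM M)) {f : Fn EM M}
    (h : Q.restr χ (Q.pull f) = 0) : Q.restr χ (Q.pull (X f)) = 0 := by
  have h0 := (Q.restr_eq_zero χ _).mp h
  rw [← map_mul] at h0
  have h1 := mul_derivation_eq_zero (Q.pull_injective (h0.trans (map_zero _).symm)) X
  funext p
  have h2 : χ (Q.proj p.1) * χ (Q.proj p.1) * X f (Q.proj p.1) = 0 :=
    congrArg (fun u : Fn EM M => u (Q.proj p.1)) h1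
  exact (mul_eq_zero.mp h2).resolve_left (mul_ne_zero p.2 p.2)

variable {Q}

open LiftedAction.GenMetric.Fields

lemma qFrame_of_isFrame {g : PseudoMetric (Fn EM M)} {χ χ₁ : Fn EM M}
    {e e' : Fin 10 → VF (Fn EM M)} (he : g.IsFrame χ₁ e e') (hχ : ∀ x, χ x ≠ 0 → χ₁ x ≠ 0) :
    QFrame g ((Q.restr χ).comp Q.pull) e e' where
  dual i j := by
    funext p
    have h := toForm_frame_apply he (hχ _ p.2) i j
    change g.toForm (e i) (e' j) (Q.proj p.1) = _
    rw [h]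
    split_ifs <;> rfl
  expand β hβ X := by
    have h1 := congrArg β (he.2 X)
    have hsum : β (∑ i, g.toForm X (e' i) • e i) = ∑ i, β (g.toForm X (e' i) • e i) :=
      map_sum (AddMonoidHom.mk' β hβ.1) _ _
    rw [hβ.2, hβ.2, hsum] at h1
    simp only [hβ.2] at h1
    funext p
    exact mul_left_cancel₀ (hχ _ p.2) (congrFun h1 p)
  deriv X b hb := Q.restr_pull_derivation χ X hb

variable {c : LinearMap.BilinForm ℝ EG} {L : Q.LiftedAction c} {n : ℕ} {𝒱 : L.GenMetric n}

lemma vFrame_of_isFrame (ℱ : 𝒱.Fields) (hg : FrameExists ℱ.g) (hM : Module.finrank ℝ EM = 10)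
    (h𝒱 : 𝒱.Admissible) {χ χ₁ : Fn EM M} {s s' : Fin n → GT (Fn EP P)}
    (hs : LiftedAction.IsFrame (Q := Q) 𝒱.V χ₁ s s') (hχ : ∀ x, χ x ≠ 0 → χ₁ x ≠ 0) :
    (ℱ.reduction hg hM h𝒱).VFrame (Q.restr χ) s s' where
  mem i := (hs.1 i).1
  mem' i := (hs.1 i).2
  dual i j := by
    funext p
    have h1 : χ₁ (Q.proj p.1) * pair (s i) (s' j) p.1
        = (if i = j then Q.pull χ₁ else 0 : Fn EP P) p.1 :=
      congrArg (fun u : Fn EP P => u p.1) (hs.2.1 i j)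
    change pair (s i) (s' j) p.1 = _
    split_ifs at h1 ⊢
    · exact mul_left_cancel₀ (hχ _ p.2) (h1.trans (mul_one _).symm)
    · exact (mul_eq_zero.mp h1).resolve_left (hχ _ p.2)
  expand F hadd hsmul v hv := by
    have h0 : F 0 = 0 := by simpa using hadd 0 𝒱.V.zero_mem 0 𝒱.V.zero_mem
    have hsum : ∀ (t : Finset (Fin n)) (u : Fin n → GT (Fn EP P)), (∀ i, u i ∈ 𝒱.V) →
        F (∑ i ∈ t, u i) = ∑ i ∈ t, F (u i) := fun t u hu => by
      induction t using Finset.induction_on with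
      | empty => simpa using h0
      | insert a t ha ih =>
        rw [Finset.sum_insert ha, Finset.sum_insert ha,
          hadd _ (hu a) _ (𝒱.V.sum_mem fun i _ => hu i), ih]
    -- `F` is linear only over functions on the base. The frame coefficients are invariant functions
    -- on `P`, hence pulled back from `M`.
    have hb : ∀ i, ∃ b, pair v (s' i) = Q.pull b := fun i =>
      (ℱ.reduction hg hM h𝒱).pair_mem v (𝒱.le hv) _ (𝒱.le (hs.1 i).2)
    choose b hb using hb
    have h1 := hs.2.2 v hv
    simp only [hb] at h1 ⊢
    have hmem : ∀ i, Q.pull (b i) • s i ∈ 𝒱.V := fun i => 𝒱.smul_mem _ _ (hs.1 i).1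
    have h2 : Q.restr χ (Q.pull χ₁) * F v
        = Q.restr χ (Q.pull χ₁) * ∑ i, Q.restr χ (Q.pull (b i)) * F (s i) := by
      refine (hsmul χ₁ v hv).symm.trans ((congrArg F h1).trans ?_)
      refine (hsmul χ₁ _ (𝒱.V.sum_mem fun i _ => hmem i)).trans ?_
      rw [hsum _ _ hmem]
      exact congrArg _ (Finset.sum_congr rfl fun i _ => hsmul _ _ (hs.1 i).1)
    funext p
    exact mul_left_cancel₀ (hχ _ p.2) (congrFun h2 p)
  deriv X a ha := Q.restr_derivation χ X ha

end PrincipalBundle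
end Restriction

/-! ## The field equations -/

namespace PrincipalBundle.LiftedAction.GenMetric.Fields

section Field

variable {EG HG G EP P EM M : Type*}
  [NormedAddCommGroup EG] [NormedSpace ℝ EG] [TopologicalSpace HG] {IG : ModelWithCorners ℝ EG HG}
  [TopologicalSpace G] [ChartedSpace HG G] [Group G] [LieGroup IG ∞ G]
  [NormedAddCommGroup EP] [NormedSpace ℝ EP] [TopologicalSpace P] [ChartedSpace EP P]
  [IsManifold 𝓘(ℝ, EP) ∞ P]
  [NormedAddCommGroup EM] [NormedSpace ℝ EM] [TopologicalSpace M] [ChartedSpace EM M]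
  {Q : PrincipalBundle G EP P EM M IG} {c : LinearMap.BilinForm ℝ EG} {L : Q.LiftedAction c}
  {n : ℕ} {𝒱 : L.GenMetric n} (ℱ : 𝒱.Fields) (hg : FrameExists ℱ.g)
  (hM : Module.finrank ℝ EM = 10) (h𝒱 : 𝒱.Admissible)

lemma form_ad {u : GT (Fn EP P)} (hu : u ∈ L.sections) :
    ℱ.conn.form ((ℱ.reduction hg hM h𝒱).ad u).1 = ℱ.conn.form u.1 := by
  have h := congrArg (fun u : GT (Fn EP P) => ℱ.conn.form u.1) ((ℱ.reduction hg hM h𝒱).ad_eq hu)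
  simp only [Prod.fst_add, map_add, Reduction.flat_fst, add_zero] at h
  refine Eq.trans ?_ h.symm
  exact (zero_add _).symm.trans (congrArg (· + _) (ℱ.conn_lam _).symm)

lemma form_cv (X Y : VF (Fn EM M)) :
    ℱ.conn.form ((ℱ.reduction hg hM h𝒱).cv X Y).1 = -ℱ.curvature X Y := by
  rw [curvature, neg_neg]
  exact ℱ.form_ad hg hM h𝒱 (L.dorfman_mem_sections (ℱ.lam_mem X) (ℱ.lam_mem Y))

variable [FiniteDimensional ℝ EP] [T2Space P] (hQ : VerticalIsFund Q)
include hQ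

lemma cPair_form_ad {u r : GT (Fn EP P)} (hu : u ∈ L.sections)
    (hr : (ℱ.reduction hg hM h𝒱).IsAd r) :
    L.cPair (ℱ.conn.form u.1) (ℱ.conn.form r.1) = pair u r := by
  rw [ℱ.cPair_form hQ hg hM h𝒱 hu hr.mem_S, Reduction.adPair_V hu hr.1,
    (ℱ.reduction hg hM h𝒱).adPart_of_isAd hr]

lemma pair_cv_cv (X Y Z W : VF (Fn EM M)) :
    pair ((ℱ.reduction hg hM h𝒱).cv X Y) ((ℱ.reduction hg hM h𝒱).cv Z W)
      = L.cPair (ℱ.curvature X Y) (ℱ.curvature Z W) := by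
  rw [← ℱ.cPair_form_ad hg hM h𝒱 hQ ((ℱ.reduction hg hM h𝒱).isAd_cv X Y).mem_S
    ((ℱ.reduction hg hM h𝒱).isAd_cv Z W), form_cv, form_cv, cPair, cPair, map_neg, map_neg,
    LinearMap.neg_apply, neg_neg]

lemma form_br_lam (X : VF (Fn EM M)) {r : GT (Fn EP P)} (hr : (ℱ.reduction hg hM h𝒱).IsAd r) :
    ℱ.conn.form ((ℱ.reduction hg hM h𝒱).ad ((ℱ.reduction hg hM h𝒱).br (ℱ.lam X) r)).1
      = ℱ.covD X (ℱ.conn.form r.1) := by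
  have h0 : Q.push r.1 = 0 := hr.2
  have h1 : ℱ.lam 0 = 0 := (ℱ.reduction hg hM h𝒱).lam_zero
  refine (ℱ.form_ad hg hM h𝒱 (L.dorfman_mem_sections (ℱ.lam_mem X) hr.mem_S)).trans ?_
  rw [ℱ.covD_form hQ X hr.mem_S, h0, h1, sub_zero]

end Field
end PrincipalBundle.LiftedAction.GenMetric.Fields
end Heterotic

/-! ### The equivalence of Ricci flatness and the heterotic equations. -/

namespace Heterotic
namespace PrincipalBundle.LiftedAction.GenMetric.Fields

variable {EK K ES S EP P EM M : Type*}
  [NormedAddCommGroup EK] [NormedSpace ℝ EK]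
  [TopologicalSpace K] [ChartedSpace EK K] [Group K] [LieGroup 𝓘(ℝ, EK) ∞ K]
  [NormedAddCommGroup ES] [NormedSpace ℝ ES]
  [TopologicalSpace S] [ChartedSpace ES S] [Group S] [LieGroup 𝓘(ℝ, ES) ∞ S]
  [NormedAddCommGroup EP] [NormedSpace ℝ EP] [TopologicalSpace P] [ChartedSpace EP P]
  [IsManifold 𝓘(ℝ, EP) ∞ P] [FiniteDimensional ℝ EP] [T2Space P]
  [NormedAddCommGroup EM] [NormedSpace ℝ EM] [TopologicalSpace M] [ChartedSpace EM M]
  {ι : SLIso ES S} {Q : PrincipalBundle (K × S) EP P EM M (𝓘(ℝ, EK).prod 𝓘(ℝ, ES))}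

section Tensor

variable {c : LinearMap.BilinForm ℝ (EK × ES)} {L : Q.LiftedAction c} {n : ℕ} {𝒱 : L.GenMetric n}
  (ℱ : 𝒱.Fields) (hg : FrameExists ℱ.g) (hM : Module.finrank ℝ EM = 10) (h𝒱 : 𝒱.Admissible)
  (hQ : VerticalIsFund Q) (χ : Fn EM M) (e e' : Fin 10 → VF (Fn EM M)) (w : Fn EM M)
  (Y : VF (Fn EM M))
include hQ

lemma form_fieldEq : ℱ.conn.form ((ℱ.reduction hg hM h𝒱).fieldEq e e' w Y).1
    = ℱ.fieldTensor e e' w Y := by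
  have hb : ∀ j, ℱ.conn.form ((ℱ.reduction hg hM h𝒱).ad ((ℱ.reduction hg hM h𝒱).br
      ((ℱ.reduction hg hM h𝒱).lam (e j)) ((ℱ.reduction hg hM h𝒱).pull w •
        (ℱ.reduction hg hM h𝒱).cv (e' j) Y))).1
      = -ℱ.covD (e j) (Q.pull w • ℱ.curvature (e' j) Y) := fun j => by
    refine (ℱ.form_br_lam hg hM h𝒱 hQ (e j) (((ℱ.reduction hg hM h𝒱).isAd_cv _ _).smul w)).trans ?_
    rw [Prod.smul_fst, map_smul, form_cv, smul_neg, covD, map_neg]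
    rfl
  have h2 : ∀ j k, ℱ.conn.form ((ℱ.reduction hg hM h𝒱).pull ((ℱ.reduction hg hM h𝒱).H
      ![e' j, Y, e k]) • (ℱ.reduction hg hM h𝒱).cv (e j) (e' k)).1
      = -(Q.pull (ℱ.H ![e' j, Y, e k]) • ℱ.curvature (e j) (e' k)) := fun j k => by
    rw [Prod.smul_fst, map_smul, form_cv, smul_neg]
    rfl
  have h3 : ∀ X Z, ℱ.conn.form ((ℱ.reduction hg hM h𝒱).pull w • (ℱ.reduction hg hM h𝒱).cv X Z).1
      = -(Q.pull w • ℱ.curvature X Z) := fun X Z => by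
    rw [Prod.smul_fst, map_smul, form_cv, smul_neg]
    rfl
  simp only [Reduction.fieldEq, Prod.fst_add, Prod.fst_sum, Prod.fst_sub, map_add,
    map_sum, map_sub, hb, h3, fieldTensor]
  rw [Prod.smul_fst, map_smul]
  simp only [Prod.fst_sum, map_sum, h2, Finset.sum_neg_distrib]
  refine congrArg₂ (· + ·) ?_ rfl
  rw [← Finset.sum_neg_distrib]
  refine Finset.sum_congr rfl fun j _ => ?_
  rw [neg_sub, sub_neg_eq_add, sub_neg_eq_add]
  change -_ + Q.pull w • ℱ.curvature (ℱ.g.nabla (e j) (e' j)) Y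
    + Q.pull w • ℱ.curvature (e' j) (ℱ.g.nabla (e j) Y) = _
  abel

/-- The field tensor is the value of the connection form on `fieldEq`. A section of `ad` vanishes
once its pairings with `ad` do, because pairing it with any section of `E` sees only the
`ad`-component of that section. -/
lemma smul_fieldTensor_iff : Q.pull χ • ℱ.fieldTensor e e' w Y = 0 ↔
    ∀ r, (ℱ.reduction hg hM h𝒱).IsAd r →
      Q.pull χ * pair ((ℱ.reduction hg hM h𝒱).fieldEq e e' w Y) r = 0 := by
  have hF := (ℱ.reduction hg hM h𝒱).isAd_fieldEq e e' w Y
  have hform : ℱ.conn.form (Q.pull χ • (ℱ.reduction hg hM h𝒱).fieldEq e e' w Y).1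
      = Q.pull χ • ℱ.fieldTensor e e' w Y := by
    rw [Prod.smul_fst, map_smul, form_fieldEq ℱ hg hM h𝒱 hQ]
  have hF' : (ℱ.reduction hg hM h𝒱).IsAd (Q.pull χ • (ℱ.reduction hg hM h𝒱).fieldEq e e' w Y) :=
    hF.smul χ
  constructor
  · intro h r hr
    rw [← pair_smul_left', ← ℱ.cPair_form_ad hg hM h𝒱 hQ hF'.mem_S hr, hform, h, cPair]
    simp
  · intro h
    have h0 : Q.pull χ • (ℱ.reduction hg hM h𝒱).fieldEq e e' w Y = 0 :=
      h𝒱.2.nondeg hF'.mem_S fun f hf => by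
        rw [(ℱ.reduction hg hM h𝒱).pair_isAd_eq hf hF', pair_smul_left',
          h _ ((ℱ.reduction hg hM h𝒱).isAd_ad hf)]
    rw [← hform, h0]
    simp

end Tensor

section Main

variable {α κ : ℝ} {trk : LinearMap.BilinForm ℝ EK} {L : Q.LiftedAction (ι.pairing α κ trk)}
  {n : ℕ} {𝒱 : L.GenMetric n} (ℱ : 𝒱.Fields) (θ : SolderForm ι Q) (hg : FrameExists ℱ.g)
  (hM : Module.finrank ℝ EM = 10) (h𝒱 : 𝒱.Admissible) [FiniteDimensional ℝ EM]
  [IsManifold 𝓘(ℝ, EM) ∞ M] [T2Space M] {χ : Fn EM M} {e e' : Fin 10 → VF (Fn EM M)}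
  {nablaT : VF (Fn EM M) → VF (Fn EM M) → VF (Fn EM M)} (hT : ℱ.Induces θ nablaT) (φ : Fn EM M)

omit [FiniteDimensional ℝ EP] [T2Space P] in
lemma vf_expFn (X : VF (Fn EM M)) :
    X (expFn (-2 * φ)) = (-2 : ℝ) • (expFn (-2 * φ) * X φ) := by
  have h : X (-2 * φ) = (-2 : ℝ) • X φ := by
    have h1 : (-2 * φ : Fn EM M) = -(φ + φ) := by ring
    rw [h1, map_neg, map_add, neg_smul, two_smul]
  rw [derivation_expFn, h, mul_smul_comm]

include hg in
-- The constant `-6` is chosen for this: the trace factor `(n-1)/3` turns it into `-2`. The point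
-- `x` is needed for the bound `10 ≤ n`.
lemma weyl_smul (x : M) :
    (((n : ℝ) - 1) / 3) • ((-6 / ((n : ℝ) - 1)) • dFn φ) = (-2 : ℝ) • dFn φ := by
  have h10 : (10 : ℝ) ≤ n := by exact_mod_cast ℱ.le_rank hg x
  have hne : (n : ℝ) - 1 ≠ 0 := by linarith
  rw [smul_smul]
  congr 1
  field_simp
  norm_num

include hT

/-- The block form of `c = α (κ Tr - tr_𝔨)` is the source of the opposite signs of the gravitational
and gauge terms in both the Einstein and the Bianchi equation. -/
lemma pair_cv_cv_apply (he : ℱ.g.IsFrame χ e e') {p : P} (hp : χ (Q.proj p) ≠ 0)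
    (X Y Z W : VF (Fn EM M)) :
    pair ((ℱ.reduction hg hM h𝒱).cv X Y) ((ℱ.reduction hg hM h𝒱).cv Z W) p
      = α * κ * ℱ.trR e e' nablaT X Y Z W (Q.proj p)
        - α * trk.baseChange (Fn EP P) (ℱ.FA X Y) (ℱ.FA Z W) p := by
  rw [ℱ.pair_cv_cv hg hM h𝒱 (ℱ.verticalIsFund hg hM h𝒱 θ), cPair, ι.pairing_baseChange,
    ℱ.trR_eq θ hg hM h𝒱 hT he hp]
  rfl

/-- The Einstein equation as the symmetric part of the Ricci tensor. -/
lemma einstein_apply (he : ℱ.g.IsFrame χ e e') {p : P} (hp : χ (Q.proj p) ≠ 0)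
    (Y Z : VF (Fn EM M)) :
    (Q.pull (ℱ.ric e e' Y Z + (2 : ℝ) • ℱ.hess φ Y Z
      - (1 / 4 : ℝ) • ℱ.HH e e' Y Z - (α * κ) • ℱ.trRR e e' nablaT Y Z)
      + α • ℱ.trFF e e' trk Y Z) p
    = Q.pull (ℱ.ric e e' Y Z + (2 : ℝ) • ℱ.hess φ Y Z - (1 / 4 : ℝ) • ℱ.HH e e' Y Z) p
      - ∑ j, pair ((ℱ.reduction hg hM h𝒱).cv Y (e j)) ((ℱ.reduction hg hM h𝒱).cv Z (e' j)) p := by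
  simp only [ℱ.pair_cv_cv_apply θ hg hM h𝒱 hT he hp, Finset.sum_sub_distrib, ← Finset.mul_sum]
  have h1 : ℱ.trRR e e' nablaT Y Z (Q.proj p)
      = ∑ j, ℱ.trR e e' nablaT Y (e j) Z (e' j) (Q.proj p) := fn_sum_apply _ _ _
  have h2 : ℱ.trFF e e' trk Y Z p
      = ∑ j, trk.baseChange (Fn EP P) (ℱ.FA Y (e j)) (ℱ.FA Z (e' j)) p := fn_sum_apply _ _ _
  rw [← h1, ← h2, map_sub]
  change _ - α * κ * _ + α * _ = _ - (_ - _)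
  ring

include hg hM h𝒱 in
/-- The Bianchi identity. -/
lemma bianchi (he : ℱ.g.IsFrame χ e e') (X Y Z W : VF (Fn EM M)) :
    Q.pull (χ * d3 ℱ.H X Y Z W) = Q.pull χ *
      (Q.pull ((2 * α * κ) • (ℱ.trR e e' nablaT X Y Z W - ℱ.trR e e' nablaT X Z Y W
        + ℱ.trR e e' nablaT X W Y Z))
      - (2 * α) • (trk.baseChange (Fn EP P) (ℱ.FA X Y) (ℱ.FA Z W)
        - trk.baseChange (Fn EP P) (ℱ.FA X Z) (ℱ.FA Y W)
        + trk.baseChange (Fn EP P) (ℱ.FA X W) (ℱ.FA Y Z))) := by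
  have h := (ℱ.reduction hg hM h𝒱).pull_d3 X Y Z W
  rw [map_mul]
  ext p
  by_cases hp : χ (Q.proj p) = 0
  · change χ (Q.proj p) * _ = χ (Q.proj p) * _
    rw [hp, zero_mul, zero_mul]
  have h1 : Q.pull (d3 ℱ.H X Y Z W) p = 2 * (pair ((ℱ.reduction hg hM h𝒱).cv X Y)
      ((ℱ.reduction hg hM h𝒱).cv Z W) p - pair ((ℱ.reduction hg hM h𝒱).cv X Z)
      ((ℱ.reduction hg hM h𝒱).cv Y W) p + pair ((ℱ.reduction hg hM h𝒱).cv X W)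
      ((ℱ.reduction hg hM h𝒱).cv Y Z) p) := congrArg (fun u : Fn EP P => u p) h
  simp only [ℱ.pair_cv_cv_apply θ hg hM h𝒱 hT he hp] at h1
  change χ (Q.proj p) * Q.pull (d3 ℱ.H X Y Z W) p = χ (Q.proj p) * (2 * α * κ *
    (ℱ.trR e e' nablaT X Y Z W (Q.proj p) - ℱ.trR e e' nablaT X Z Y W (Q.proj p)
      + ℱ.trR e e' nablaT X W Y Z (Q.proj p)) - 2 * α *
    (trk.baseChange (Fn EP P) (ℱ.FA X Y) (ℱ.FA Z W) p
      - trk.baseChange (Fn EP P) (ℱ.FA X Z) (ℱ.FA Y W) p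
      + trk.baseChange (Fn EP P) (ℱ.FA X W) (ℱ.FA Y Z) p))
  rw [h1]
  ring

omit hT in
include hg hM h𝒱 θ in
/-- The trace that defines the Ricci tensor, in terms of the algebraic connection. -/
lemma GRic_apply (ϕ : Form1 (Fn EM M)) {s s' : Fin n → GT (Fn EP P)}
    (hs : ∀ i, s i ∈ 𝒱.V) (Y : VF (Fn EM M)) {v : GT (Fn EP P)} (hv : v ∈ 𝒱.V) (p : P) :
    ℱ.GRic ϕ s s' ((ℱ.reduction hg hM h𝒱).low Y) v p
      = ∑ i, pair ((ℱ.reduction hg hM h𝒱).gCurv ϕ (s i) ((ℱ.reduction hg hM h𝒱).low Y) v)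
        (s' i) p := by
  rw [GRic, fn_sum_apply]
  refine Finset.sum_congr rfl fun i _ => ?_
  rw [ℱ.GR_eq (ℱ.verticalIsFund hg hM h𝒱 θ) hg hM h𝒱 ϕ (𝒱.le (hs i))
    ((ℱ.reduction hg hM h𝒱).low_mem Y) hv]

omit hT in
include θ in
/-- Vanishing of the Ricci tensor over the open set on which both `TM` and `V_+` have a frame. -/
lemma GRic_eq_zero_iff {χ₁ χ₂ : Fn EM M} {s s' : Fin n → GT (Fn EP P)}
    (he : ℱ.g.IsFrame χ₁ e e') (hs : IsFrame (Q := Q) 𝒱.V χ₂ s s') (x : M) :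
    (∀ Y, ∀ v ∈ 𝒱.V, ∀ p, (χ₁ * χ₂) (Q.proj p) ≠ 0 → ℱ.GRic ((-6 / ((n : ℝ) - 1)) • dFn φ) s s'
        ((ℱ.reduction hg hM h𝒱).low Y) v p = 0) ↔
      ∀ p, (χ₁ * χ₂) (Q.proj p) ≠ 0 →
        (∀ Y Z, Q.pull (ℱ.ric e e' Y Z + (2 : ℝ) • ℱ.hess φ Y Z - (1 / 4 : ℝ) • ℱ.HH e e' Y Z) p
          - ∑ j, pair ((ℱ.reduction hg hM h𝒱).cv Y (e j))
            ((ℱ.reduction hg hM h𝒱).cv Z (e' j)) p = 0) ∧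
        (∀ Y Z, ℱ.dstarH e e' (expFn (-2 * φ)) Y Z (Q.proj p) = 0) ∧
        ∀ Y r, (ℱ.reduction hg hM h𝒱).IsAd r →
          pair ((ℱ.reduction hg hM h𝒱).fieldEq e e' (expFn (-2 * φ)) Y) r p = 0 := by
  -- Restriction to the set where `χ₁ * χ₂` does not vanish makes both frames valid. The weight is a
  -- unit there, being an exponential.
  have core := (ℱ.reduction hg hM h𝒱).ricci_eq_zero_iff (q := Q.restr (χ₁ * χ₂))
    (vFrame_of_isFrame ℱ hg hM h𝒱 hs fun _ h => right_ne_zero_of_mul h)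
    (qFrame_of_isFrame he fun _ h => left_ne_zero_of_mul h)
    (ℱ.weyl_smul hg φ x) (vf_expFn φ)
    (Pi.isUnit_iff.mpr fun p => isUnit_iff_ne_zero.mpr (Real.exp_pos _).ne')
  have hGR : ∀ Y, ∀ v ∈ 𝒱.V, ∀ p, ℱ.GRic ((-6 / ((n : ℝ) - 1)) • dFn φ) s s'
      ((ℱ.reduction hg hM h𝒱).low Y) v p = _ :=
    fun Y v hv p => ℱ.GRic_apply θ hg hM h𝒱 _ (fun i => (hs.1 i).1) Y hv p
  constructor
  · intro h p hp
    obtain ⟨h1, h2, h3⟩ := core.mp fun Y v hv => by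
      funext p'
      rw [Finset.sum_apply]
      exact (hGR Y v hv p'.1).symm.trans (h Y v hv p'.1 p'.2)
    refine ⟨fun Y Z => ?_, fun Y Z => congrFun (h2 Y Z) ⟨p, hp⟩,
      fun Y r hr => congrFun (h3 Y r hr) ⟨p, hp⟩⟩
    have h4 := congrFun (h1 Y Z) ⟨p, hp⟩
    rw [Pi.sub_apply, Finset.sum_apply] at h4
    exact h4
  · intro h Y v hv p hp
    have h1 := core.mpr ⟨fun Y Z => ?_, fun Y Z => funext fun p' => (h p'.1 p'.2).2.1 Y Z,
      fun Y r hr => funext fun p' => (h p'.1 p'.2).2.2 Y r hr⟩ Y v hv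
    · rw [hGR Y v hv p]
      have h2 := congrFun h1 ⟨p, hp⟩
      rw [Finset.sum_apply] at h2
      exact h2
    · funext p'
      rw [Pi.sub_apply, Finset.sum_apply]
      exact (h p'.1 p'.2).1 Y Z

include hg hM h𝒱

/-- One side is tested in frames of `V_+`, the other in frames of `TM`. In each direction the
missing frame is chosen near a given point, and the comparison is made where both exist. The Bianchi
identity is supplied by `bianchi`. -/
theorem ricciFlat_iff : ℱ.RicciFlat ((-6 / ((n : ℝ) - 1)) • dFn φ) ↔
    ℱ.HeteroticEquations α κ trk nablaT φ := by
  have hQ := ℱ.verticalIsFund hg hM h𝒱 θ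
  constructor
  · intro hR χ e e' he
    have key := fun (p : P) (hp : χ (Q.proj p) ≠ 0) =>
      let ⟨_, s, s', hχ₂, hs⟩ := 𝒱.hasRank (Q.proj p)
      (ℱ.GRic_eq_zero_iff θ hg hM h𝒱 φ he hs (Q.proj p)).mp (fun Y v hv p' hp' => by
        have h1 := hR _ s s' hs ((ℱ.reduction hg hM h𝒱).low Y)
          ⟨(ℱ.reduction hg hM h𝒱).low_mem Y,
            fun v hv => (ℱ.reduction hg hM h𝒱).pair_low_V hv Y⟩ v hv
        exact (mul_eq_zero.mp (congrArg (fun u : Fn EP P => u p') h1)).resolve_left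
          (right_ne_zero_of_mul hp')) p (mul_ne_zero hp hχ₂)
    have hfield := fun Y => (ℱ.smul_fieldTensor_eq_zero_iff θ hg hM h𝒱 hT he _ Y).mp
      ((ℱ.smul_fieldTensor_iff hg hM h𝒱 hQ χ e e' (expFn (-2 * φ)) Y).mpr fun r hr => by
        ext p
        by_cases hp : χ (Q.proj p) = 0
        · exact mul_eq_zero_of_left hp _
        · exact mul_eq_zero_of_right _ ((key p hp).2.2 Y r hr))
    refine ⟨fun Y Z => ?_, fun Y Z => ?_, fun Y => (hfield Y).1, fun Y => (hfield Y).2,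
      ℱ.bianchi θ hg hM h𝒱 hT he⟩
    · ext p
      by_cases hp : χ (Q.proj p) = 0
      · exact mul_eq_zero_of_left hp _
      · exact mul_eq_zero_of_right _
          ((ℱ.einstein_apply θ hg hM h𝒱 hT φ he hp Y Z).trans ((key p hp).1 Y Z))
    · ext x
      obtain ⟨p, rfl⟩ := Q.proj_surjective x
      by_cases hp : χ (Q.proj p) = 0
      · exact mul_eq_zero_of_left hp _
      · exact mul_eq_zero_of_right _ ((key p hp).2.1 Y Z)
  · intro hE χ₂ s s' hs e₂ he₂ v hv
    -- Every section of `V_-` is the `Y^-` of its projection, so it suffices to treat these.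
    rw [(ℱ.reduction hg hM h𝒱).eq_low_of_orth he₂.1 he₂.2]
    ext p
    by_cases hp : χ₂ (Q.proj p) = 0
    · exact mul_eq_zero_of_left hp _
    refine mul_eq_zero_of_right _ ?_
    obtain ⟨χ₁, e, e', hχ₁, he⟩ := hg (Q.proj p)
    obtain ⟨h1, h2, h3, h4, -⟩ := hE χ₁ e e' he
    refine (ℱ.GRic_eq_zero_iff θ hg hM h𝒱 φ he hs (Q.proj p)).mpr (fun p' hp' => ?_) _ v hv p
      (mul_ne_zero hχ₁ hp)
    have hp₁ : χ₁ (Q.proj p') ≠ 0 := left_ne_zero_of_mul hp'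
    refine ⟨fun Y Z => ?_, fun Y Z => ?_, fun Y r hr => ?_⟩
    · rw [← ℱ.einstein_apply θ hg hM h𝒱 hT φ he hp₁ Y Z]
      exact (mul_eq_zero.mp (congrArg (fun u : Fn EP P => u p') (h1 Y Z))).resolve_left hp₁
    · exact (mul_eq_zero.mp (congrArg (fun u : Fn EM M => u (Q.proj p')) (h2 Y Z))).resolve_left hp₁
    · have h := (ℱ.smul_fieldTensor_iff hg hM h𝒱 hQ χ₁ e e' (expFn (-2 * φ)) Y).mp
        ((ℱ.smul_fieldTensor_eq_zero_iff θ hg hM h𝒱 hT he _ Y).mpr ⟨h3 Y, h4 Y⟩) r hr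
      exact (mul_eq_zero.mp (congrArg (fun u : Fn EP P => u p') h)).resolve_left hp₁

end Main

end PrincipalBundle.LiftedAction.GenMetric.Fields

lemma PseudoMetric.IsLorentzian.frameExists {EM M : Type*} [NormedAddCommGroup EM]
    [NormedSpace ℝ EM] [TopologicalSpace M] [ChartedSpace EM M] {g : PseudoMetric (Fn EM M)}
    (hg : g.IsLorentzian) : PrincipalBundle.LiftedAction.GenMetric.Fields.FrameExists g := fun x => by
  rcases hg with h | h <;> obtain ⟨χ, e, hχ, he⟩ := h x <;> exact ⟨χ, e, _, hχ, he⟩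

end Heterotic

theorem mainTheorem1 {EK K ES S EP P M : Type*}
    [NormedAddCommGroup EK] [NormedSpace ℝ EK] [FiniteDimensional ℝ EK]
    [TopologicalSpace K] [ChartedSpace EK K] [Group K] [LieGroup 𝓘(ℝ, EK) ∞ K]
    [T2Space K] [CompactSpace K]
    [NormedAddCommGroup ES] [NormedSpace ℝ ES] [FiniteDimensional ℝ ES]
    [TopologicalSpace S] [ChartedSpace ES S] [Group S] [LieGroup 𝓘(ℝ, ES) ∞ S]
    [NormedAddCommGroup EP] [NormedSpace ℝ EP] [FiniteDimensional ℝ EP]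
    [TopologicalSpace P] [ChartedSpace EP P] [IsManifold 𝓘(ℝ, EP) ∞ P]
    [T2Space P] [SigmaCompactSpace P]
    [TopologicalSpace M] [ChartedSpace (EuclideanSpace ℝ (Fin 10)) M]
    [IsManifold 𝓘(ℝ, EuclideanSpace ℝ (Fin 10)) ∞ M] [T2Space M] [SigmaCompactSpace M]
    (ι : SLIso ES S)
    (Q : PrincipalBundle (K × S) EP P (EuclideanSpace ℝ (Fin 10)) M (𝓘(ℝ, EK).prod 𝓘(ℝ, ES)))
    (θ : SolderForm ι Q)
    (α κ : ℝ) (hα : 0 < α) (hκ : κ ≠ 0)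
    (trk : LinearMap.BilinForm ℝ EK) (trk_symm : trk.IsSymm) (trk_nondeg : trk.Nondegenerate)
    (trk_inv : ∀ (k : K) z w, trk (Ad 𝓘(ℝ, EK) k z) (Ad 𝓘(ℝ, EK) k w) = trk z w)
    (L : Q.LiftedAction (ι.pairing α κ trk))
    {n : ℕ} (𝒱 : L.GenMetric n) (h𝒱 : 𝒱.Admissible)
    (ℱ : 𝒱.Fields) (hg : ℱ.g.IsLorentzian)
    (nablaT : VF (Fn (EuclideanSpace ℝ (Fin 10)) M) → VF (Fn (EuclideanSpace ℝ (Fin 10)) M) →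
      VF (Fn (EuclideanSpace ℝ (Fin 10)) M))
    (hT : ℱ.Induces θ nablaT) (hTg : ℱ.IsMetric nablaT)
    (φ : Fn (EuclideanSpace ℝ (Fin 10)) M) :
    ℱ.RicciFlat ((-6 / ((n : ℝ) - 1)) • dFn φ) ↔
      ℱ.HeteroticEquations α κ trk nablaT φ := by
  exact ℱ.ricciFlat_iff θ hg.frameExists finrank_euclideanSpace_fin h𝒱 hT φ
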